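/- Notation. Let $\alpha,\mu,\beta\in(0,1]$ and $\xi>0$. Let $\mathcal L=1-\hat T_{-1}$ be the Laplacian of the directed integer line, $\mathcal L_{ij}=\delta_{ij}-\delta_{i+1,j}$ ($i,j\in\mathbb Z$). For a function $g$, smooth near $1$, let $g(\mathcal L)$ be the upper triangular circulant matrix with generating function $g(1-u)$: $[g(\mathcal L)]_{i,i+k}=\frac1{k!}\frac{d^k}{du^k}g(1-u)|_{u=0}$ for $k\ge0$, and $[g(\mathcal L)]_{ij}=0$ for $j<i$. Put $g_{ML,\alpha}(s)=\frac{s^\alpha}{\lambda+s^\alpha}$, $\mathcal E^{(c)}_\alpha(\lambda,n)=\frac1{n!}\frac{d^n}{du^n}[g_{ML,\alpha}(1-u)]^{c}|_{u=0}$, and $(c)_s=c(c+1)\cdots(c+s-1)$. Let $\frac{d^\beta}{dt^\beta}f(t)=\frac1{\Gamma(1-\beta)}\int_0^t(t-\tau)^{-\beta}f'(\tau)\,d\tau$ be the Caputo derivative ($f'$ if $\beta=1$), applied to functions continuous on $[0,\infty)$ and differentiable on $(0,\infty)$ with $f'$ integrable on bounded intervals. Let $E^{c}_{\alpha,1}(z)=\sum_{s\ge0}\frac{(c)_s}{s!}\frac{z^s}{\Gamma(\alpha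 s+1)}$, and let $$e^{c}_{\alpha,0}(-\lambda_0,x)=\delta(x)+\sum_{s\ge1}\frac{(c)_s(-\lambda_0)^sx^{\alpha s-1}}{s!\,\Gamma(\alpha s)},$$ a distribution on $[0,\infty)$, i.e. acting on continuous functions on $[0,\infty)$ that vanish for large $x$; $\delta$ has full mass at $0$. (a) Let $\lambda>0$. The function $g_{ML,\alpha}^\mu$ is a Bernstein function without constant and linear part. The matrix $[g_{ML,\alpha}(\mathcal L)]^\mu$ has row sums $0$, positive diagonal and non-positive off-diagonal entries (it is a good Laplacian), and $[g_{ML,\alpha}(\mathcal L)]^\mu=\frac{\mathcal L^{\alpha\mu}}{(\lambda\mathbf 1+\mathcal L^\alpha)^\mu}$. If $\mu<1$, then also $[g_{ML,\alpha}(\mathcal L)]^\mu=-\frac1{\Gamma(-\mu)}\int_0^\infty(\mathbf 1-e^{-\tau g_{ML,\alpha}(\mathcal L)})\tau^{-\mu-1}d\tau$, the integral converging entrywise. (b) Let $\lambda>0$. The Cauchy problem $$\frac{d^\beta}{dt^\beta}p_n(t)=-\xi(\lambda+1)^\mu\sum_{k=0}^n p_k(t)\,\big[[g_{ML,\alpha}(\mathcal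 L)]^\mu\big]_{k,n}\quad(t>0),\qquad p_n(0)=\delta_{n0},\qquad n\in\mathbb N_0,$$ has a unique solution, namely the convergent series $$p_n(t)=\sum_{m\ge0}\frac{[-(\lambda+1)^\mu\xi t^\beta]^m}{\Gamma(\beta m+1)}\,\mathcal E^{(m\mu)}_\alpha(\lambda,n),\qquad t\ge 0,$$ and $p_n(t)\ge0$, $\sum_{n\ge 0} p_n(t)=1$. Moreover, with absolutely convergent series, $$\mathcal E^{(m\mu)}_\alpha(\lambda,n)=\frac1{n!}\sum_{s\ge0}\frac{(-\lambda)^s(m\mu)_s}{s!}(\alpha s)_n\quad(0<\lambda<1),$$ $$\mathcal E^{(m\mu)}_\alpha(\lambda,n)=\frac{(-1)^n\lambda^{-m\mu}}{n!}\sum_{s\ge0}\frac{(-1)^s\lambda^{-s}(m\mu)_s}{s!}\,a_s(a_s-1)\cdots(a_s-n+1)\quad(\lambda>1),\qquad a_s=\alpha(s+m\mu).$$ (c) Let $\lambda_0>0$, $t\ge0$, and write $p^{\lambda}_n(t)$ for the solution in (b). As $h\to0+$, with the scaling $\lambda=\lambda_0h^\alpha$, the functions $x\mapsto\frac1h p^{\lambda_0h^\alpha}_{\lfloor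 x/h\rfloor}(t)$ converge to $$\mathcal P(x,t)=\sum_{m\ge0}\frac{(-\xi t^\beta)^m}{\Gamma(\beta m+1)}\,e^{m\mu}_{\alpha,0}(-\lambda_0,x)$$ both for every $x>0$ (where $\delta$ does not contribute) and in the sense of distributions on $[0,\infty)$; all the series converge. Thus $\mathcal P(\cdot,t)$ consists of an atom at $0$ of mass $\sum_m\frac{(-\xi t^\beta)^m}{\Gamma(\beta m+1)}$ and of the pointwise limit as its density on $(0,\infty)$. Moreover $\mathcal P(x,t)=D_x\big[\Theta(x)\sum_{m\ge0}\frac{(-\xi t^\beta)^m}{\Gamma(\beta m+1)}E^{m\mu}_{\alpha,1}(-\lambda_0x^\alpha)\big]$ in the sense of distributions, $\Theta$ being the Heaviside function. (d) Let $\lambda_0>0$. For $x>0$ the jump kernel $$\mathcal W(x)=-D_xE^\mu_{\alpha,1}(-\lambda_0x^\alpha)$$ exists and equals $\lambda_0x^{\alpha-1}\sum_{s\ge0}\frac{(\mu)_{s+1}}{(s+1)!}\frac{(-\lambda_0x^\alpha)^s}{\Gamma(\alpha s+\alpha)}$, so that $e^\mu_{\alpha,0}(-\lambda_0,x)=\delta(x)-\mathcal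 W(x)$. The kernel $\mathcal P$ of (c) solves, in the sense of distributions in $x$, $$\frac{\partial^\beta}{\partial t^\beta}\mathcal P(x,t)=-\xi\mathcal P(x,t)+\xi\int_0^x\mathcal W(x-\tau)\mathcal P(\tau,t)\,d\tau\quad(t>0),\qquad\mathcal P(x,0)=\delta(x).$$ -/

import Mathlib

open Real Set Filter Topology MeasureTheory

noncomputable section

namespace SpaceTimeML

/-! ### Upper triangular circulant matrices on the integer line -/

/-- The Laplacian matrix `1 - T₋₁` of the directed integer line:
`1` on the diagonal, `-1` on the first upper side-diagonal. -/
def lineLaplacian : Matrix ℤ ℤ ℝ :=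
  fun i j => (if i = j then 1 else 0) - (if j = i + 1 then 1 else 0)

/-- The matrix function `g(𝓛)`, `𝓛 = 1 - T₋₁`: the upper triangular circulant matrix whose
generating function is `u ↦ g (1 - u)`, that is
`[g(𝓛)]_{i,j} = (1/k!) (d/du)^k g(1-u) |_{u=0}` for `k = j - i ≥ 0`, and `0` below the diagonal. -/
def lapFn (g : ℝ → ℝ) : Matrix ℤ ℤ ℝ :=
  fun i j => if i ≤ j then
    iteratedDeriv (j - i).toNat (fun u : ℝ => g (1 - u)) 0 / ((j - i).toNat.factorial : ℝ)
  else 0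

/-- The matrix function of the identity is the Laplacian matrix itself. -/
theorem lapFn_id : lapFn (fun s => s) = lineLaplacian := by
  have h1 : deriv (fun u : ℝ => 1 - u) = fun _ => -1 := by
    funext u
    simp
  funext i j
  simp only [lapFn, lineLaplacian]
  by_cases h : i ≤ j
  · obtain ⟨k, rfl⟩ : ∃ k : ℕ, j = i + k := ⟨(j - i).toNat, by omega⟩
    have hk : (i + (k : ℤ) - i).toNat = k := by omega
    rw [if_pos h, hk]
    match k with
    | 0 => simp
    | 1 => simp [iteratedDeriv_one]
    | k + 2 =>
      rw [iteratedDeriv_succ', h1, iteratedDeriv_const]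
      have a1 : ¬ (i = i + ((k + 2 : ℕ) : ℤ)) := by omega
      have a2 : ¬ (i + ((k + 2 : ℕ) : ℤ) = i + 1) := by omega
      rw [if_neg a1, if_neg a2]
      simp
  · have a1 : ¬ (i = j) := by omega
    have a2 : ¬ (j = i + 1) := by omega
    simp [h, a1, a2]

/-- Product of upper triangular matrices (all other terms of the matrix product vanish). -/
def utMul (A B : Matrix ℤ ℤ ℝ) : Matrix ℤ ℤ ℝ :=
  fun i j => ∑ k ∈ Finset.Icc i j, A i k * B k j

/-- Powers of an upper triangular matrix. -/
def utPow (A : Matrix ℤ ℤ ℝ) : ℕ → Matrix ℤ ℤ ℝ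
  | 0 => 1
  | k + 1 => utMul (utPow A k) A

/-- The exponential `e^A` of an upper triangular matrix, by its (always convergent) series. -/
def utExp (A : Matrix ℤ ℤ ℝ) : Matrix ℤ ℤ ℝ :=
  fun i j => ∑' k : ℕ, utPow A k i j / (k.factorial : ℝ)

/-- The good Laplacian properties: (i) the rows sum to zero, (ii) positive diagonal,
(iii) non-positive off-diagonal entries. -/
structure IsGoodLaplacian (A : Matrix ℤ ℤ ℝ) : Prop where
  row_sum : ∀ i, HasSum (fun j => A i j) 0
  diag_pos : ∀ i, 0 < A i i
  off_diag : ∀ i j, i ≠ j → A i j ≤ 0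

/-- Bernstein functions on `[0, ∞)` with no constant part (`g 0 = 0`) and no linear part
(`g s / s → 0`). -/
structure IsLaplacianBernstein (g : ℝ → ℝ) : Prop where
  cont : ContinuousOn g (Ici 0)
  smooth : ∀ n : ℕ, ContDiffOn ℝ n g (Ioi 0)
  nonneg : ∀ s, 0 ≤ s → 0 ≤ g s
  sign : ∀ n : ℕ, 1 ≤ n → ∀ s, 0 < s → 0 ≤ (-1) ^ (n - 1) * iteratedDeriv n g s
  at_zero : g 0 = 0
  no_drift : Tendsto (fun s => g s / s) atTop (𝓝 0)

/-- The scalar function `s ↦ (s^α / (lam + s^α))^c`; for `c = 1` it is `g_{ML,α}`. -/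
def gMLpow (α lam c s : ℝ) : ℝ := (s ^ α / (lam + s ^ α)) ^ c

/-- The discrete Prabhakar kernel `𝓔_α^{(c)}(lam, n)`: the `n`-th Taylor coefficient at `u = 0` of
`((1-u)^α / (lam + (1-u)^α))^c`. -/
def discPrabhakar (α c lam : ℝ) (n : ℕ) : ℝ := lapFn (gMLpow α lam c) 0 n

/-- The Pochhammer symbol `(c)_m = c (c+1) ⋯ (c+m-1)`. -/
def poch (c : ℝ) (m : ℕ) : ℝ := (ascPochhammer ℝ m).eval c

/-- The falling factorial `a (a-1) ⋯ (a-m+1) = Γ(a+1)/Γ(a-m+1)`. -/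
def fall (a : ℝ) (m : ℕ) : ℝ := (descPochhammer ℝ m).eval a

/-! ### The Caputo derivative -/

/-- The functions on `[0, ∞)` to which the Caputo derivative is applied: continuous on `[0, ∞)`,
differentiable on `(0, ∞)`, with derivative integrable on bounded intervals `(0, T)`. -/
structure CaputoRegular (f : ℝ → ℝ) : Prop where
  cont : ContinuousOn f (Ici 0)
  diff : DifferentiableOn ℝ f (Ioi 0)
  int : ∀ T, 0 < T → IntervalIntegrable (deriv f) volume 0 T

/-- `f` has Caputo derivative `d` of order `β ∈ (0,1]` at `t`: for `β < 1`,
`d = (1/Γ(1-β)) ∫₀ᵗ (t-τ)^{-β} f'(τ) dτ` (convergent integral); for `β = 1`, `d = f'(t)`. -/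
def HasCaputoDerivAt (β : ℝ) (f : ℝ → ℝ) (d t : ℝ) : Prop :=
  if β = 1 then HasDerivAt f d t
  else IntervalIntegrable (fun τ => (t - τ) ^ (-β) * deriv f τ) volume 0 t ∧
    d = 1 / Gamma (1 - β) * ∫ τ in (0 : ℝ)..t, (t - τ) ^ (-β) * deriv f τ

/-! ### The discrete Cauchy problem -/

/-- `p n t` solves `d^β/dt^β p_n = -ξ (lam+1)^μ [p · g_{ML,α}(𝓛)^μ]_n`, `p_n(0) = δ_{n0}`. -/
structure IsDiscreteSolution (α μ β lam ξ : ℝ) (p : ℕ → ℝ → ℝ) : Prop where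
  regular : ∀ n, CaputoRegular (p n)
  init : ∀ n, p n 0 = if n = 0 then 1 else 0
  eqn : ∀ n t, 0 < t → HasCaputoDerivAt β (p n)
    (-ξ * (lam + 1) ^ μ * ∑ k ∈ Finset.range (n + 1), p k t * lapFn (gMLpow α lam μ) k n) t

/-- The `m`-th term of the series for the state probability `p_n(t)`. -/
def stateTerm (α μ β lam ξ : ℝ) (n : ℕ) (t : ℝ) (m : ℕ) : ℝ :=
  (-((lam + 1) ^ μ * ξ * t ^ β)) ^ m / Gamma (β * m + 1) * discPrabhakar α (m * μ) lam n

/-- The state probability `p_n(t)`. -/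
def stateProb (α μ β lam ξ : ℝ) (n : ℕ) (t : ℝ) : ℝ :=
  ∑' m : ℕ, stateTerm α μ β lam ξ n t m

/-! ### Prabhakar functions and kernels on the half line -/

/-- The `s`-th term of the Prabhakar function. -/
def prabhakarTerm (α b c z : ℝ) (s : ℕ) : ℝ :=
  poch c s / (s.factorial : ℝ) * z ^ s / Gamma (α * s + b)

/-- The Prabhakar function `E_{α,b}^c(z)`. -/
def prabhakarE (α b c z : ℝ) : ℝ := ∑' s : ℕ, prabhakarTerm α b c z s

/-- The term of index `s + 1` in the series of the Prabhakar kernel `e_{α,0}^c(-lam₀, x)`. -/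
def kernelTerm (α c lam₀ x : ℝ) (s : ℕ) : ℝ :=
  poch c (s + 1) * (-lam₀) ^ (s + 1) * x ^ (α * (s + 1 : ℕ) - 1) /
    (((s + 1).factorial : ℝ) * Gamma (α * (s + 1 : ℕ)))

/-- The regular part (the part without `δ`) of the Prabhakar kernel, for `x > 0`. -/
def kernelReg (α c lam₀ x : ℝ) : ℝ := ∑' s : ℕ, kernelTerm α c lam₀ x s

/-- Test functions on the closed half line: continuous on `[0, ∞)` and vanishing for large `x`. -/
def IsTest (φ : ℝ → ℝ) : Prop := ContinuousOn φ (Ici 0) ∧ ∃ R, ∀ x, R ≤ x → φ x = 0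

/-- The Prabhakar kernel `e_{α,0}^c(-lam₀, x) = δ(x) + ∑_{s ≥ 1} …` as a distribution on `[0, ∞)`,
the mass of `δ` at `0` counting fully. -/
def prabhakarKernel (α c lam₀ : ℝ) (φ : ℝ → ℝ) : ℝ :=
  φ 0 + ∫ x in Ioi (0 : ℝ), kernelReg α c lam₀ x * φ x

/-- The coefficient `(-ξ t^β)^m / Γ(β m + 1)`. -/
def timeCoeff (β ξ t : ℝ) (m : ℕ) : ℝ := (-(ξ * t ^ β)) ^ m / Gamma (β * m + 1)

/-- The state density kernel `P(·, t) = ∑_m (-ξ t^β)^m / Γ(βm+1) e_{α,0}^{mμ}(-lam₀, ·)` as a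
distribution on `[0, ∞)`. -/
def stateKernel (α μ β lam₀ ξ t : ℝ) (φ : ℝ → ℝ) : ℝ :=
  ∑' m : ℕ, timeCoeff β ξ t m * prabhakarKernel α (m * μ) lam₀ φ

/-- The values of `P(x, t)` for `x > 0`, where `δ` does not contribute. -/
def stateDensity (α μ β lam₀ ξ t x : ℝ) : ℝ :=
  ∑' m : ℕ, timeCoeff β ξ t m * kernelReg α (m * μ) lam₀ x

/-- The function `∑_m (-ξ t^β)^m / Γ(βm+1) E_{α,1}^{mμ}(-lam₀ x^α)`. -/
def stateCdf (α μ β lam₀ ξ t x : ℝ) : ℝ :=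
  ∑' m : ℕ, timeCoeff β ξ t m * prabhakarE α 1 (m * μ) (-lam₀ * x ^ α)

/-- The jump kernel `-D_x E_{α,1}^μ(-lam₀ x^α)`. -/
def jumpKernel (α μ lam₀ x : ℝ) : ℝ :=
  -deriv (fun y : ℝ => prabhakarE α 1 μ (-lam₀ * y ^ α)) x

/-- The convolution `∫₀ˣ W(x-τ) P(τ) dτ` on the half line, `P` being a distribution:
`⟨W * P, φ⟩ = ⟨P(τ), ∫₀^∞ W(y) φ(τ+y) dy⟩`. -/
def convDistr (W : ℝ → ℝ) (P : (ℝ → ℝ) → ℝ) (φ : ℝ → ℝ) : ℝ :=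
  P (fun τ => ∫ y in Ioi (0 : ℝ), W y * φ (τ + y))

/-- `P` solves `∂^β/∂t^β P = -ξ P + ξ W * P`, `P(·, 0) = δ`, in the sense of distributions in `x`. -/
structure IsContinuousSolution (β ξ : ℝ) (W : ℝ → ℝ) (P : ℝ → (ℝ → ℝ) → ℝ) : Prop where
  regular : ∀ φ, IsTest φ → CaputoRegular (fun t => P t φ)
  init : ∀ φ, IsTest φ → P 0 φ = φ 0
  eqn : ∀ φ, IsTest φ → ∀ t, 0 < t →
    HasCaputoDerivAt β (fun r => P r φ) (-ξ * P t φ + ξ * convDistr W (P t) φ) t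

end SpaceTimeML

end

open SpaceTimeML

/-! All matrices involved are upper triangular circulants. Passing to the generating series turns
products and exponentials of matrices into products and exponentials of formal Taylor series at `u =
0` (`utMul_circ`, `utExp_circ`), so each matrix claim is a claim about the coefficients of `g(1 -
u)`.

The good Laplacian property comes from complete monotonicity. The derivative of `g_{ML,α}^μ` is a
positive multiple of a function `s^{-d} (λ + s^α)^{-c}` with `c, d ≥ 0`, and `-d/ds` maps this class
to non-negative combinations of its members (`cmFn_sign`). Hence the Taylor coefficients of `g^μ(1 -
u)` are non-positive from index one on. Holomorphy in the unit disc and Abel's theorem give the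
total sum `g^μ(0) = 0` (`hasSum_coeff_mlPS`). So the absolute sum is at most `2`, and at most `2^m`
for the `m`-th power. The subordination integral is verified coefficient by coefficient, by a
recursion that reduces it to scalar Gamma integrals.

In time, every function is a series `∑ b_m t^{βm} / Γ(βm+1)` with geometrically bounded `b`. The
Beta integral shows that the Caputo derivative shifts `b` by one index
(`hasCaputoDerivAt_mlSeries`), while multiplication by the matrix raises `g^{mμ}` to `g^{(m+1)μ}`;
the two operations match. The system is triangular with diagonal rate `ξ`, so uniqueness and
positivity follow by induction on `n` from an extremum principle: a Caputo derivative is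
non-positive at a minimum over the past. The masses add up to one because `∑_n 𝓔^{(mμ)}(λ, n) =
0^m`.

For `λ = λ₀ h^α` the small-`λ` series consists of terms `h^{αs-1} (αs)_n / n!` with `n = ⌊x/h⌋`. By
Euler's limit for Gamma they tend to `x^{αs-1} / Γ(αs)`, and a bound uniform in `s`
(`exists_bound_rpow_mul_poch_floor`) permits dominated convergence. The cell `n = 0`, of width `h`,
carries a mass independent of `λ` and becomes the atom.

Finally, Vandermonde's identity for `(c)_s / s!` and the Beta integral give the semigroup law
`e^{c+d} = e^c * e^d` (`kernelReg_add`). Since `e^μ = δ - W`, the index shift produced by the Caputo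
derivative is convolution with `δ - W`, which is the limit equation. -/

noncomputable section

namespace SpaceTimeML

/-! ### Mittag-Leffler type series -/

/-- A lower bound of the Gamma function that beats every geometric sequence. -/
theorem rpow_mul_exp_neg_le_Gamma {y R : ℝ} (hy : 1 ≤ y) (hR : 0 < R) :
    R ^ (y - 1) * exp (-R) ≤ Gamma y := by
  have hy0 : 0 < y := by linarith
  rw [Gamma_eq_integral hy0]
  have hint := GammaIntegral_convergent hy0
  have h1 : ∫ x in Ioi R, exp (-x) * x ^ (y - 1) ≤ ∫ x in Ioi 0, exp (-x) * x ^ (y - 1) := by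
    apply setIntegral_mono_set hint
    · filter_upwards [ae_restrict_mem measurableSet_Ioi] with x hx
      have : (0 : ℝ) < x := hx
      simp only [Pi.zero_apply]
      positivity
    · exact (Ioi_subset_Ioi hR.le).eventuallyLE
  refine le_trans ?_ h1
  have h2 : R ^ (y - 1) * exp (-R) = ∫ x in Ioi R, R ^ (y - 1) * exp (-x) := by
    rw [integral_const_mul, integral_exp_neg_Ioi]
  rw [h2]
  apply setIntegral_mono_on
  · exact (integrableOn_exp_neg_Ioi R).const_mul _
  · exact hint.mono_set (Ioi_subset_Ioi hR.le)
  · exact measurableSet_Ioi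
  · intro x hx
    have hx' : R < x := hx
    rw [mul_comm]
    gcongr

/-- Since `R` is free in the Gamma bound, it is chosen with `R^β = 2|K| + 1`; the terms are then
dominated by a geometric series of ratio `1/2`. The bound needs `β m + b ≥ 1`, so the comparison is
only eventual and no sign of `b` matters. -/
theorem summable_pow_div_Gamma {β b : ℝ} (hβ : 0 < β) (K : ℝ) :
    Summable (fun m : ℕ => K ^ m / Gamma (β * m + b)) := by
  set L := 2 * |K| + 1 with hL
  have hL0 : 0 < L := by positivity
  set R := L ^ (1 / β) with hRdef
  have hR : 0 < R := by positivity
  have hRβ : R ^ β = L := by rw [hRdef, ← rpow_mul hL0.le]; simp [hβ.ne']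
  have hg : Summable (fun m : ℕ => (R ^ (b - 1) * exp (-R))⁻¹ * (1 / 2 : ℝ) ^ m) :=
    (summable_geometric_of_lt_one (by norm_num) (by norm_num)).mul_left _
  refine Summable.of_norm_bounded_eventually_nat hg ?_
  have ht : Tendsto (fun m : ℕ => β * m + b) atTop atTop :=
    tendsto_atTop_add_const_right _ _ (tendsto_natCast_atTop_atTop.const_mul_atTop hβ)
  filter_upwards [ht.eventually_ge_atTop 1] with m hm
  have h1 := rpow_mul_exp_neg_le_Gamma hm hR
  have h2 : R ^ (β * m + b - 1) = L ^ m * R ^ (b - 1) := by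
    rw [add_sub_assoc, rpow_add hR, rpow_mul hR.le, hRβ, rpow_natCast]
  rw [h2] at h1
  have hG : 0 < Gamma (β * m + b) := Gamma_pos_of_pos (by linarith)
  rw [norm_div, norm_pow, Real.norm_eq_abs, Real.norm_of_nonneg hG.le]
  have h3 : |K| ^ m ≤ (1 / 2) ^ m * L ^ m := by
    rw [← mul_pow]; gcongr; rw [hL]; linarith
  have hpos : 0 < R ^ (b - 1) * exp (-R) := by positivity
  rw [div_le_iff₀ hG]
  calc |K| ^ m ≤ (1 / 2) ^ m * L ^ m := h3
    _ = (R ^ (b - 1) * exp (-R))⁻¹ * (1 / 2 : ℝ) ^ m * (L ^ m * R ^ (b - 1) * exp (-R)) := by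
        field_simp
    _ ≤ _ := by gcongr

/-- Sequences of at most geometric growth. -/
def GeomBdd (b : ℕ → ℝ) : Prop := ∃ C K : ℝ, 0 ≤ C ∧ 0 < K ∧ ∀ m, |b m| ≤ C * K ^ m

theorem GeomBdd.shift {b : ℕ → ℝ} (hb : GeomBdd b) : GeomBdd (fun m => b (m + 1)) := by
  obtain ⟨C, K, hC, hK, h⟩ := hb
  refine ⟨C * K, K, by positivity, hK, fun m => (h (m + 1)).trans_eq (by ring)⟩

theorem GeomBdd.mul {a b : ℕ → ℝ} (ha : GeomBdd a) (hb : GeomBdd b) :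
    GeomBdd (fun m => a m * b m) := by
  obtain ⟨C, K, hC, hK, h⟩ := ha
  obtain ⟨C', K', hC', hK', h'⟩ := hb
  refine ⟨C * C', K * K', by positivity, by positivity, fun m => ?_⟩
  rw [abs_mul, mul_pow]
  calc |a m| * |b m| ≤ (C * K ^ m) * (C' * K' ^ m) := by gcongr <;> simp [h, h']
    _ = _ := by ring

theorem geomBdd_pow (x : ℝ) : GeomBdd (fun m => x ^ m) :=
  ⟨1, |x| + 1, by norm_num, by positivity, fun m => by
    rw [abs_pow, one_mul]; gcongr; linarith⟩

/-- `∑ b_m t^{βm} / Γ(βm+1)`. -/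
def mlSeries (β : ℝ) (b : ℕ → ℝ) (t : ℝ) : ℝ :=
  ∑' m : ℕ, b m * t ^ (β * m) / Gamma (β * m + 1)

/-- `∑ b_{m+1} t^{β(m+1)-1} / Γ(β(m+1))`. -/
def mlDeriv (β : ℝ) (b : ℕ → ℝ) (t : ℝ) : ℝ :=
  ∑' m : ℕ, b (m + 1) * t ^ (β * (m + 1 : ℕ) - 1) / Gamma (β * (m + 1 : ℕ))

theorem summable_geomBdd_div_Gamma {β c : ℝ} {b : ℕ → ℝ} (hβ : 0 < β)
    (hb : GeomBdd b) (K : ℝ) :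
    Summable (fun m : ℕ => |b m| * K ^ m / Gamma (β * m + c)) := by
  obtain ⟨C, L, hC, hL, h⟩ := hb
  refine Summable.of_norm_bounded ((summable_pow_div_Gamma (b := c) hβ (L * |K|)).abs.mul_left C)
    fun m => ?_
  rw [norm_div, norm_mul, norm_pow, Real.norm_eq_abs, Real.norm_eq_abs, Real.norm_eq_abs,
    abs_abs, abs_div, ← mul_div_assoc, abs_of_nonneg (by positivity : 0 ≤ (L * |K|) ^ m), mul_pow,
    ← mul_assoc]
  gcongr
  exact h m

theorem summable_mlSeries {β : ℝ} {b : ℕ → ℝ} (hβ : 0 < β) (hb : GeomBdd b) {t : ℝ}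
    (ht : 0 ≤ t) : Summable (fun m : ℕ => |b m| * t ^ (β * m) / Gamma (β * m + 1)) := by
  refine (summable_geomBdd_div_Gamma (c := 1) hβ hb (t ^ β)).congr fun m => ?_
  rw [rpow_mul ht, rpow_natCast]

theorem abs_mlSeries_term (β : ℝ) (hβ : 0 < β) (b : ℕ → ℝ) {t : ℝ} (ht : 0 ≤ t) (m : ℕ) :
    |b m * t ^ (β * m) / Gamma (β * m + 1)| = |b m| * t ^ (β * m) / Gamma (β * m + 1) := by
  have hG : 0 < Gamma (β * m + 1) := Gamma_pos_of_pos (by positivity)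
  rw [abs_div, abs_mul, abs_of_pos hG, abs_of_nonneg (by positivity : 0 ≤ t ^ (β * m))]

theorem summable_mlSeries' {β : ℝ} {b : ℕ → ℝ} (hβ : 0 < β) (hb : GeomBdd b) {t : ℝ}
    (ht : 0 ≤ t) : Summable (fun m : ℕ => b m * t ^ (β * m) / Gamma (β * m + 1)) := by
  refine Summable.of_abs ((summable_mlSeries hβ hb ht).congr fun m => ?_)
  rw [abs_mlSeries_term β hβ b ht]

theorem summable_mlDeriv {β : ℝ} {b : ℕ → ℝ} (hβ : 0 < β) (hb : GeomBdd b) {t : ℝ}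
    (ht : 0 < t) : Summable (fun m : ℕ =>
      |b (m + 1)| * t ^ (β * (m + 1 : ℕ) - 1) / Gamma (β * (m + 1 : ℕ))) := by
  refine ((summable_geomBdd_div_Gamma (c := β) hβ hb.shift (t ^ β)).mul_left
    (t ^ (β - 1))).congr fun m => ?_
  have e : β * ((m + 1 : ℕ) : ℝ) = β * m + β := by push_cast; ring
  rw [e, add_sub_assoc, rpow_add ht, rpow_mul ht.le, rpow_natCast]
  ring

theorem abs_mlDeriv_term (β : ℝ) (hβ : 0 < β) (b : ℕ → ℝ) {t : ℝ} (ht : 0 ≤ t) (m : ℕ) :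
    |b (m + 1) * t ^ (β * (m + 1 : ℕ) - 1) / Gamma (β * (m + 1 : ℕ))| =
      |b (m + 1)| * t ^ (β * (m + 1 : ℕ) - 1) / Gamma (β * (m + 1 : ℕ)) := by
  have hG : 0 < Gamma (β * (m + 1 : ℕ)) := Gamma_pos_of_pos (by positivity)
  rw [abs_div, abs_mul, abs_of_pos hG,
    abs_of_nonneg (by positivity : 0 ≤ t ^ (β * (m + 1 : ℕ) - 1))]

theorem summable_mlDeriv' {β : ℝ} {b : ℕ → ℝ} (hβ : 0 < β) (hb : GeomBdd b) {t : ℝ}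
    (ht : 0 < t) : Summable (fun m : ℕ =>
      b (m + 1) * t ^ (β * (m + 1 : ℕ) - 1) / Gamma (β * (m + 1 : ℕ))) := by
  refine Summable.of_abs ((summable_mlDeriv hβ hb ht).congr fun m => ?_)
  rw [abs_mlDeriv_term β hβ b ht.le]

/-- Termwise differentiation with a majorant on `(t/2, 2t)`. The exponents `β(m+1) - 1` may be
negative for small `m`, so the majorant adds the values at both endpoints. The constant term is
split off beforehand because it has no counterpart in `mlDeriv`. -/
theorem hasDerivAt_mlSeries {β : ℝ} {b : ℕ → ℝ} (hβ : 0 < β) (hb : GeomBdd b) {t : ℝ}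
    (ht : 0 < t) : HasDerivAt (mlSeries β b) (mlDeriv β b t) t := by
  have hterm : ∀ (m : ℕ) (y : ℝ), 0 < y →
      HasDerivAt (fun y : ℝ => b (m + 1) * y ^ (β * (m + 1 : ℕ)) / Gamma (β * (m + 1 : ℕ) + 1))
        (b (m + 1) * y ^ (β * (m + 1 : ℕ) - 1) / Gamma (β * (m + 1 : ℕ))) y := by
    intro m y hy
    have hp : 0 < β * ((m + 1 : ℕ) : ℝ) := by positivity
    have h := ((Real.hasDerivAt_rpow_const (p := β * ((m + 1 : ℕ) : ℝ))
      (Or.inl hy.ne')).const_mul (b (m + 1))).div_const (Gamma (β * (m + 1 : ℕ) + 1))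
    refine h.congr_deriv ?_
    rw [Gamma_add_one hp.ne']
    have := (Gamma_pos_of_pos hp).ne'
    field_simp
  -- a bound on `(t/2, 2t)`
  set u : ℕ → ℝ := fun m => 
    |b (m + 1)| * (2 * t) ^ (β * (m + 1 : ℕ) - 1) / Gamma (β * (m + 1 : ℕ)) +
    |b (m + 1)| * (t / 2) ^ (β * (m + 1 : ℕ) - 1) / Gamma (β * (m + 1 : ℕ)) with hu
  have hus : Summable u :=
    (summable_mlDeriv hβ hb (by positivity)).add (summable_mlDeriv hβ hb (by positivity))
  have key := hasDerivAt_tsum_of_isPreconnected (t := Ioo (t / 2) (2 * t)) (u := u)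
    (g := fun (m : ℕ) (y : ℝ) => b (m + 1) * y ^ (β * (m + 1 : ℕ)) / Gamma (β * (m + 1 : ℕ) + 1))
    (g' := fun (m : ℕ) (y : ℝ) =>
      b (m + 1) * y ^ (β * (m + 1 : ℕ) - 1) / Gamma (β * (m + 1 : ℕ)))
    (y₀ := t) (y := t) hus isOpen_Ioo isPreconnected_Ioo
    (fun m y hy => hterm m y (by have := hy.1; linarith)) ?_ ⟨by linarith, by linarith⟩
    ((summable_nat_add_iff 1).2 (summable_mlSeries' hβ hb ht.le)) ⟨by linarith, by linarith⟩
  · have h2 : mlSeries β b =ᶠ[𝓝 t] fun y => b 0 +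
        ∑' m : ℕ, b (m + 1) * y ^ (β * (m + 1 : ℕ)) / Gamma (β * (m + 1 : ℕ) + 1) := by
      filter_upwards [lt_mem_nhds ht] with y hy
      rw [mlSeries, (summable_mlSeries' hβ hb (le_of_lt hy)).tsum_eq_zero_add]
      simp
    exact (key.const_add (b 0)).congr_of_eventuallyEq h2
  · intro m y hy
    have hy0 : 0 < y := by have := hy.1; linarith
    have hG : 0 < Gamma (β * (m + 1 : ℕ)) := Gamma_pos_of_pos (by positivity)
    rw [Real.norm_eq_abs, abs_mlDeriv_term β hβ b hy0.le, hu]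
    simp only
    rw [← add_div, ← mul_add]
    gcongr
    rcases le_total 0 (β * ((m + 1 : ℕ) : ℝ) - 1) with hp | hp
    · have : y ^ (β * ((m + 1 : ℕ) : ℝ) - 1) ≤ (2 * t) ^ (β * ((m + 1 : ℕ) : ℝ) - 1) :=
        rpow_le_rpow hy0.le hy.2.le hp
      have h2 : 0 ≤ (t / 2) ^ (β * ((m + 1 : ℕ) : ℝ) - 1) := by positivity
      linarith
    · have : y ^ (β * ((m + 1 : ℕ) : ℝ) - 1) ≤ (t / 2) ^ (β * ((m + 1 : ℕ) : ℝ) - 1) :=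
        rpow_le_rpow_of_nonpos (by positivity) hy.1.le hp
      have h2 : 0 ≤ (2 * t) ^ (β * ((m + 1 : ℕ) : ℝ) - 1) := by positivity
      linarith

theorem continuousOn_mlSeries {β : ℝ} {b : ℕ → ℝ} (hβ : 0 < β) (hb : GeomBdd b) :
    ContinuousOn (mlSeries β b) (Ici 0) := by
  intro t ht
  have ht' : (0 : ℝ) ≤ t := ht
  have h : ContinuousOn (mlSeries β b) (Icc 0 (t + 1)) := by
    refine continuousOn_tsum (u := fun m : ℕ =>
      |b m| * (t + 1) ^ (β * m) / Gamma (β * m + 1)) ?_ (summable_mlSeries hβ hb (by linarith)) ?_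
    · intro m
      refine ContinuousOn.div_const (ContinuousOn.mul continuousOn_const ?_) _
      exact (Real.continuous_rpow_const (by positivity)).continuousOn
    · intro m x hx
      rw [Real.norm_eq_abs, abs_mlSeries_term β hβ b hx.1]
      have hG : 0 < Gamma (β * m + 1) := Gamma_pos_of_pos (by positivity)
      gcongr
      · exact hx.1
      · exact hx.2
  refine (h t ⟨ht', by linarith⟩).mono_of_mem_nhdsWithin ?_
  have : Iio (t + 1) ∈ 𝓝 t := Iio_mem_nhds (by linarith)
  filter_upwards [self_mem_nhdsWithin, mem_nhdsWithin_of_mem_nhds this] with x hx hx2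
  exact ⟨hx, le_of_lt hx2⟩

/-! ### Termwise integration -/

/-- Tonelli: the sum of the norms has finite integral, so the series converges absolutely almost
everywhere and its sum is a measurable limit with integrable majorant. -/
theorem integrable_tsum_of_summable_integral_norm {X : Type*} [MeasurableSpace X] {ν : Measure X}
    {F : ℕ → X → ℝ} (hF : ∀ i, Integrable (F i) ν) (hs : Summable fun i => ∫ x, ‖F i x‖ ∂ν) :
    Integrable (fun x => ∑' i, F i x) ν := by
  have hfin : ∑' i, ∫⁻ x, ‖F i x‖ₑ ∂ν ≠ ⊤ := by
    have h1 : ∀ i, ∫⁻ x, ‖F i x‖ₑ ∂ν = ENNReal.ofReal (∫ x, ‖F i x‖ ∂ν) := fun i =>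
      (ofReal_integral_norm_eq_lintegral_enorm (hF i)).symm
    simp_rw [h1]
    rw [← ENNReal.ofReal_tsum_of_nonneg (fun i => integral_nonneg fun x => norm_nonneg _) hs]
    exact ENNReal.ofReal_ne_top
  have hswap : ∫⁻ x, ∑' i, ‖F i x‖ₑ ∂ν = ∑' i, ∫⁻ x, ‖F i x‖ₑ ∂ν :=
    lintegral_tsum fun i => (hF i).aestronglyMeasurable.enorm
  have hae : ∀ᵐ x ∂ν, Summable fun i => F i x := by
    have : ∀ᵐ x ∂ν, ∑' i, ‖F i x‖ₑ < ⊤ :=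
      ae_lt_top' (AEMeasurable.tsum fun i => (hF i).aestronglyMeasurable.enorm)
        (by rw [hswap]; exact hfin)
    filter_upwards [this] with x hx
    refine Summable.of_norm ?_
    have h2 := ENNReal.summable_toReal hx.ne
    simpa using h2
  refine ⟨?_, ?_⟩
  · refine aestronglyMeasurable_of_tendsto_ae atTop
      (f := fun (n : ℕ) x => ∑ i ∈ Finset.range n, F i x) (fun n => ?_) ?_
    · exact Finset.aestronglyMeasurable_fun_sum _ fun i _ => (hF i).aestronglyMeasurable
    · filter_upwards [hae] with x hx
      exact hx.hasSum.tendsto_sum_nat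
  · refine lt_of_le_of_lt ?_ (lt_top_iff_ne_top.2 hfin)
    rw [← hswap]
    exact lintegral_mono fun x => enorm_tsum_le_tsum_enorm

/-! ### The real Beta integral -/

theorem beta_integral_rpow {a b t : ℝ} (ha : 0 < a) (hb : 0 < b) (ht : 0 < t) :
    IntervalIntegrable (fun x : ℝ => x ^ (a - 1) * (t - x) ^ (b - 1)) volume 0 t ∧
    ∫ x in (0 : ℝ)..t, x ^ (a - 1) * (t - x) ^ (b - 1) =
      t ^ (a + b - 1) * (Gamma a * Gamma b / Gamma (a + b)) := by
  have hint : ∫ x in (0 : ℝ)..t, x ^ (a - 1) * (t - x) ^ (b - 1) =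
      t ^ (a + b - 1) * (Gamma a * Gamma b / Gamma (a + b)) := by
    have h := Complex.betaIntegral_scaled (a : ℂ) (b : ℂ) ht
    have h2 : ∫ x in (0 : ℝ)..t, (x : ℂ) ^ ((a : ℂ) - 1) * ((t : ℂ) - x) ^ ((b : ℂ) - 1) =
        ((∫ x in (0 : ℝ)..t, x ^ (a - 1) * (t - x) ^ (b - 1) : ℝ) : ℂ) := by
      rw [← intervalIntegral.integral_ofReal]
      refine intervalIntegral.integral_congr fun x hx => ?_
      rw [uIcc_of_le ht.le] at hx
      rw [Complex.ofReal_mul, Complex.ofReal_cpow hx.1, Complex.ofReal_cpow (sub_nonneg.2 hx.2)]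
      push_cast
      rfl
    have h3 : Complex.betaIntegral a b = ((Gamma a * Gamma b / Gamma (a + b) : ℝ) : ℂ) := by
      have h4 := Complex.Gamma_mul_Gamma_eq_betaIntegral (s := a) (t := b) (by simpa) (by simpa)
      rw [Complex.Gamma_ofReal, Complex.Gamma_ofReal, ← Complex.ofReal_add,
        Complex.Gamma_ofReal] at h4
      have hne : ((Gamma (a + b) : ℝ) : ℂ) ≠ 0 := by
        exact_mod_cast (Gamma_pos_of_pos (add_pos ha hb)).ne'
      push_cast
      rw [h4]
      field_simp
    rw [h2, h3] at h
    have h5 : ((t : ℂ) ^ ((a : ℂ) + b - 1)) = ((t ^ (a + b - 1) : ℝ) : ℂ) := by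
      rw [Complex.ofReal_cpow ht.le]; push_cast; rfl
    rw [h5] at h
    exact_mod_cast h
  refine ⟨?_, hint⟩
  -- A non-integrable function has integral `0` by convention, whereas the value just computed is
  -- positive; hence integrability comes for free.
  by_contra hn
  rw [intervalIntegral.integral_undef hn] at hint
  have h1 := Gamma_pos_of_pos ha
  have h2 := Gamma_pos_of_pos hb
  have h3 := Gamma_pos_of_pos (add_pos ha hb)
  have : 0 < t ^ (a + b - 1) * (Gamma a * Gamma b / Gamma (a + b)) := by positivity
  linarith

/-! ### Caputo derivatives of Mittag-Leffler type series -/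

theorem integrableOn_rpow_sub_one {a T : ℝ} (ha : 0 < a) (hT : 0 < T) :
    IntegrableOn (fun x : ℝ => x ^ (a - 1)) (Ioc 0 T) ∧
      ∫ x in Ioc 0 T, x ^ (a - 1) = T ^ a / a := by
  refine ⟨(intervalIntegrable_iff_integrableOn_Ioc_of_le hT.le).1
    (intervalIntegral.intervalIntegrable_rpow' (by linarith)), ?_⟩
  rw [← intervalIntegral.integral_of_le hT.le, integral_rpow (Or.inl (by linarith))]
  simp [zero_rpow ha.ne']

/-- Termwise integration of `mlDeriv` against a weight. -/
theorem mlDeriv_mul_integral {β : ℝ} {b : ℕ → ℝ} (hβ : 0 < β) {S : Set ℝ}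
    (hS : S ⊆ Ioi 0) (hSm : MeasurableSet S) {w : ℝ → ℝ}
    (hint : ∀ m : ℕ, IntegrableOn (fun x => x ^ (β * (m + 1 : ℕ) - 1) * w x) S)
    (hsum : Summable fun m : ℕ => |b (m + 1)| / Gamma (β * (m + 1 : ℕ)) *
      ∫ x in S, x ^ (β * (m + 1 : ℕ) - 1) * |w x|) :
    IntegrableOn (fun x => mlDeriv β b x * w x) S ∧
    HasSum (fun m : ℕ => b (m + 1) / Gamma (β * (m + 1 : ℕ)) *
      ∫ x in S, x ^ (β * (m + 1 : ℕ) - 1) * w x) (∫ x in S, mlDeriv β b x * w x) := by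
  set F : ℕ → ℝ → ℝ := fun m x =>
    b (m + 1) / Gamma (β * (m + 1 : ℕ)) * (x ^ (β * (m + 1 : ℕ) - 1) * w x) with hF
  have hFi : ∀ m, Integrable (F m) (volume.restrict S) := fun m => (hint m).const_mul _
  have hFs : Summable fun m => ∫ x in S, ‖F m x‖ := by
    refine hsum.congr fun m => ?_
    rw [← integral_const_mul]
    refine setIntegral_congr_fun hSm fun x hx => ?_
    have hx0 : (0 : ℝ) < x := hS hx
    have hG : 0 < Gamma (β * (m + 1 : ℕ)) := Gamma_pos_of_pos (by positivity)
    simp only [hF]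
    rw [norm_mul, norm_mul, norm_div, Real.norm_of_nonneg hG.le, Real.norm_eq_abs,
      Real.norm_of_nonneg (by positivity : 0 ≤ x ^ (β * ((m + 1 : ℕ) : ℝ) - 1)), Real.norm_eq_abs]
  have heq : (fun x => ∑' m, F m x) = fun x => mlDeriv β b x * w x := by
    funext x
    rw [mlDeriv, ← tsum_mul_right]
    refine tsum_congr fun m => ?_
    simp only [hF]; ring
  have h1 := integrable_tsum_of_summable_integral_norm hFi hFs
  have h2 := hasSum_integral_of_summable_integral_norm hFi hFs
  rw [heq] at h1 h2
  refine ⟨h1, ?_⟩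
  simp only [hF, integral_const_mul] at h2
  exact h2

theorem integrableOn_mlDeriv {β : ℝ} {b : ℕ → ℝ} (hβ : 0 < β) (hb : GeomBdd b) {T : ℝ}
    (hT : 0 < T) : IntegrableOn (mlDeriv β b) (Ioc 0 T) := by
  have hp : ∀ m : ℕ, 0 < β * ((m + 1 : ℕ) : ℝ) := fun m => by positivity
  have h := (mlDeriv_mul_integral (b := b) hβ (S := Ioc 0 T) (w := fun _ => 1)
    Ioc_subset_Ioi_self measurableSet_Ioc
    (fun m => by simpa using (integrableOn_rpow_sub_one (hp m) hT).1) ?_).1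
  · simpa using h
  · refine ((summable_nat_add_iff 1).2 (summable_mlSeries hβ hb hT.le)).congr fun m => ?_
    simp only [abs_one, mul_one]
    rw [(integrableOn_rpow_sub_one (hp m) hT).2, Gamma_add_one (hp m).ne']
    have := hp m
    have := (Gamma_pos_of_pos (hp m)).ne'
    field_simp

theorem caputoRegular_mlSeries {β : ℝ} {b : ℕ → ℝ} (hβ : 0 < β) (hb : GeomBdd b) :
    CaputoRegular (mlSeries β b) where
  cont := continuousOn_mlSeries hβ hb
  diff := fun t ht => (hasDerivAt_mlSeries hβ hb ht).differentiableAt.differentiableWithinAt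
  int := fun T hT => by
    rw [intervalIntegrable_iff_integrableOn_Ioc_of_le hT.le]
    refine (integrableOn_mlDeriv hβ hb hT).congr_fun (fun t ht => ?_) measurableSet_Ioc
    exact (hasDerivAt_mlSeries hβ hb ht.1).deriv.symm

/-- The Beta integral gives `D^β t^{β(m+1)} / Γ(β(m+1)+1) = t^{βm} / Γ(βm+1)`, and the constant is
killed: on these series the Caputo derivative is the left shift of the coefficients. Both fractional
equations below rest on this. -/
theorem hasCaputoDerivAt_mlSeries {β : ℝ} {b : ℕ → ℝ} (hβ : β ∈ Ioc (0 : ℝ) 1)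
    (hb : GeomBdd b) {t : ℝ} (ht : 0 < t) :
    HasCaputoDerivAt β (mlSeries β b) (mlSeries β (fun m => b (m + 1)) t) t := by
  have hβ0 := hβ.1
  unfold HasCaputoDerivAt
  split_ifs with h1
  · refine (hasDerivAt_mlSeries hβ0 hb ht).congr_deriv ?_
    subst h1
    rw [mlDeriv, mlSeries]
    refine tsum_congr fun m => ?_
    push_cast
    simp
  · have hβ1 : 0 < 1 - β := by
      have := lt_of_le_of_ne hβ.2 h1
      linarith
    have hp : ∀ m : ℕ, 0 < β * ((m + 1 : ℕ) : ℝ) := fun m => by positivity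
    have hG1 : 0 < Gamma (1 - β) := Gamma_pos_of_pos hβ1
    have hw : ∀ m : ℕ, IntegrableOn (fun x : ℝ => x ^ (β * (m + 1 : ℕ) - 1) * (t - x) ^ (-β))
        (Ioc 0 t) ∧ ∫ x in Ioc 0 t, x ^ (β * (m + 1 : ℕ) - 1) * (t - x) ^ (-β) =
        t ^ (β * m) * (Gamma (β * (m + 1 : ℕ)) * Gamma (1 - β) / Gamma (β * m + 1)) := by
      intro m
      have h := beta_integral_rpow (hp m) hβ1 ht
      rw [intervalIntegrable_iff_integrableOn_Ioc_of_le ht.le,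
        intervalIntegral.integral_of_le ht.le] at h
      have e1 : 1 - β - 1 = -β := by ring
      have e2 : β * ((m + 1 : ℕ) : ℝ) + (1 - β) = β * m + 1 := by push_cast; ring
      have e3 : β * (m : ℝ) + 1 - 1 = β * m := by ring
      rw [e1, e2, e3] at h
      exact h
    have h := mlDeriv_mul_integral (b := b) hβ0 (S := Ioc 0 t) (w := fun x => (t - x) ^ (-β))
      Ioc_subset_Ioi_self measurableSet_Ioc (fun m => (hw m).1) ?_
    · obtain ⟨hi, hsum⟩ := h
      have hcongr : EqOn (fun x => mlDeriv β b x * (t - x) ^ (-β))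
          (fun τ => (t - τ) ^ (-β) * deriv (mlSeries β b) τ) (Ioc 0 t) := fun x hx => by
        simp only
        rw [(hasDerivAt_mlSeries hβ0 hb hx.1).deriv, mul_comm]
      refine ⟨?_, ?_⟩
      · rw [intervalIntegrable_iff_integrableOn_Ioc_of_le ht.le]
        exact hi.congr_fun hcongr measurableSet_Ioc
      · rw [intervalIntegral.integral_of_le ht.le, ← setIntegral_congr_fun measurableSet_Ioc hcongr,
          ← hsum.tsum_eq, ← tsum_mul_left, mlSeries]
        refine tsum_congr fun m => ?_
        rw [(hw m).2]
        have := (Gamma_pos_of_pos (hp m)).ne'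
        field_simp
    · refine ((summable_mlSeries hβ0 hb.shift ht.le).mul_left (Gamma (1 - β))).congr fun m => ?_
      have : ∫ x in Ioc 0 t, x ^ (β * ((m + 1 : ℕ) : ℝ) - 1) * |(t - x) ^ (-β)| =
          ∫ x in Ioc 0 t, x ^ (β * ((m + 1 : ℕ) : ℝ) - 1) * (t - x) ^ (-β) := by
        refine setIntegral_congr_fun measurableSet_Ioc fun x hx => ?_
        rw [abs_of_nonneg (rpow_nonneg (sub_nonneg.2 hx.2) _)]
      rw [this, (hw m).2]
      have := (Gamma_pos_of_pos (hp m)).ne'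
      field_simp

theorem mlSeries_zero {β : ℝ} (hβ : 0 < β) (b : ℕ → ℝ) : mlSeries β b 0 = b 0 := by
  rw [mlSeries, tsum_eq_single 0]
  · simp
  · intro m hm
    rw [zero_rpow (mul_pos hβ (by positivity)).ne']
    simp

/-! ### The extremum principle for Caputo derivatives -/

/-- Integration by parts against `f τ - f t ≥ 0` moves the derivative onto the increasing kernel
`(t-τ)^{-β}`. The boundary term at `0` and the remaining integral then enter with a minus sign. The
kernel is singular at `t`, so this is done on `[0, x]` with `x < t`, and then `x → t`. -/
theorem HasCaputoDerivAt.nonpos_of_min {β d t : ℝ} {f : ℝ → ℝ} (hβ : β ∈ Ioc (0 : ℝ) 1)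
    (hf : CaputoRegular f) (ht : 0 < t) (hmin : ∀ s ∈ Icc 0 t, f t ≤ f s)
    (hd : HasCaputoDerivAt β f d t) : d ≤ 0 := by
  have hev : ∀ᶠ s in 𝓝[<] t, s ∈ Ioo 0 t := Ioo_mem_nhdsLT ht
  have hslope : ∀ {e : ℝ}, HasDerivAt f e t → Tendsto (slope f t) (𝓝[<] t) (𝓝 e) := by
    intro e he
    exact (hasDerivWithinAt_iff_tendsto_slope' (by simp)).1 (he.hasDerivWithinAt (s := Iio t))
  unfold HasCaputoDerivAt at hd
  split_ifs at hd with h1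
  · refine le_of_tendsto (hslope hd) ?_
    filter_upwards [hev] with s hs
    rw [slope_def_field]
    exact div_nonpos_of_nonneg_of_nonpos (sub_nonneg.2 (hmin s ⟨hs.1.le, hs.2.le⟩))
      (by linarith [hs.2])
  · have hβ1 : 0 < 1 - β := by
      have := lt_of_le_of_ne hβ.2 h1
      linarith
    obtain ⟨hint, rfl⟩ := hd
    have hG1 : 0 < Gamma (1 - β) := Gamma_pos_of_pos hβ1
    suffices h : ∫ τ in (0 : ℝ)..t, (t - τ) ^ (-β) * deriv f τ ≤ 0 from
      mul_nonpos_of_nonneg_of_nonpos (by positivity) h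
    -- the primitive is continuous at `t`
    have hprim : Tendsto (fun x => ∫ τ in (0 : ℝ)..x, (t - τ) ^ (-β) * deriv f τ) (𝓝[<] t)
        (𝓝 (∫ τ in (0 : ℝ)..t, (t - τ) ^ (-β) * deriv f τ)) := by
      have hc := intervalIntegral.continuousOn_primitive_interval
        (a := 0) (b := t) (μ := volume) (f := fun τ => (t - τ) ^ (-β) * deriv f τ)
        ((intervalIntegrable_iff' enorm_ne_top).1 hint)
      have := (hc t right_mem_uIcc).tendsto
      refine this.mono_left (nhdsWithin_le_of_mem ?_)
      filter_upwards [hev] with s hs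
      rw [uIcc_of_le ht.le]
      exact ⟨hs.1.le, hs.2.le⟩
    -- The boundary term at `x` is, up to sign, `(t-x)^{1-β}` times a difference quotient of `f` at
    -- `t`; it vanishes in the limit because `f` is differentiable there.
    have hbd : Tendsto (fun x => (t - x) ^ (-β) * (f x - f t)) (𝓝[<] t) (𝓝 0) := by
      have hda : HasDerivAt f (deriv f t) t :=
        ((hf.diff t ht).differentiableAt (Ioi_mem_nhds ht)).hasDerivAt
      have h2 : Tendsto (fun x => (t - x) ^ (1 - β)) (𝓝[<] t) (𝓝 0) := by
        have : ContinuousAt (fun x : ℝ => (t - x) ^ (1 - β)) t :=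
          ContinuousAt.rpow_const (by fun_prop) (Or.inr hβ1.le)
        have h3 := this.tendsto
        simp only [sub_self, zero_rpow hβ1.ne'] at h3
        exact h3.mono_left nhdsWithin_le_nhds
      have h3 := (h2.mul (hslope hda)).neg
      rw [zero_mul, neg_zero] at h3
      refine h3.congr' ?_
      filter_upwards [hev] with x hx
      have hx' : 0 < t - x := sub_pos.2 hx.2
      rw [slope_def_field, sub_eq_add_neg 1 β, rpow_add hx', rpow_one]
      have : x - t ≠ 0 := by linarith
      field_simp
      ring
    refine le_of_tendsto_of_tendsto hprim hbd ?_
    filter_upwards [hev] with x hx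
    have hsub : ∀ τ ∈ Icc 0 x, 0 < t - τ := fun τ hτ => by linarith [hτ.2, hx.2]
    have hparts := intervalIntegral.integral_mul_deriv_eq_deriv_mul_of_hasDeriv_right
      (a := 0) (b := x) (u := fun τ => (t - τ) ^ (-β)) (v := fun τ => f τ - f t)
      (u' := fun τ => β * (t - τ) ^ (-β - 1)) (v' := deriv f) ?_ ?_ ?_ ?_ ?_ ?_
    · rw [hparts]
      have h4 : 0 ≤ (t - 0) ^ (-β) * (f 0 - f t) := by
        have := hmin 0 ⟨le_rfl, ht.le⟩
        have := sub_nonneg.2 this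
        positivity
      have h5 : 0 ≤ ∫ τ in (0 : ℝ)..x, β * (t - τ) ^ (-β - 1) * (f τ - f t) := by
        refine intervalIntegral.integral_nonneg hx.1.le fun τ hτ => ?_
        have := sub_nonneg.2 (hmin τ ⟨hτ.1, hτ.2.trans hx.2.le⟩)
        have := hsub τ hτ
        have := hβ.1
        positivity
      linarith
    · rw [uIcc_of_le hx.1.le]
      exact ContinuousOn.rpow_const (by fun_prop) fun τ hτ => Or.inl (hsub τ hτ).ne'
    · rw [uIcc_of_le hx.1.le]
      exact (hf.cont.mono Icc_subset_Ici_self).sub continuousOn_const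
    · intro τ hτ
      rw [min_eq_left hx.1.le, max_eq_right hx.1.le] at hτ
      have h6 : HasDerivAt (fun τ : ℝ => t - τ) (-1) τ := by
        simpa using (hasDerivAt_id τ).const_sub t
      have h7 := h6.rpow_const (p := -β) (Or.inl (hsub τ ⟨hτ.1.le, hτ.2.le⟩).ne')
      refine (h7.congr_deriv ?_).hasDerivWithinAt
      ring
    · intro τ hτ
      rw [min_eq_left hx.1.le, max_eq_right hx.1.le] at hτ
      exact (((hf.diff τ hτ.1).differentiableAt (Ioi_mem_nhds hτ.1)).hasDerivAt.sub_const
        _).hasDerivWithinAt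
    · refine ContinuousOn.intervalIntegrable ?_
      rw [uIcc_of_le hx.1.le]
      exact continuousOn_const.mul
        (ContinuousOn.rpow_const (by fun_prop) fun τ hτ => Or.inl (hsub τ hτ).ne')
    · exact hf.int x hx.1

/-- A supersolution of `D^β f = -c f` with non-negative initial value is non-negative. -/
theorem nonneg_of_caputo_add_mul_nonneg {β c : ℝ} {f d : ℝ → ℝ} (hβ : β ∈ Ioc (0 : ℝ) 1)
    (hf : CaputoRegular f) (h0 : 0 ≤ f 0) (hc : 0 < c)
    (hd : ∀ t, 0 < t → HasCaputoDerivAt β f (d t) t) (h : ∀ t, 0 < t → 0 ≤ d t + c * f t)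
    {t : ℝ} (ht : 0 ≤ t) : 0 ≤ f t := by
  by_contra! hneg
  -- At a negative minimum `s > 0` the derivative is `≤ 0` and `c * f s < 0`, contradicting the
  -- supersolution inequality.
  obtain ⟨s, hs, hmin⟩ := isCompact_Icc.exists_isMinOn (nonempty_Icc.2 ht)
    (hf.cont.mono (Icc_subset_Ici_self : Icc 0 t ⊆ Ici 0))
  have hs1 : f s < 0 := lt_of_le_of_lt (hmin (right_mem_Icc.2 ht)) hneg
  have hs0 : 0 < s := by
    rcases hs.1.eq_or_lt with h | h
    · rw [← h] at hs1; linarith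
    · exact h
  have h1 := (hd s hs0).nonpos_of_min hβ hf hs0 fun r hr => hmin ⟨hr.1, hr.2.trans hs.2⟩
  have h2 := h s hs0
  have h3 := mul_neg_of_pos_of_neg hc hs1
  linarith

theorem CaputoRegular.sub {f g : ℝ → ℝ} (hf : CaputoRegular f) (hg : CaputoRegular g) :
    CaputoRegular (fun t => f t - g t) where
  cont := hf.cont.sub hg.cont
  diff := hf.diff.sub hg.diff
  int := fun T hT => by
    rw [intervalIntegrable_iff_integrableOn_Ioc_of_le hT.le]
    have h1 := ((hf.int T hT).sub (hg.int T hT))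
    rw [intervalIntegrable_iff_integrableOn_Ioc_of_le hT.le] at h1
    refine h1.congr_fun (fun t ht => ?_) measurableSet_Ioc
    exact (deriv_fun_sub ((hf.diff t ht.1).differentiableAt (Ioi_mem_nhds ht.1))
      ((hg.diff t ht.1).differentiableAt (Ioi_mem_nhds ht.1))).symm

theorem HasCaputoDerivAt.sub {β d e t : ℝ} {f g : ℝ → ℝ} (hf : CaputoRegular f)
    (hg : CaputoRegular g) (ht : 0 < t) (hfd : HasCaputoDerivAt β f d t)
    (hgd : HasCaputoDerivAt β g e t) : HasCaputoDerivAt β (fun t => f t - g t) (d - e) t := by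
  unfold HasCaputoDerivAt at *
  split_ifs at * with h1
  · exact HasDerivAt.sub hfd hgd
  · obtain ⟨h2, rfl⟩ := hfd
    obtain ⟨h3, rfl⟩ := hgd
    have hcongr : EqOn (fun τ => (t - τ) ^ (-β) * deriv f τ - (t - τ) ^ (-β) * deriv g τ)
        (fun τ => (t - τ) ^ (-β) * deriv (fun t => f t - g t) τ) (Ioc 0 t) := fun τ hτ => by
      simp only
      rw [deriv_fun_sub ((hf.diff τ hτ.1).differentiableAt (Ioi_mem_nhds hτ.1))
        ((hg.diff τ hτ.1).differentiableAt (Ioi_mem_nhds hτ.1)), mul_sub]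
    refine ⟨?_, ?_⟩
    · have h4 := h2.sub h3
      rw [intervalIntegrable_iff_integrableOn_Ioc_of_le ht.le] at h4 ⊢
      exact h4.congr_fun hcongr measurableSet_Ioc
    · rw [← mul_sub, ← intervalIntegral.integral_sub h2 h3,
        intervalIntegral.integral_of_le ht.le, intervalIntegral.integral_of_le ht.le,
        setIntegral_congr_fun measurableSet_Ioc hcongr]

/-- Uniqueness for `D^β f = -c f`. -/
theorem eq_zero_of_caputo_eq_neg_mul {β c : ℝ} {f : ℝ → ℝ} (hβ : β ∈ Ioc (0 : ℝ) 1)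
    (hf : CaputoRegular f) (h0 : f 0 = 0) (hc : 0 < c)
    (hd : ∀ t, 0 < t → HasCaputoDerivAt β f (-c * f t) t) {t : ℝ} (ht : 0 ≤ t) : f t = 0 := by
  have hz : CaputoRegular (fun _ : ℝ => (0 : ℝ)) :=
    ⟨continuousOn_const, differentiableOn_const _, fun T _ => by simp⟩
  have hzd : ∀ t : ℝ, HasCaputoDerivAt β (fun _ : ℝ => (0 : ℝ)) 0 t := fun t => by
    unfold HasCaputoDerivAt
    split_ifs
    · exact hasDerivAt_const _ _
    · simp
  have h1 := nonneg_of_caputo_add_mul_nonneg hβ hf h0.ge hc hd (fun t _ => by simp) ht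
  -- The same principle for `-f`, written `0 - f`.
  have h2 := nonneg_of_caputo_add_mul_nonneg hβ (hz.sub hf) (by simp [h0]) hc
    (fun t ht => (hzd t).sub hz hf ht (hd t ht)) (fun t _ => by simp) ht
  linarith

/-! ### Formal Taylor series at the origin -/

/-- The formal Taylor series of `f` at `0`. -/
def taylorPS (f : ℝ → ℝ) : PowerSeries ℝ :=
  PowerSeries.mk fun n => iteratedDeriv n f 0 / (n.factorial : ℝ)

theorem coeff_taylorPS (f : ℝ → ℝ) (n : ℕ) :
    PowerSeries.coeff n (taylorPS f) = iteratedDeriv n f 0 / (n.factorial : ℝ) :=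
  PowerSeries.coeff_mk _ _

theorem taylorPS_congr {f g : ℝ → ℝ} (h : f =ᶠ[𝓝 0] g) : taylorPS f = taylorPS g := by
  ext n
  rw [coeff_taylorPS, coeff_taylorPS, h.iteratedDeriv_eq]

/-- This is the Leibniz rule; it makes the formal Taylor series multiplicative, so functional
identities near `0` become identities of power series. -/
theorem taylorPS_mul {f g : ℝ → ℝ} (hf : AnalyticAt ℝ f 0) (hg : AnalyticAt ℝ g 0) :
    taylorPS (fun u => f u * g u) = taylorPS f * taylorPS g := by
  ext n
  rw [PowerSeries.coeff_mul, coeff_taylorPS, iteratedDeriv_fun_mul hf.contDiffAt hg.contDiffAt,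
    Finset.Nat.sum_antidiagonal_eq_sum_range_succ_mk, Finset.sum_div]
  refine Finset.sum_congr rfl fun i hi => ?_
  have hi' : i ≤ n := Nat.lt_succ_iff.1 (Finset.mem_range.1 hi)
  rw [coeff_taylorPS, coeff_taylorPS, Nat.cast_choose ℝ hi']
  have := Nat.factorial_ne_zero n
  field_simp

theorem taylorPS_deriv (f : ℝ → ℝ) :
    taylorPS (deriv f) = PowerSeries.derivative ℝ (taylorPS f) := by
  ext n
  rw [PowerSeries.coeff_derivative, coeff_taylorPS, coeff_taylorPS, iteratedDeriv_succ',
    Nat.factorial_succ]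
  push_cast
  field_simp

theorem constantCoeff_taylorPS (f : ℝ → ℝ) : PowerSeries.coeff 0 (taylorPS f) = f 0 := by
  simp [coeff_taylorPS]

theorem taylorPS_one : taylorPS (fun _ => 1) = 1 := by
  ext n
  rw [coeff_taylorPS, PowerSeries.coeff_one, iteratedDeriv_const]
  split_ifs with h <;> simp [h]

/-- The coefficients of a convergent power series are its Taylor coefficients. -/
theorem taylorPS_of_hasSum {f : ℝ → ℝ} {a : ℕ → ℝ}
    (h : ∀ᶠ u in 𝓝 (0 : ℝ), HasSum (fun n => a n * u ^ n) (f u)) :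
    AnalyticAt ℝ f 0 ∧ ∀ n, PowerSeries.coeff n (taylorPS f) = a n := by
  have h1 : HasFPowerSeriesAt f (FormalMultilinearSeries.ofScalars ℝ a) 0 := by
    rw [hasFPowerSeriesAt_iff]
    filter_upwards [h] with u hu
    simpa [mul_comm] using hu
  refine ⟨h1.analyticAt, fun n => ?_⟩
  have h2 := h1.eq_formalMultilinearSeries h1.analyticAt.hasFPowerSeriesAt
  rw [FormalMultilinearSeries.ofScalars_series_eq_iff] at h2
  rw [coeff_taylorPS, h2]

theorem lapFn_apply (g : ℝ → ℝ) (i j : ℤ) : lapFn g i j =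
    if i ≤ j then PowerSeries.coeff (j - i).toNat (taylorPS fun u => g (1 - u)) else 0 := by
  simp only [lapFn, coeff_taylorPS]

/-! ### The upper triangular circulant matrix of a power series -/

/-- The upper triangular circulant matrix of a power series. -/
def circ (p : PowerSeries ℝ) : Matrix ℤ ℤ ℝ :=
  fun i j => if i ≤ j then PowerSeries.coeff (j - i).toNat p else 0

theorem lapFn_eq_circ (g : ℝ → ℝ) : lapFn g = circ (taylorPS fun u => g (1 - u)) := by
  funext i j
  rw [lapFn_apply, circ]

theorem circ_one : circ 1 = 1 := by
  funext i j
  rw [circ, PowerSeries.coeff_one, Matrix.one_apply]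
  by_cases h : i = j
  · simp [h]
  · by_cases h2 : i ≤ j
    · have : (j - i).toNat ≠ 0 := by omega
      simp [h, this]
    · simp [h, h2]

/-- The substitution `k ↦ i + k` turns the sum over `[i, j]` into the Cauchy product. The circulants
thus form a copy of the ring of power series. -/
theorem utMul_circ (p q : PowerSeries ℝ) : utMul (circ p) (circ q) = circ (p * q) := by
  funext i j
  rw [utMul, circ]
  split_ifs with h
  · obtain ⟨n, rfl⟩ : ∃ n : ℕ, j = i + n := ⟨(j - i).toNat, by omega⟩
    have e : (i + (n : ℤ) - i).toNat = n := by omega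
    rw [e, PowerSeries.coeff_mul, Finset.Nat.sum_antidiagonal_eq_sum_range_succ_mk]
    symm
    refine Finset.sum_bij (fun (k : ℕ) _ => i + (k : ℤ)) ?_ ?_ ?_ ?_
    · intro k hk
      have := Finset.mem_range.1 hk
      rw [Finset.mem_Icc]
      omega
    · intro a _ b _ hab
      have : i + (a : ℤ) = i + b := hab
      omega
    · intro b hb
      rw [Finset.mem_Icc] at hb
      refine ⟨(b - i).toNat, Finset.mem_range.2 (by omega), by omega⟩
    · intro k hk
      have hk := Finset.mem_range.1 hk
      have e1 : (i + (k : ℤ) - i).toNat = k := by omega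
      have e2 : (i + (n : ℤ) - (i + k)).toNat = n - k := by omega
      rw [circ, circ, if_pos (by omega), if_pos (by omega), e1, e2]
  · rw [Finset.Icc_eq_empty (by omega), Finset.sum_empty]

theorem smul_circ (c : ℝ) (p : PowerSeries ℝ) : c • circ p = circ (c • p) := by
  funext i j
  simp only [Matrix.smul_apply, circ, smul_eq_mul, mul_ite, mul_zero]
  simp

theorem utPow_circ (p : PowerSeries ℝ) (k : ℕ) : utPow (circ p) k = circ (p ^ k) := by
  induction k with
  | zero => rw [utPow, pow_zero, circ_one]
  | succ k ih => rw [utPow, ih, utMul_circ, pow_succ]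

/-! ### The functions `s^{-d} (lam + s^α)^{-c}` -/

theorem analyticAt_rpow_const {x : ℝ} (p : ℝ) (hx : 0 < x) : AnalyticAt ℝ (fun y => y ^ p) x := by
  have h : (fun y : ℝ => y ^ p) =ᶠ[𝓝 x] fun y => exp (Real.log y * p) := by
    filter_upwards [lt_mem_nhds hx] with y hy
    rw [rpow_def_of_pos hy]
  rw [analyticAt_congr h]
  exact ((analyticAt_log hx).mul analyticAt_const).rexp'

theorem AnalyticAt.rpow_const_of_pos {f : ℝ → ℝ} {x : ℝ} (p : ℝ) (hf : AnalyticAt ℝ f x)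
    (hx : 0 < f x) : AnalyticAt ℝ (fun y => f y ^ p) x :=
  (analyticAt_rpow_const p hx).comp hf

/-- The functions `s^{-d} (lam + s^α)^{-c}`, completely monotone for `c, d ≥ 0`. -/
def cmFn (α lam c d s : ℝ) : ℝ := s ^ (-d) * (lam + s ^ α) ^ (-c)

theorem analyticAt_cmFn (α c d : ℝ) {lam s : ℝ} (hlam : 0 < lam) (hs : 0 < s) :
    AnalyticAt ℝ (cmFn α lam c d) s := by
  refine (analyticAt_rpow_const _ hs).mul (AnalyticAt.rpow_const_of_pos _ ?_ (by positivity))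
  exact analyticAt_const.add (analyticAt_rpow_const _ hs)

/-- The form of the derivative is what matters: for non-negative `α`, `c` and `d` it is a
non-positive combination of functions of the same family, with exponents `d + 1` and `d + 1 - α`. -/
theorem hasDerivAt_cmFn (α c d : ℝ) {lam s : ℝ} (hlam : 0 < lam) (hs : 0 < s) :
    HasDerivAt (cmFn α lam c d)
      (-d * cmFn α lam c (d + 1) s + -(c * α) * cmFn α lam (c + 1) (d + 1 - α) s) s := by
  have hp : 0 < lam + s ^ α := by positivity
  have h1 := Real.hasDerivAt_rpow_const (p := -d) (Or.inl hs.ne')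
  have h2 := ((Real.hasDerivAt_rpow_const (p := α) (Or.inl hs.ne')).const_add lam).rpow_const
    (p := -c) (Or.inl hp.ne')
  refine (h1.mul h2).congr_deriv ?_
  simp only [cmFn]
  have e1 : s ^ (-(d + 1 - α)) = s ^ (-d) * s ^ (α - 1) := by
    rw [← rpow_add hs]; ring_nf
  have e2 : -(d + 1) = -d - 1 := by ring
  have e3 : -(c + 1) = -c - 1 := by ring
  rw [e1, e2, e3]
  ring

/-- Induction over all exponents at once. The condition `α ≤ 1` keeps `d + 1 - α` non-negative, so
the inductive hypothesis applies to both summands of the derivative. -/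
theorem cmFn_sign {α lam : ℝ} (hα : α ∈ Ioc (0 : ℝ) 1) (hlam : 0 < lam) (n : ℕ) :
    ∀ c d : ℝ, 0 ≤ c → 0 ≤ d → ∀ s, 0 < s →
      0 ≤ (-1) ^ n * iteratedDeriv n (cmFn α lam c d) s := by
  induction n with
  | zero =>
    intro c d _ _ s hs
    simp only [pow_zero, one_mul, iteratedDeriv_zero, cmFn]
    positivity
  | succ n ih =>
    intro c d hc hd s hs
    have hev : deriv (cmFn α lam c d) =ᶠ[𝓝 s] fun s =>
        -d * cmFn α lam c (d + 1) s + -(c * α) * cmFn α lam (c + 1) (d + 1 - α) s := by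
      filter_upwards [lt_mem_nhds hs] with x hx
      exact (hasDerivAt_cmFn α c d hlam hx).deriv
    have a1 := (analyticAt_cmFn α c (d + 1) hlam hs).contDiffAt (n := n)
    have a2 := (analyticAt_cmFn α (c + 1) (d + 1 - α) hlam hs).contDiffAt (n := n)
    rw [iteratedDeriv_succ', hev.iteratedDeriv_eq,
      iteratedDeriv_fun_add (contDiffAt_const.mul a1) (contDiffAt_const.mul a2),
      iteratedDeriv_const_mul_field, iteratedDeriv_const_mul_field]
    have i1 := ih c (d + 1) hc (by linarith) s hs
    have i2 := ih (c + 1) (d + 1 - α) (by linarith) (by linarith [hα.2]) s hs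
    have i3 := mul_nonneg hd i1
    have i4 := mul_nonneg (mul_nonneg hc hα.1.le) i2
    rw [pow_succ]
    linarith

/-! ### The functions `g_{ML,α}^c` -/

theorem gMLpow_eq_cmFn {α lam c s : ℝ} (hlam : 0 < lam) (hs : 0 < s) :
    gMLpow α lam c s = cmFn α lam c (-(α * c)) s := by
  have hp : 0 < lam + s ^ α := by positivity
  rw [gMLpow, cmFn, div_rpow (by positivity) hp.le, neg_neg, rpow_mul hs.le, rpow_neg hp.le,
    div_eq_mul_inv]

theorem analyticAt_gMLpow (α c : ℝ) {lam s : ℝ} (hlam : 0 < lam) (hs : 0 < s) :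
    AnalyticAt ℝ (gMLpow α lam c) s := by
  have h : gMLpow α lam c =ᶠ[𝓝 s] cmFn α lam c (-(α * c)) := by
    filter_upwards [lt_mem_nhds hs] with y hy using gMLpow_eq_cmFn hlam hy
  exact (analyticAt_congr h).2 (analyticAt_cmFn α c _ hlam hs)

/-- For the special exponent `d = -αc` the two summands combine into a single function of the
family, now with `d = 1 - αc`. This is non-negative when `α, c ≤ 1`, although `-αc` itself is not,
and makes `gMLpow_sign` a corollary of `cmFn_sign`. -/
theorem hasDerivAt_gMLpow (α c : ℝ) {lam s : ℝ} (hlam : 0 < lam) (hs : 0 < s) :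
    HasDerivAt (gMLpow α lam c) (c * α * lam * cmFn α lam (c + 1) (1 - α * c) s) s := by
  have h : gMLpow α lam c =ᶠ[𝓝 s] cmFn α lam c (-(α * c)) := by
    filter_upwards [lt_mem_nhds hs] with y hy using gMLpow_eq_cmFn hlam hy
  refine ((hasDerivAt_cmFn α c (-(α * c)) hlam hs).congr_of_eventuallyEq h).congr_deriv ?_
  have hp : 0 < lam + s ^ α := by positivity
  simp only [cmFn]
  have e1 : (lam + s ^ α) ^ (-c) = (lam + s ^ α) ^ (-(c + 1)) * (lam + s ^ α) := by
    rw [← rpow_add_one hp.ne']; ring_nf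
  have e2 : s ^ (-(-(α * c) + 1 - α)) = s ^ (-(1 - α * c)) * s ^ α := by
    rw [← rpow_add hs]; ring_nf
  have e3 : -(α * c) + 1 = 1 - α * c := by ring
  rw [e1, e2, e3]
  ring

theorem gMLpow_sign {α lam c : ℝ} (hα : α ∈ Ioc (0 : ℝ) 1) (hlam : 0 < lam)
    (hc : c ∈ Icc (0 : ℝ) 1) {n : ℕ} (hn : 1 ≤ n) {s : ℝ} (hs : 0 < s) :
    0 ≤ (-1) ^ (n - 1) * iteratedDeriv n (gMLpow α lam c) s := by
  obtain ⟨k, rfl⟩ : ∃ k, n = k + 1 := ⟨n - 1, by omega⟩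
  have hev : deriv (gMLpow α lam c) =ᶠ[𝓝 s] fun s =>
      c * α * lam * cmFn α lam (c + 1) (1 - α * c) s := by
    filter_upwards [lt_mem_nhds hs] with x hx
    exact (hasDerivAt_gMLpow α c hlam hx).deriv
  have h1 : α * c ≤ 1 := mul_le_one₀ hα.2 hc.1 hc.2
  have := cmFn_sign hα hlam k (c + 1) (1 - α * c) (by linarith [hc.1]) (by linarith) s hs
  rw [iteratedDeriv_succ', hev.iteratedDeriv_eq, iteratedDeriv_const_mul_field,
    Nat.add_sub_cancel, mul_left_comm]
  have := hα.1
  have := hc.1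
  positivity

theorem gMLpow_nonneg (α c : ℝ) {lam s : ℝ} (hlam : 0 < lam) (hs : 0 ≤ s) :
    0 ≤ gMLpow α lam c s := by
  unfold gMLpow
  positivity

theorem gMLpow_zero {α lam c : ℝ} (hα : 0 < α) (hc : 0 < c) : gMLpow α lam c 0 = 0 := by
  simp [gMLpow, zero_rpow hα.ne', zero_rpow hc.ne']

theorem continuousOn_gMLpow {α lam c : ℝ} (hα : 0 < α) (hlam : 0 < lam) (hc : 0 ≤ c) :
    ContinuousOn (gMLpow α lam c) (Ici 0) := by
  have h1 : ContinuousOn (fun s : ℝ => s ^ α) (Ici 0) :=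
    (Real.continuous_rpow_const hα.le).continuousOn
  refine ContinuousOn.rpow_const (h1.div (continuousOn_const.add h1) fun s hs => ?_)
    fun s _ => Or.inr hc
  have : (0 : ℝ) ≤ s := hs
  positivity

theorem gMLpow_le_one {α lam c s : ℝ} (hlam : 0 < lam) (hc : 0 ≤ c) (hs : 0 ≤ s) :
    gMLpow α lam c s ≤ 1 := by
  have h : 0 ≤ s ^ α := by positivity
  refine rpow_le_one (by positivity) ?_ hc
  rw [div_le_one (by positivity)]
  linarith

theorem isLaplacianBernstein_gMLpow {α lam c : ℝ} (hα : α ∈ Ioc (0 : ℝ) 1) (hlam : 0 < lam)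
    (hc : c ∈ Ioc (0 : ℝ) 1) : IsLaplacianBernstein (gMLpow α lam c) where
  cont := continuousOn_gMLpow hα.1 hlam hc.1.le
  smooth := fun _ _ hs => (analyticAt_gMLpow α c hlam hs).contDiffAt.contDiffWithinAt
  nonneg := fun _ hs => gMLpow_nonneg α c hlam hs
  sign := fun _ hn _ hs => gMLpow_sign hα hlam ⟨hc.1.le, hc.2⟩ hn hs
  at_zero := gMLpow_zero hα.1 hc.1
  no_drift := by
    refine squeeze_zero' ?_ ?_ (tendsto_inv_atTop_zero (𝕜 := ℝ))
    · filter_upwards [eventually_ge_atTop 0] with s hs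
      exact div_nonneg (gMLpow_nonneg α c hlam hs) hs
    · filter_upwards [eventually_ge_atTop 0] with s hs
      rw [inv_eq_one_div]
      gcongr
      exact gMLpow_le_one hlam hc.1.le hs

/-! ### The Taylor series of `g_{ML,α}^c (1 - u)` -/

/-- The Taylor series of `u ↦ g_{ML,α}^c (1 - u)`. -/
def mlPS (α lam c : ℝ) : PowerSeries ℝ := taylorPS fun u => gMLpow α lam c (1 - u)

theorem discPrabhakar_eq (α c lam : ℝ) (n : ℕ) :
    discPrabhakar α c lam n = PowerSeries.coeff n (mlPS α lam c) := by
  rw [discPrabhakar, lapFn_apply, if_pos (by simp)]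
  simp [mlPS]

theorem lapFn_gMLpow (α lam c : ℝ) : lapFn (gMLpow α lam c) = circ (mlPS α lam c) :=
  lapFn_eq_circ _

theorem analyticAt_comp_one_sub {g : ℝ → ℝ} (hg : AnalyticAt ℝ g 1) :
    AnalyticAt ℝ (fun u => g (1 - u)) 0 := by
  have h : AnalyticAt ℝ (fun u : ℝ => 1 - u) 0 := analyticAt_const.sub analyticAt_id
  have hg' : AnalyticAt ℝ g ((fun u : ℝ => 1 - u) 0) := by simpa using hg
  exact hg'.comp h

theorem analyticAt_gMLpow_one_sub (α c : ℝ) {lam : ℝ} (hlam : 0 < lam) :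
    AnalyticAt ℝ (fun u => gMLpow α lam c (1 - u)) 0 :=
  analyticAt_comp_one_sub (analyticAt_gMLpow α c hlam one_pos)

theorem eventually_one_sub_pos : ∀ᶠ u in 𝓝 (0 : ℝ), 0 < 1 - u := by
  filter_upwards [gt_mem_nhds (zero_lt_one' ℝ)] with u hu
  linarith

theorem mlPS_add (α c d : ℝ) {lam : ℝ} (hlam : 0 < lam) :
    mlPS α lam (c + d) = mlPS α lam c * mlPS α lam d := by
  rw [mlPS, mlPS, mlPS, ← taylorPS_mul (analyticAt_gMLpow_one_sub α c hlam)
    (analyticAt_gMLpow_one_sub α d hlam)]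
  refine taylorPS_congr ?_
  filter_upwards [eventually_one_sub_pos] with u hu
  have : 0 < (1 - u) ^ α / (lam + (1 - u) ^ α) := by positivity
  rw [gMLpow, gMLpow, gMLpow, rpow_add this]

theorem mlPS_zero (α lam : ℝ) : mlPS α lam 0 = 1 := by
  rw [mlPS, ← taylorPS_one]
  congr 1
  funext u
  simp [gMLpow]

theorem mlPS_nat_mul (α c : ℝ) {lam : ℝ} (hlam : 0 < lam) (m : ℕ) :
    mlPS α lam (m * c) = mlPS α lam c ^ m := by
  induction m with
  | zero => simp [mlPS_zero]
  | succ m ih => rw [pow_succ, ← ih, ← mlPS_add _ _ _ hlam]; push_cast; ring_nf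

theorem gMLpow_eq_one_add_rpow {α lam c s : ℝ} (hlam : 0 < lam) (hs : 0 < s) :
    gMLpow α lam c s = (1 + lam * s ^ (-α)) ^ (-c) := by
  have h1 : 0 < s ^ α := by positivity
  have h2 : 0 < 1 + lam * s ^ (-α) := by positivity
  rw [gMLpow, rpow_neg h2.le, ← inv_rpow h2.le]
  congr 1
  rw [rpow_neg hs.le]
  field_simp
  ring

/-- The holomorphic extension of `u ↦ g_{ML,α}^c (1 - u)` to the unit disc. -/
theorem differentiableOn_complex_gMLpow {α lam : ℝ} (c : ℝ) (hα : α ∈ Ioc (0 : ℝ) 1)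
    (hlam : 0 < lam) : DifferentiableOn ℂ
      (fun z : ℂ => (1 + lam * (1 - z) ^ (-α : ℂ)) ^ (-c : ℂ)) (Metric.ball 0 1) := by
  intro z hz
  have hz1 : ‖z‖ < 1 := by simpa using hz
  have hre : 0 < (1 - z).re := by
    have := (Complex.abs_re_le_norm z)
    have := (abs_le.1 this).2
    simp only [Complex.sub_re, Complex.one_re]
    linarith
  have hne : (1 - z) ≠ 0 := fun h => by rw [h] at hre; simp at hre
  have harg : |Complex.arg (1 - z)| < π / 2 :=
    Complex.abs_arg_lt_pi_div_two_iff.2 (Or.inl hre)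
  -- The argument of `1 - z` lies in `(-π/2, π/2)`, and multiplying it by `α ≤ 1` keeps it there. So
  -- the base of the outer power has positive real part and avoids the branch cut.
  have hpos : 0 < ((1 - z) ^ (-α : ℂ)).re := by
    rw [Complex.cpow_def_of_ne_zero hne, Complex.exp_re]
    refine mul_pos (Real.exp_pos _) (Real.cos_pos_of_mem_Ioo ?_)
    have him : (Complex.log (1 - z) * (-α : ℂ)).im = -(α * Complex.arg (1 - z)) := by
      have : (-α : ℂ) = ((-α : ℝ) : ℂ) := by push_cast; rfl
      rw [this, Complex.im_mul_ofReal, Complex.log_im]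
      ring
    have h2 : |α * Complex.arg (1 - z)| < π / 2 := by
      rw [abs_mul, abs_of_pos hα.1]
      refine lt_of_le_of_lt ?_ harg
      exact mul_le_of_le_one_left (abs_nonneg _) hα.2
    rw [him]
    have := abs_lt.1 h2
    constructor <;> linarith
  have hpos2 : 0 < (1 + lam * (1 - z) ^ (-α : ℂ)).re := by
    rw [Complex.add_re, Complex.one_re, Complex.re_ofReal_mul]
    positivity
  have d1 : DifferentiableAt ℂ (fun z : ℂ => (1 - z) ^ (-α : ℂ)) z :=
    DifferentiableAt.cpow_const (by fun_prop) (Or.inl hre)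
  exact (DifferentiableAt.cpow_const ((d1.const_mul _).const_add _)
    (Or.inl hpos2)).differentiableWithinAt

/-- Real analyticity at `0` would give only some radius of convergence, but radius `1` is needed in
order to let `u → 1`. The holomorphic extension provides it; the real parts of its coefficients are
the real Taylor coefficients by uniqueness. -/
theorem hasSum_mlPS {α lam : ℝ} (c : ℝ) (hα : α ∈ Ioc (0 : ℝ) 1) (hlam : 0 < lam) {u : ℝ}
    (hu : |u| < 1) :
    HasSum (fun n => PowerSeries.coeff n (mlPS α lam c) * u ^ n) (gMLpow α lam c (1 - u)) := by
  set F : ℂ → ℂ := fun z => (1 + lam * (1 - z) ^ (-α : ℂ)) ^ (-c : ℂ)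
  set a : ℕ → ℝ := fun n => ((n.factorial : ℂ)⁻¹ * iteratedDeriv n F 0).re with ha
  have key : ∀ u : ℝ, |u| < 1 → HasSum (fun n => a n * u ^ n) (gMLpow α lam c (1 - u)) := by
    intro u hu
    have hu' : 0 < 1 - u := by linarith [(abs_lt.1 hu).2]
    have h := Complex.hasSum_taylorSeries_on_ball (z := (u : ℂ))
      (differentiableOn_complex_gMLpow c hα hlam) (by simpa using hu)
    have h2 := Complex.hasSum_re h
    have e : F (u : ℂ) = ((gMLpow α lam c (1 - u) : ℝ) : ℂ) := by
      rw [gMLpow_eq_one_add_rpow hlam hu', Complex.ofReal_cpow (by positivity)]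
      simp only [F]
      push_cast
      rw [Complex.ofReal_cpow hu'.le]
      push_cast
      rfl
    change HasSum _ (F (u : ℂ)).re at h2
    rw [e, Complex.ofReal_re] at h2
    refine h2.congr_fun fun n => ?_
    simp only [ha, sub_zero, smul_eq_mul]
    rw [← mul_assoc, mul_right_comm, ← Complex.ofReal_pow, Complex.re_mul_ofReal]
  have h3 := (taylorPS_of_hasSum (f := fun u => gMLpow α lam c (1 - u)) (a := a) ?_).2
  · refine (key u hu).congr_fun fun n => ?_
    rw [mlPS, h3 n]
  · filter_upwards [Ioo_mem_nhds (show (-1 : ℝ) < 0 by norm_num) one_pos] with u hu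
    exact key u (abs_lt.2 hu)

theorem coeff_zero_mlPS (α lam c : ℝ) :
    PowerSeries.coeff 0 (mlPS α lam c) = (1 / (lam + 1)) ^ c := by
  rw [mlPS, constantCoeff_taylorPS]
  simp [gMLpow]

theorem coeff_mlPS_nonpos {α lam c : ℝ} (hα : α ∈ Ioc (0 : ℝ) 1) (hlam : 0 < lam)
    (hc : c ∈ Icc (0 : ℝ) 1) {n : ℕ} (hn : 1 ≤ n) : PowerSeries.coeff n (mlPS α lam c) ≤ 0 := by
  rw [mlPS, coeff_taylorPS, iteratedDeriv_comp_const_sub]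
  have h := gMLpow_sign hα hlam hc hn (s := 1) one_pos
  obtain ⟨k, rfl⟩ : ∃ k, n = k + 1 := ⟨n - 1, by omega⟩
  rw [Nat.add_sub_cancel] at h
  refine div_nonpos_of_nonpos_of_nonneg ?_ (by positivity)
  simp only [sub_zero, smul_eq_mul, pow_succ]
  linarith

/-- The coefficients of `g_{ML,α}^c (1 - u)` are absolutely summable with sum `0`. -/
theorem hasSum_coeff_mlPS {α lam c : ℝ} (hα : α ∈ Ioc (0 : ℝ) 1) (hlam : 0 < lam)
    (hc : c ∈ Ioc (0 : ℝ) 1) : HasSum (fun n => PowerSeries.coeff n (mlPS α lam c)) 0 := by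
  set a := fun n => PowerSeries.coeff n (mlPS α lam c) with ha
  have hc' : c ∈ Icc (0 : ℝ) 1 := ⟨hc.1.le, hc.2⟩
  have hneg : ∀ n, a (n + 1) ≤ 0 := fun n => coeff_mlPS_nonpos hα hlam hc' (by omega)
  -- For `u < 1` the sum of the non-negative terms `-a (n+1) u^(n+1)` equals `a 0 - g(1-u)^c ≤ a 0`;
  -- letting `u → 1` bounds the partial sums at `u = 1`.
  have hbound : ∀ N, ∑ n ∈ Finset.range N, -a (n + 1) ≤ a 0 := by
    intro N
    have hlim : Tendsto (fun u : ℝ => ∑ n ∈ Finset.range N, -a (n + 1) * u ^ (n + 1)) (𝓝[<] 1)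
        (𝓝 (∑ n ∈ Finset.range N, -a (n + 1))) := by
      have : Continuous (fun u : ℝ => ∑ n ∈ Finset.range N, -a (n + 1) * u ^ (n + 1)) := by
        fun_prop
      have h2 := this.tendsto 1
      simp only [one_pow, mul_one] at h2
      exact h2.mono_left nhdsWithin_le_nhds
    refine le_of_tendsto hlim ?_
    filter_upwards [Ioo_mem_nhdsLT (zero_lt_one' ℝ)] with u hu
    have hs := hasSum_mlPS c hα hlam (u := u) (by rw [abs_of_pos hu.1]; exact hu.2)
    have hs1 := (hasSum_nat_add_iff' 1).2 hs
    have h3 := sum_le_hasSum (Finset.range N) (fun n _ => ?_) hs1.neg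
    · have h4 := gMLpow_nonneg α c hlam (s := 1 - u) (by linarith [hu.2])
      simp only [Finset.range_one, Finset.sum_singleton, pow_zero, mul_one] at h3
      have h5 : ∑ n ∈ Finset.range N, -a (n + 1) * u ^ (n + 1) =
        ∑ n ∈ Finset.range N, -(PowerSeries.coeff (n + 1) (mlPS α lam c) * u ^ (n + 1)) :=
        Finset.sum_congr rfl fun n _ => by rw [ha]; ring
      rw [h5]
      simp only [ha]
      linarith
    · have := hneg n
      have h6 : 0 ≤ -a (n + 1) * u ^ (n + 1) := by
        have := hu.1
        have : 0 ≤ -a (n + 1) := by linarith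
        positivity
      simp only [ha] at h6
      linarith
  have hsum1 : Summable fun n => -a (n + 1) :=
    summable_of_sum_range_le (fun n => neg_nonneg.2 (hneg n)) hbound
  have hsum : Summable a := (summable_nat_add_iff 1).1 (by simpa using hsum1.neg)
  -- Abel's theorem: the sum of the coefficients is the limit of `g(1-u)^c` as `u → 1`, which is the
  -- value `0` of `g^c` at the origin.
  have habel := Real.tendsto_tsum_powerSeries_nhdsWithin_lt hsum.hasSum.tendsto_sum_nat
  have hg : Tendsto (fun u : ℝ => gMLpow α lam c (1 - u)) (𝓝[<] 1) (𝓝 0) := by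
    have h0 := (continuousOn_gMLpow hα.1 hlam hc.1.le 0 self_mem_Ici).tendsto
    rw [gMLpow_zero hα.1 hc.1] at h0
    refine h0.comp (tendsto_nhdsWithin_of_tendsto_nhds_of_eventually_within _ ?_ ?_)
    · have : Tendsto (fun u : ℝ => 1 - u) (𝓝 1) (𝓝 (1 - 1)) := tendsto_const_nhds.sub tendsto_id
      rw [sub_self] at this
      exact this.mono_left nhdsWithin_le_nhds
    · filter_upwards [self_mem_nhdsWithin] with u hu
      have : u < 1 := hu
      simp only [mem_Ici]
      linarith
  have heq : Tendsto (fun u : ℝ => gMLpow α lam c (1 - u)) (𝓝[<] 1) (𝓝 (∑' n, a n)) := by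
    refine habel.congr' ?_
    filter_upwards [Ioo_mem_nhdsLT (zero_lt_one' ℝ)] with u hu
    exact (hasSum_mlPS c hα hlam (u := u) (by rw [abs_of_pos hu.1]; exact hu.2)).tsum_eq
  have := tendsto_nhds_unique heq hg
  rw [← this]
  exact hsum.hasSum

/-- Only the zeroth coefficient is positive and the total is `0`, so the absolute sum is twice that
coefficient, which is at most `1`. -/
theorem tsum_abs_coeff_mlPS {α lam c : ℝ} (hα : α ∈ Ioc (0 : ℝ) 1) (hlam : 0 < lam)
    (hc : c ∈ Ioc (0 : ℝ) 1) : ∑' n, |PowerSeries.coeff n (mlPS α lam c)| ≤ 2 := by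
  have h := hasSum_coeff_mlPS hα hlam hc
  have h0 : PowerSeries.coeff 0 (mlPS α lam c) = (1 / (lam + 1)) ^ c := coeff_zero_mlPS α lam c
  have h0pos : 0 ≤ PowerSeries.coeff 0 (mlPS α lam c) := by rw [h0]; positivity
  have h0le : PowerSeries.coeff 0 (mlPS α lam c) ≤ 1 := by
    rw [h0]
    exact rpow_le_one (by positivity) (by rw [div_le_one] <;> linarith) hc.1.le
  rw [h.summable.abs.tsum_eq_zero_add, abs_of_nonneg h0pos]
  have h1 := (hasSum_nat_add_iff' 1).2 h
  have h2 : ∀ n, |PowerSeries.coeff (n + 1) (mlPS α lam c)| =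
      -PowerSeries.coeff (n + 1) (mlPS α lam c) := fun n =>
    abs_of_nonpos (coeff_mlPS_nonpos hα hlam ⟨hc.1.le, hc.2⟩ (by omega))
  simp_rw [h2]
  rw [h1.neg.tsum_eq]
  simp only [Finset.range_one, Finset.sum_singleton]
  linarith

/-- Powers of an absolutely summable power series. -/
theorem summable_abs_coeff_pow {p : PowerSeries ℝ} {C s : ℝ} 
    (hp : Summable fun n => |PowerSeries.coeff n p|)
    (hC : ∑' n, |PowerSeries.coeff n p| ≤ C) (hs : HasSum (fun n => PowerSeries.coeff n p) s)
    (m : ℕ) : (Summable fun n => |PowerSeries.coeff n (p ^ m)|) ∧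
      ∑' n, |PowerSeries.coeff n (p ^ m)| ≤ C ^ m ∧
      HasSum (fun n => PowerSeries.coeff n (p ^ m)) (s ^ m) := by
  induction m with
  | zero =>
    have h : ∀ n, n ≠ 0 → PowerSeries.coeff n (1 : PowerSeries ℝ) = 0 := fun n hn => by
      rw [PowerSeries.coeff_one, if_neg hn]
    have h0 : PowerSeries.coeff 0 (1 : PowerSeries ℝ) = 1 := by simp
    simp only [pow_zero]
    have ha := hasSum_single (f := fun n => |PowerSeries.coeff n (1 : PowerSeries ℝ)|) 0
      (fun n hn => by simp only [h n hn, abs_zero])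
    have hb := hasSum_single (f := fun n => PowerSeries.coeff n (1 : PowerSeries ℝ)) 0
      (fun n hn => by simp only [h n hn])
    rw [h0] at hb
    simp only [h0, abs_one] at ha
    exact ⟨ha.summable, ha.tsum_eq.le, hb⟩
  | succ m ih =>
    obtain ⟨i1, i2, i3⟩ := ih
    simp only [pow_succ, PowerSeries.coeff_mul]
    have hC0 : 0 ≤ C := le_trans (tsum_nonneg fun n => abs_nonneg _) hC
    have j1 := summable_norm_sum_mul_antidiagonal_of_summable_norm
      (f := fun n => PowerSeries.coeff n (p ^ m)) (g := fun n => PowerSeries.coeff n p) i1 hp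
    have j2 := tsum_mul_tsum_eq_tsum_sum_antidiagonal_of_summable_norm
      (f := fun n => PowerSeries.coeff n (p ^ m)) (g := fun n => PowerSeries.coeff n p) i1 hp
    have j3 := summable_norm_sum_mul_antidiagonal_of_summable_norm
      (f := fun n => |PowerSeries.coeff n (p ^ m)|) (g := fun n => |PowerSeries.coeff n p|)
      (by simpa using i1) (by simpa using hp)
    have j4 := tsum_mul_tsum_eq_tsum_sum_antidiagonal_of_summable_norm
      (f := fun n => |PowerSeries.coeff n (p ^ m)|) (g := fun n => |PowerSeries.coeff n p|)
      (by simpa using i1) (by simpa using hp)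
    refine ⟨j1, ?_, ?_⟩
    · refine (Summable.tsum_le_tsum (fun n => ?_) j1 j3.of_norm).trans (j4.symm.trans_le ?_)
      · refine (Finset.abs_sum_le_sum_abs _ _).trans_eq ?_
        simp only [abs_mul]
      · exact mul_le_mul i2 hC (tsum_nonneg fun n => abs_nonneg _) (by positivity)
    · rw [i3.tsum_eq, hs.tsum_eq] at j2
      rw [j2]
      exact j1.of_norm.hasSum

/-- The kernel of order `mc` is the `m`-th power of a series with absolute sum at most `2` and sum
`0`. The value `0 ^ 0 = 1` is the case that later carries the whole probability mass. -/
theorem hasSum_discPrabhakar {α lam c : ℝ} (hα : α ∈ Ioc (0 : ℝ) 1) (hlam : 0 < lam)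
    (hc : c ∈ Ioc (0 : ℝ) 1) (m : ℕ) :
    (Summable fun n => |discPrabhakar α (m * c) lam n|) ∧
      ∑' n, |discPrabhakar α (m * c) lam n| ≤ 2 ^ m ∧
      HasSum (fun n => discPrabhakar α (m * c) lam n) (0 ^ m) := by
  have h := hasSum_coeff_mlPS hα hlam hc
  have := summable_abs_coeff_pow h.summable.abs (tsum_abs_coeff_mlPS hα hlam hc) h m
  simpa only [discPrabhakar_eq, mlPS_nat_mul α c hlam m] using this

theorem abs_discPrabhakar_le {α lam c : ℝ} (hα : α ∈ Ioc (0 : ℝ) 1) (hlam : 0 < lam)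
    (hc : c ∈ Ioc (0 : ℝ) 1) (m n : ℕ) : |discPrabhakar α (m * c) lam n| ≤ 2 ^ m := by
  obtain ⟨h1, h2, -⟩ := hasSum_discPrabhakar hα hlam hc m
  exact (h1.le_tsum n fun _ _ => abs_nonneg _).trans h2

theorem isGoodLaplacian_gMLpow {α lam c : ℝ} (hα : α ∈ Ioc (0 : ℝ) 1) (hlam : 0 < lam)
    (hc : c ∈ Ioc (0 : ℝ) 1) : IsGoodLaplacian (lapFn (gMLpow α lam c)) := by
  rw [lapFn_gMLpow]
  refine ⟨fun i => ?_, fun i => ?_, fun i j hij => ?_⟩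
  · have hinj : Function.Injective (fun n : ℕ => i + (n : ℤ)) := fun a b hab => by
      have : i + (a : ℤ) = i + b := hab
      omega
    refine (hinj.hasSum_iff fun j hj => ?_).1 ?_
    · have : ¬ i ≤ j := fun h => hj ⟨(j - i).toNat, by simp only; omega⟩
      rw [circ, if_neg this]
    · refine (hasSum_coeff_mlPS hα hlam hc).congr_fun fun n => ?_
      simp [circ]
  · rw [circ, if_pos le_rfl, sub_self, Int.toNat_zero, coeff_zero_mlPS]
    positivity
  · rw [circ]
    split_ifs with h
    · exact coeff_mlPS_nonpos hα hlam ⟨hc.1.le, hc.2⟩ (by omega)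
    · exact le_rfl

/-- `g_{ML,α}(𝓛)^c` is the quotient of `𝓛^{αc}` by `(lam + 𝓛^α)^c`. -/
theorem utMul_lapFn_gMLpow (α c : ℝ) {lam : ℝ} (hlam : 0 < lam) :
    utMul (lapFn (gMLpow α lam c)) (lapFn (fun s => (lam + s ^ α) ^ c)) =
      lapFn (fun s => s ^ (α * c)) := by
  have h1 : AnalyticAt ℝ (fun s : ℝ => (lam + s ^ α) ^ c) 1 :=
    AnalyticAt.rpow_const_of_pos _ (analyticAt_const.add (analyticAt_rpow_const _ one_pos))
      (by positivity)
  rw [lapFn_eq_circ, lapFn_eq_circ, lapFn_eq_circ, utMul_circ,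
    ← taylorPS_mul (analyticAt_gMLpow_one_sub α c hlam) (analyticAt_comp_one_sub h1)]
  congr 1
  refine taylorPS_congr ?_
  filter_upwards [eventually_one_sub_pos] with u hu
  have hp : 0 < lam + (1 - u) ^ α := by positivity
  rw [gMLpow, div_rpow (by positivity) hp.le, rpow_mul hu.le]
  field_simp

/-! ### The discrete Cauchy problem -/

/-- The coefficients of `p_n(t)` as a series in powers of `t^β`. -/
def stateCoeff (α μ lam ξ : ℝ) (n m : ℕ) : ℝ :=
  (-((lam + 1) ^ μ * ξ)) ^ m * discPrabhakar α (m * μ) lam n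

theorem neg_mul_rpow_pow (a β : ℝ) {t : ℝ} (ht : 0 ≤ t) (m : ℕ) :
    (-(a * t ^ β)) ^ m = (-a) ^ m * t ^ (β * m) := by
  rw [rpow_mul ht, rpow_natCast, ← mul_pow, neg_mul]

theorem stateTerm_eq (α μ β lam ξ : ℝ) (n : ℕ) {t : ℝ} (ht : 0 ≤ t) (m : ℕ) :
    stateTerm α μ β lam ξ n t m =
      stateCoeff α μ lam ξ n m * t ^ (β * m) / Gamma (β * m + 1) := by
  rw [stateTerm, stateCoeff, neg_mul_rpow_pow _ _ ht]
  ring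

theorem stateProb_eq (α μ β lam ξ : ℝ) (n : ℕ) {t : ℝ} (ht : 0 ≤ t) :
    stateProb α μ β lam ξ n t = mlSeries β (stateCoeff α μ lam ξ n) t :=
  tsum_congr fun m => stateTerm_eq α μ β lam ξ n ht m

theorem CaputoRegular.congr {f g : ℝ → ℝ} (hf : CaputoRegular f)
    (h : ∀ t, 0 ≤ t → g t = f t) : CaputoRegular g where
  cont := hf.cont.congr fun t ht => h t ht
  diff := hf.diff.congr fun t ht => h t (le_of_lt ht)
  int := fun T hT => by
    have h1 := hf.int T hT
    rw [intervalIntegrable_iff_integrableOn_Ioc_of_le hT.le] at h1 ⊢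
    refine h1.congr_fun (fun t ht => ?_) measurableSet_Ioc
    refine Filter.EventuallyEq.deriv_eq ?_
    filter_upwards [lt_mem_nhds ht.1] with s hs using (h s hs.le).symm

theorem HasCaputoDerivAt.congr {β d t : ℝ} {f g : ℝ → ℝ} (hf : HasCaputoDerivAt β f d t)
    (ht : 0 < t) (h : ∀ t, 0 ≤ t → g t = f t) : HasCaputoDerivAt β g d t := by
  unfold HasCaputoDerivAt at *
  split_ifs at * with h1
  · refine hf.congr_of_eventuallyEq ?_
    filter_upwards [lt_mem_nhds ht] with s hs using h s hs.le
  · have hd : EqOn (fun τ => (t - τ) ^ (-β) * deriv f τ)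
        (fun τ => (t - τ) ^ (-β) * deriv g τ) (Ioc 0 t) := fun τ hτ => by
      have : deriv f τ = deriv g τ := by
        refine Filter.EventuallyEq.deriv_eq ?_
        filter_upwards [lt_mem_nhds hτ.1] with s hs using (h s hs.le).symm
      simp only [this]
    obtain ⟨h2, rfl⟩ := hf
    refine ⟨?_, ?_⟩
    · rw [intervalIntegrable_iff_integrableOn_Ioc_of_le ht.le] at h2 ⊢
      exact h2.congr_fun hd measurableSet_Ioc
    · rw [intervalIntegral.integral_of_le ht.le, intervalIntegral.integral_of_le ht.le,
        setIntegral_congr_fun measurableSet_Ioc hd]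

section

variable {α μ β lam ξ : ℝ} (hα : α ∈ Ioc (0 : ℝ) 1) (hμ : μ ∈ Ioc (0 : ℝ) 1)
  (hβ : β ∈ Ioc (0 : ℝ) 1) (hξ : 0 < ξ) (hlam : 0 < lam)
include hα hμ hlam

theorem geomBdd_stateCoeff (n : ℕ) : GeomBdd (stateCoeff α μ lam ξ n) :=
  (geomBdd_pow _).mul ⟨1, 2, by norm_num, by norm_num, fun m => by
    simpa using abs_discPrabhakar_le hα hlam hμ m n⟩

include hβ

theorem summable_stateTerm (n : ℕ) {t : ℝ} (ht : 0 ≤ t) :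
    Summable (stateTerm α μ β lam ξ n t) :=
  (summable_mlSeries' hβ.1 (geomBdd_stateCoeff hα hμ hlam n) ht).congr fun m =>
    (stateTerm_eq α μ β lam ξ n ht m).symm

omit hα hμ hβ in
-- Since `g^{(m+1)μ} = g^{mμ} g^μ`, the shift of the coefficients is multiplication by the
-- generator. Together with the shift rule for the Caputo derivative this is the evolution equation.
theorem stateCoeff_succ (n m : ℕ) : stateCoeff α μ lam ξ n (m + 1) =
    -ξ * (lam + 1) ^ μ *
      ∑ k ∈ Finset.range (n + 1), stateCoeff α μ lam ξ k m * lapFn (gMLpow α lam μ) k n := by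
  have h : ∀ k ∈ Finset.range (n + 1), stateCoeff α μ lam ξ k m * lapFn (gMLpow α lam μ) k n =
      (-((lam + 1) ^ μ * ξ)) ^ m * (PowerSeries.coeff k (mlPS α lam (m * μ)) *
        PowerSeries.coeff (n - k) (mlPS α lam μ)) := fun k hk => by
    have hk := Finset.mem_range.1 hk
    have e : ((n : ℤ) - (k : ℤ)).toNat = n - k := by omega
    rw [stateCoeff, lapFn_gMLpow, circ, if_pos (by omega), e, discPrabhakar_eq]
    ring
  rw [Finset.sum_congr rfl h, ← Finset.mul_sum, stateCoeff, discPrabhakar_eq]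
  have e : ((m + 1 : ℕ) : ℝ) * μ = m * μ + μ := by push_cast; ring
  rw [e, mlPS_add _ _ _ hlam, PowerSeries.coeff_mul,
    Finset.Nat.sum_antidiagonal_eq_sum_range_succ_mk]
  ring

theorem isDiscreteSolution_stateProb :
    IsDiscreteSolution α μ β lam ξ (stateProb α μ β lam ξ) where
  regular := fun n => (caputoRegular_mlSeries hβ.1 (geomBdd_stateCoeff hα hμ hlam n)).congr
    fun t ht => stateProb_eq α μ β lam ξ n ht
  init := fun n => by
    rw [stateProb_eq _ _ _ _ _ _ le_rfl, mlSeries_zero hβ.1, stateCoeff, discPrabhakar_eq]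
    simp [mlPS_zero, PowerSeries.coeff_one]
  eqn := fun n t ht => by
    refine HasCaputoDerivAt.congr ?_ ht fun t ht => stateProb_eq α μ β lam ξ n ht
    have h := hasCaputoDerivAt_mlSeries hβ (geomBdd_stateCoeff (ξ := ξ) hα hμ hlam n) ht
    have e : mlSeries β (fun m => stateCoeff α μ lam ξ n (m + 1)) t =
        -ξ * (lam + 1) ^ μ * ∑ k ∈ Finset.range (n + 1),
          stateProb α μ β lam ξ k t * lapFn (gMLpow α lam μ) k n := by
      simp_rw [stateProb_eq _ _ _ _ _ _ ht.le]
      have h1 : ∀ k, HasSum (fun m : ℕ => stateCoeff α μ lam ξ k m * t ^ (β * m) /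
          Gamma (β * m + 1)) (mlSeries β (stateCoeff α μ lam ξ k) t) := fun k =>
        (summable_mlSeries' hβ.1 (geomBdd_stateCoeff hα hμ hlam k) ht.le).hasSum
      have h2 := (hasSum_sum (s := Finset.range (n + 1)) fun k _ =>
        (h1 k).mul_right (lapFn (gMLpow α lam μ) k n)).mul_left (-ξ * (lam + 1) ^ μ)
      rw [← h2.tsum_eq, mlSeries]
      refine tsum_congr fun m => ?_
      rw [stateCoeff_succ hlam, Finset.mul_sum, Finset.mul_sum, Finset.sum_mul,
        Finset.sum_div]
      refine Finset.sum_congr rfl fun k _ => ?_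
      ring
    rwa [e] at h

omit hα hμ hβ hlam in
theorem sum_range_succ_mul_lapFn (p : ℕ → ℝ) (n : ℕ) :
    ∑ k ∈ Finset.range (n + 1), p k * lapFn (gMLpow α lam μ) k n =
      ∑ k ∈ Finset.range n, p k * lapFn (gMLpow α lam μ) k n +
        p n * (1 / (lam + 1)) ^ μ := by
  rw [Finset.sum_range_succ, lapFn_gMLpow]
  congr 2
  rw [circ, if_pos le_rfl, sub_self, Int.toNat_zero, coeff_zero_mlPS]

omit hα hμ hβ in
-- The prefactor `(λ+1)^μ` normalises the diagonal of the matrix to `1`, so the `n`-th equation has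
-- decay rate exactly `ξ`.
theorem rpow_mul_one_div_rpow : (lam + 1) ^ μ * (1 / (lam + 1)) ^ μ = 1 := by
  rw [← mul_rpow (by positivity) (by positivity), mul_one_div_cancel (by positivity), one_rpow]

include hξ

/-- By strong induction on `n`: the off-diagonal entries are non-positive, so the equation reads
`D^β p_n = -ξ p_n` plus a non-negative source built from the earlier states, and `p_n` is a
supersolution. -/
theorem stateProb_nonneg (n : ℕ) {t : ℝ} (ht : 0 ≤ t) : 0 ≤ stateProb α μ β lam ξ n t := by
  have hsol := isDiscreteSolution_stateProb (ξ := ξ) hα hμ hβ hlam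
  induction n using Nat.strong_induction_on generalizing t with
  | _ n ih =>
    refine nonneg_of_caputo_add_mul_nonneg (c := ξ) hβ (hsol.regular n) ?_ hξ
      (fun t ht => hsol.eqn n t ht) (fun t ht => ?_) ht
    · rw [hsol.init]; split_ifs <;> norm_num
    · rw [sum_range_succ_mul_lapFn]
      have h1 : ∑ k ∈ Finset.range n, stateProb α μ β lam ξ k t * lapFn (gMLpow α lam μ) k n ≤
          0 := by
        refine Finset.sum_nonpos fun k hk => ?_
        have hk := Finset.mem_range.1 hk
        exact mul_nonpos_of_nonneg_of_nonpos (ih k hk ht.le)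
          ((isGoodLaplacian_gMLpow hα hlam hμ).off_diag _ _ (by omega))
      have h2 := rpow_mul_one_div_rpow (μ := μ) hlam
      have h3 : 0 ≤ ξ * (lam + 1) ^ μ := by positivity
      have h4 := mul_nonneg h3 (neg_nonneg.2 h1)
      have h5 : ξ * (lam + 1) ^ μ * (stateProb α μ β lam ξ n t * (1 / (lam + 1)) ^ μ) =
          ξ * stateProb α μ β lam ξ n t := by
        linear_combination ξ * stateProb α μ β lam ξ n t * h2
      linarith

/-- Once the earlier states agree, the difference of two solutions satisfies the homogeneous
equation `D^β f = -ξ f` with `f 0 = 0`. -/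
theorem eq_stateProb {p : ℕ → ℝ → ℝ} (hp : IsDiscreteSolution α μ β lam ξ p) (n : ℕ) {t : ℝ}
    (ht : 0 ≤ t) : p n t = stateProb α μ β lam ξ n t := by
  have hsol := isDiscreteSolution_stateProb (ξ := ξ) hα hμ hβ hlam
  induction n using Nat.strong_induction_on generalizing t with
  | _ n ih =>
    refine sub_eq_zero.1 (eq_zero_of_caputo_eq_neg_mul (c := ξ) hβ
      ((hp.regular n).sub (hsol.regular n)) (by rw [hp.init, hsol.init, sub_self]) hξ
      (fun t ht => ?_) ht)
    have h := HasCaputoDerivAt.sub (hp.regular n) (hsol.regular n) ht (hp.eqn n t ht)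
      (hsol.eqn n t ht)
    rw [sum_range_succ_mul_lapFn, sum_range_succ_mul_lapFn] at h
    have h1 : ∑ k ∈ Finset.range n, p k t * lapFn (gMLpow α lam μ) k n =
        ∑ k ∈ Finset.range n, stateProb α μ β lam ξ k t * lapFn (gMLpow α lam μ) k n :=
      Finset.sum_congr rfl fun k hk => by rw [ih k (Finset.mem_range.1 hk) ht.le]
    rw [h1] at h
    have h2 := rpow_mul_one_div_rpow (μ := μ) hlam
    convert h using 1
    linear_combination ξ * (p n t - stateProb α μ β lam ξ n t) * h2

omit hξ in
-- Summing over `n` first leaves `∑_m a_m 0^m = a_0 = 1`. The interchange is absolute: the kernels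
-- contribute at most `2^m`, which `1 / Γ(βm+1)` absorbs.
theorem hasSum_stateProb {t : ℝ} (ht : 0 ≤ t) :
    HasSum (fun n => stateProb α μ β lam ξ n t) 1 := by
  set a : ℕ → ℝ := fun m => (-((lam + 1) ^ μ * ξ * t ^ β)) ^ m / Gamma (β * m + 1) with ha
  have hD := hasSum_discPrabhakar hα hlam hμ
  have hsum : Summable fun p : ℕ × ℕ => |a p.1 * discPrabhakar α (p.1 * μ) lam p.2| := by
    rw [summable_prod_of_nonneg fun p => abs_nonneg _]
    refine ⟨fun m => ?_, ?_⟩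
    · simp only [abs_mul]
      exact (hD m).1.mul_left _
    · simp only [abs_mul, tsum_mul_left]
      refine Summable.of_nonneg_of_le (fun m => ?_) (fun m => ?_)
        ((summable_pow_div_Gamma (b := 1) hβ.1 ((lam + 1) ^ μ * ξ * t ^ β * 2)).abs)
      · exact mul_nonneg (abs_nonneg _) (tsum_nonneg fun n => abs_nonneg _)
      · simp only [ha]
        rw [abs_div, abs_div, abs_pow, abs_neg, abs_pow, abs_mul _ (2 : ℝ), mul_pow, abs_two,
          mul_comm (_ ^ m) ((2 : ℝ) ^ m), mul_div_assoc, mul_comm]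
        gcongr
        exact (hD m).2.1
  have h1 : HasSum (fun m => a m * 0 ^ m)
      (∑' p : ℕ × ℕ, a p.1 * discPrabhakar α (p.1 * μ) lam p.2) :=
    hsum.of_abs.hasSum.prod_fiberwise fun m => (hD m).2.2.mul_left (a m)
  have h2 : HasSum (fun m => a m * 0 ^ m) 1 := by
    have := hasSum_single (f := fun m => a m * 0 ^ m) 0 fun m hm => by
      rw [zero_pow hm, mul_zero]
    simpa [ha] using this
  have h3 := hsum.of_abs.hasSum
  rw [h1.unique h2] at h3
  have h4 := (Equiv.prodComm ℕ ℕ).hasSum_iff.2 h3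
  exact h4.prod_fiberwise fun n => (summable_stateTerm hα hμ hβ hlam n ht).hasSum

end

/-! ### Pochhammer symbols and binomial series -/

theorem poch_zero (c : ℝ) : poch c 0 = 1 := by simp [poch]

theorem poch_succ (c : ℝ) (n : ℕ) : poch c (n + 1) = poch c n * (c + n) :=
  ascPochhammer_succ_eval n c

theorem poch_nonneg {c : ℝ} (hc : 0 ≤ c) (n : ℕ) : 0 ≤ poch c n := by
  induction n with
  | zero => simp [poch_zero]
  | succ n ih => rw [poch_succ]; positivity

theorem poch_zero_succ (n : ℕ) : poch 0 (n + 1) = 0 := by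
  induction n with
  | zero => simp [poch_succ, poch_zero]
  | succ n ih => rw [poch_succ, ih, zero_mul]

theorem poch_neg (a : ℝ) (n : ℕ) : poch (-a) n = (-1) ^ n * fall a n :=
  ascPochhammer_eval_neg_eq_descPochhammer ℝ a n

theorem abs_poch_neg_le {a : ℝ} (ha : 0 ≤ a) (n : ℕ) : |poch (-a) n| ≤ poch a n := by
  induction n with
  | zero => simp [poch_zero]
  | succ n ih =>
    rw [poch_succ, poch_succ, abs_mul]
    have : |-a + n| ≤ a + n := by
      rw [abs_le]
      have : (0 : ℝ) ≤ n := Nat.cast_nonneg n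
      constructor <;> linarith
    have := poch_nonneg ha n
    gcongr

theorem multichoose_eq_poch (a : ℝ) (n : ℕ) :
    Ring.choose (a + n - 1) n = poch a n / (n.factorial : ℝ) := by
  have h := Ring.factorial_nsmul_multichoose_eq_ascPochhammer a n
  rw [Polynomial.ascPochhammer_smeval_eq_eval, nsmul_eq_mul] at h
  have h2 : Ring.choose (a + n - 1) n = Ring.multichoose a n := by
    rw [Ring.choose]; congr 1; ring
  rw [h2, poch, ← h]
  have := Nat.factorial_ne_zero n
  field_simp

theorem hasSum_poch (a : ℝ) {u : ℝ} (hu : |u| < 1) :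
    HasSum (fun n : ℕ => poch a n / (n.factorial : ℝ) * u ^ n) ((1 - u) ^ (-a)) := by
  have h := (Real.one_div_one_sub_rpow_hasFPowerSeriesOnBall_zero a).hasSum (y := u)
    (by simpa [enorm_eq_nnnorm] using! hu)
  have hu' : 0 < 1 - u := by linarith [(abs_lt.1 hu).2]
  rw [rpow_neg hu'.le, inv_eq_one_div]
  simpa [multichoose_eq_poch, mul_comm] using h

/-- Termwise expansion of a series of power series. -/
theorem hasSum_coeff_of_hasSum_powerSeries {f : ℝ → ℝ} {w : ℕ → ℝ} {b : ℕ → ℕ → ℝ}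
    {G : ℕ → ℝ → ℝ} {r : ℝ} (hr : 0 < r)
    (habs : Summable fun p : ℕ × ℕ => |w p.1 * b p.1 p.2| * r ^ p.2)
    (hG : ∀ u, |u| < r → ∀ s, HasSum (fun n => b s n * u ^ n) (G s u))
    (hf : ∀ u, |u| < r → HasSum (fun s => w s * G s u) (f u)) (n : ℕ) :
    HasSum (fun s => w s * b s n) (PowerSeries.coeff n (taylorPS f)) := by
  have hcol : ∀ n, Summable fun s => w s * b s n := by
    intro n
    have h1 : Summable fun s => |w s * b s n| * r ^ n :=
      habs.comp_injective (i := fun s : ℕ => (s, n)) fun a b h => (Prod.ext_iff.1 h).1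
    exact ((summable_mul_right_iff (pow_pos hr n).ne').1 h1).of_abs
  have key : ∀ u, |u| < r → HasSum (fun n => (∑' s, w s * b s n) * u ^ n) (f u) := by
    intro u hu
    have h1 : Summable fun p : ℕ × ℕ => w p.1 * b p.1 p.2 * u ^ p.2 := by
      refine Summable.of_norm_bounded habs fun p => ?_
      rw [norm_mul, norm_pow, Real.norm_eq_abs, Real.norm_eq_abs]
      gcongr
    have h2 : HasSum (fun s => w s * G s u) (∑' p : ℕ × ℕ, w p.1 * b p.1 p.2 * u ^ p.2) :=
      h1.hasSum.prod_fiberwise fun s => by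
        simpa only [mul_assoc] using (hG u hu s).mul_left (w s)
    have h3 := h1.hasSum
    rw [h2.unique (hf u hu)] at h3
    exact ((Equiv.prodComm ℕ ℕ).hasSum_iff.2 h3).prod_fiberwise fun n =>
      (hcol n).hasSum.mul_right (u ^ n)
  have h := (taylorPS_of_hasSum (f := f) (a := fun n => ∑' s, w s * b s n) ?_).2 n
  · rw [h]
    exact (hcol n).hasSum
  · filter_upwards [Ioo_mem_nhds (neg_lt_zero.2 hr) hr] with u hu
    exact key u (abs_lt.2 hu)

/-- At `r = 0` the product equals `q < 1`. By continuity a whole disc remains on which the outer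
binomial series still converges. -/
theorem exists_radius {α q : ℝ} (hq : q < 1) :
    ∃ r : ℝ, 0 < r ∧ r < 1 ∧ q * (1 - r) ^ (-α) < 1 := by
  have hc : ContinuousAt (fun r : ℝ => q * (1 - r) ^ (-α)) 0 :=
    continuousAt_const.mul (ContinuousAt.rpow_const (by fun_prop) (Or.inl (by norm_num)))
  have h1 : ∀ᶠ r in 𝓝 (0 : ℝ), q * (1 - r) ^ (-α) < 1 :=
    hc.eventually_lt continuousAt_const (by simpa using hq)
  have h2 : ∀ᶠ r in 𝓝[>] (0 : ℝ), r ∈ Ioo (0 : ℝ) 1 := Ioo_mem_nhdsGT one_pos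
  obtain ⟨r, hr1, hr2⟩ := ((h1.filter_mono nhdsWithin_le_nhds).and h2).exists
  exact ⟨r, hr2.1, hr2.2, hr1⟩

/-- Summability of `∑_s |w_s| (1-r)^{-a_s}` gives the double summability needed for the
expansion of `∑_s w_s (1-u)^{-a_s}` in powers of `u`. -/
theorem summable_prod_poch {w a : ℕ → ℝ} {b : ℕ → ℕ → ℝ} {r : ℝ} (hr : 0 < r) (hr1 : r < 1)
    (ha : ∀ s, 0 ≤ a s) (hb : ∀ s n, |b s n| ≤ poch (a s) n / (n.factorial : ℝ))
    (hw : Summable fun s => |w s| * (1 - r) ^ (-a s)) :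
    Summable fun p : ℕ × ℕ => |w p.1 * b p.1 p.2| * r ^ p.2 := by
  have hP : ∀ s, HasSum (fun n : ℕ => |w s| * (poch (a s) n / (n.factorial : ℝ) * r ^ n))
      (|w s| * (1 - r) ^ (-a s)) := fun s =>
    (hasSum_poch (a s) (by rwa [abs_of_pos hr])).mul_left _
  have hmain : Summable fun p : ℕ × ℕ =>
      |w p.1| * (poch (a p.1) p.2 / (p.2.factorial : ℝ) * r ^ p.2) := by
    rw [summable_prod_of_nonneg]
    · exact ⟨fun s => (hP s).summable, hw.congr fun s => (hP s).tsum_eq.symm⟩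
    · intro p
      have := poch_nonneg (ha p.1) p.2
      simp only [Pi.zero_apply]
      positivity
  refine Summable.of_nonneg_of_le (fun p => by positivity) (fun p => ?_) hmain
  rw [abs_mul, mul_assoc]
  gcongr
  exact hb _ _

/-! ### The two explicit series of the discrete Prabhakar kernels -/

section

variable {α lam c : ℝ} (hα : α ∈ Ioc (0 : ℝ) 1) (hlam : 0 < lam) (hc : 0 ≤ c)
include hα hlam hc

/-- Near `u = 0` the function is `(1 + λ(1-u)^{-α})^{-c}` with `λ(1-u)^{-α} < 1`. It is expanded
binomially, and each `(1-u)^{-αs}` is expanded once more. -/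
theorem hasSum_discPrabhakar_of_lt_one (h1 : lam < 1) (n : ℕ) :
    HasSum (fun s : ℕ => 1 / (n.factorial : ℝ) *
      ((-lam) ^ s * poch c s / (s.factorial : ℝ) * poch (α * s) n)) (discPrabhakar α c lam n) := by
  obtain ⟨r, hr0, hr1, hr⟩ := exists_radius (α := α) h1
  have hq0 : 0 ≤ lam * (1 - r) ^ (-α) := by have := sub_pos.2 hr1; positivity
  have ha0 : ∀ s : ℕ, 0 ≤ α * (s : ℝ) := fun s => by have := hα.1; positivity
  have hpow : ∀ y : ℝ, 0 < y → ∀ s : ℕ, y ^ (-(α * (s : ℝ))) = (y ^ (-α)) ^ s := fun y hy s => by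
    rw [← rpow_natCast, ← rpow_mul hy.le]; ring_nf
  have hw : Summable fun s : ℕ => |(-lam) ^ s * poch c s / (s.factorial : ℝ)| *
      (1 - r) ^ (-(α * (s : ℝ))) := by
    have h2 := (hasSum_poch c (u := lam * (1 - r) ^ (-α)) (by rwa [abs_of_nonneg hq0])).summable
    refine h2.congr fun s => ?_
    rw [hpow _ (sub_pos.2 hr1), abs_div, abs_mul, abs_pow, abs_neg, abs_of_pos hlam,
      abs_of_nonneg (poch_nonneg hc s), Nat.abs_cast, mul_pow]
    ring
  have habs := summable_prod_poch (a := fun s : ℕ => α * (s : ℝ))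
    (b := fun s n => poch (α * (s : ℝ)) n / (n.factorial : ℝ)) hr0 hr1 ha0
    (fun s n => by
      rw [abs_div, Nat.abs_cast, abs_of_nonneg (poch_nonneg (ha0 s) n)]) hw
  have hG : ∀ u : ℝ, |u| < r → ∀ s : ℕ, HasSum
      (fun n : ℕ => poch (α * (s : ℝ)) n / (n.factorial : ℝ) * u ^ n)
      ((1 - u) ^ (-(α * (s : ℝ)))) := fun u hu s => hasSum_poch _ (hu.trans hr1)
  have hf : ∀ u : ℝ, |u| < r → HasSum (fun s : ℕ => (-lam) ^ s * poch c s / (s.factorial : ℝ) *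
      (1 - u) ^ (-(α * (s : ℝ)))) (gMLpow α lam c (1 - u)) := by
    intro u hu
    have hu' := abs_lt.1 hu
    have hu1 : 0 < 1 - u := by linarith
    have hle : lam * (1 - u) ^ (-α) < 1 := by
      refine lt_of_le_of_lt ?_ hr
      have : (1 - u) ^ (-α) ≤ (1 - r) ^ (-α) :=
        rpow_le_rpow_of_nonpos (by linarith) (by linarith) (by linarith [hα.1])
      gcongr
    have h0 : 0 ≤ lam * (1 - u) ^ (-α) := by positivity
    have h2 := hasSum_poch c (u := -(lam * (1 - u) ^ (-α))) (by rwa [abs_neg, abs_of_nonneg h0])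
    rw [sub_neg_eq_add, ← gMLpow_eq_one_add_rpow hlam hu1] at h2
    refine h2.congr_fun fun s => ?_
    rw [hpow _ hu1, ← neg_mul, mul_pow]
    ring
  have key := hasSum_coeff_of_hasSum_powerSeries (f := fun u => gMLpow α lam c (1 - u))
    (w := fun s : ℕ => (-lam) ^ s * poch c s / (s.factorial : ℝ))
    (b := fun s n : ℕ => poch (α * (s : ℝ)) n / (n.factorial : ℝ))
    (G := fun s u => (1 - u) ^ (-(α * (s : ℝ)))) hr0 habs hG hf n
  rw [discPrabhakar_eq, mlPS]
  refine key.congr_fun fun s => ?_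
  ring

/-- Here the other summand is small: the function is `λ^{-c} (1-u)^{αc} (1 + λ^{-1}(1-u)^α)^{-c}`.
The inner powers now have exponents `α(s+c)`, whose coefficients change sign. They are majorised by
`(α(s+c))_n / n!`, which allows the same summability criterion. -/
theorem hasSum_discPrabhakar_of_one_lt (h1 : 1 < lam) (n : ℕ) :
    HasSum (fun s : ℕ => (-1) ^ n * lam ^ (-c) / (n.factorial : ℝ) *
      ((-1) ^ s * (lam ^ s)⁻¹ * poch c s / (s.factorial : ℝ) * fall (α * (s + c)) n))
      (discPrabhakar α c lam n) := by
  obtain ⟨r, hr0, hr1, hr⟩ := exists_radius (α := α) (inv_lt_one_of_one_lt₀ h1)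
  have hr' := sub_pos.2 hr1
  have hq0 : 0 ≤ lam⁻¹ * (1 - r) ^ (-α) := by positivity
  have ha0 : ∀ s : ℕ, 0 ≤ α * (s + c) := fun s => by have := hα.1; positivity
  have hpow : ∀ y : ℝ, 0 < y → ∀ s : ℕ, y ^ (α * (s + c)) = (y ^ α) ^ s * y ^ (α * c) :=
    fun y hy s => by
      rw [← rpow_natCast, ← rpow_mul hy.le, ← rpow_add hy]; ring_nf
  have hw : Summable fun s : ℕ => |lam ^ (-c) * ((-1) ^ s * (lam ^ s)⁻¹ * poch c s /
      (s.factorial : ℝ))| * (1 - r) ^ (-(α * (s + c))) := by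
    have h2 := (hasSum_poch c (u := lam⁻¹ * (1 - r) ^ (-α))
      (by rwa [abs_of_nonneg hq0])).summable.mul_left (lam ^ (-c) * ((1 - r) ^ (α * c))⁻¹)
    refine h2.congr fun s => ?_
    rw [rpow_neg hr'.le, rpow_neg hr'.le, hpow _ hr', abs_mul, abs_div, abs_mul, abs_mul, abs_pow, abs_neg, abs_one,
      one_pow, abs_of_nonneg (poch_nonneg hc s), Nat.abs_cast, mul_pow,
      abs_of_pos (by positivity : 0 < lam ^ (-c)), abs_of_pos (by positivity : 0 < (lam ^ s)⁻¹),
      inv_pow, inv_pow, mul_inv]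
    ring
  have habs := summable_prod_poch (a := fun s : ℕ => α * (s + c))
    (b := fun s n => poch (-(α * (s + c))) n / (n.factorial : ℝ)) hr0 hr1 ha0
    (fun s n => by
      rw [abs_div, Nat.abs_cast]
      gcongr
      exact abs_poch_neg_le (ha0 s) n) hw
  have hG : ∀ u : ℝ, |u| < r → ∀ s : ℕ, HasSum
      (fun n : ℕ => poch (-(α * (s + c))) n / (n.factorial : ℝ) * u ^ n)
      ((1 - u) ^ (-(-(α * (s + c))))) := fun u hu s => hasSum_poch _ (hu.trans hr1)
  have hf : ∀ u : ℝ, |u| < r → HasSum (fun s : ℕ => lam ^ (-c) * ((-1) ^ s * (lam ^ s)⁻¹ *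
      poch c s / (s.factorial : ℝ)) * (1 - u) ^ (-(-(α * (s + c))))) (gMLpow α lam c (1 - u)) := by
    intro u hu
    have hu' := abs_lt.1 hu
    have hu1 : 0 < 1 - u := by linarith
    -- For `|u| < r` one has `1 - u ≤ 1 + r ≤ 1/(1-r)`, so the radius found for the negative power
    -- also controls the positive one.
    have hle : (1 - u) ^ α ≤ (1 - r) ^ (-α) := by
      rw [rpow_neg hr'.le, ← inv_rpow hr'.le]
      refine rpow_le_rpow hu1.le ?_ hα.1.le
      rw [← one_div, le_div_iff₀ hr']
      nlinarith
    have h0 : 0 ≤ lam⁻¹ * (1 - u) ^ α := by positivity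
    have h3 : |-(lam⁻¹ * (1 - u) ^ α)| < 1 := by
      rw [abs_neg, abs_of_nonneg h0]
      refine lt_of_le_of_lt ?_ hr
      gcongr
    have h2 := (hasSum_poch c h3).mul_left (lam ^ (-c) * (1 - u) ^ (α * c))
    have e : gMLpow α lam c (1 - u) =
        lam ^ (-c) * (1 - u) ^ (α * c) * (1 - -(lam⁻¹ * (1 - u) ^ α)) ^ (-c) := by
      have hp : 0 < lam + (1 - u) ^ α := by positivity
      have e1 : 1 - -(lam⁻¹ * (1 - u) ^ α) = lam⁻¹ * (lam + (1 - u) ^ α) := by field_simp; ring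
      rw [gMLpow, e1, mul_rpow (by positivity) hp.le, div_rpow (by positivity) hp.le,
        inv_rpow hlam.le, rpow_mul hu1.le, rpow_neg hp.le, ← rpow_neg hlam.le, neg_neg,
        div_eq_mul_inv]
      have : lam ^ (-c) * lam ^ c = 1 := by rw [← rpow_add hlam]; simp
      linear_combination -((1 - u) ^ α) ^ c * ((lam + (1 - u) ^ α) ^ c)⁻¹ * this
    rw [e]
    refine h2.congr_fun fun s => ?_
    rw [neg_neg, hpow _ hu1, neg_eq_neg_one_mul (lam⁻¹ * _), mul_pow, mul_pow, inv_pow]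
    ring
  have key := hasSum_coeff_of_hasSum_powerSeries (f := fun u => gMLpow α lam c (1 - u))
    (w := fun s : ℕ => lam ^ (-c) * ((-1) ^ s * (lam ^ s)⁻¹ * poch c s / (s.factorial : ℝ)))
    (b := fun s n : ℕ => poch (-(α * (s + c))) n / (n.factorial : ℝ))
    (G := fun s u => (1 - u) ^ (-(-(α * (s + c))))) hr0 habs hG hf n
  rw [discPrabhakar_eq, mlPS]
  refine key.congr_fun fun s => ?_
  rw [poch_neg]
  ring

end

/-! ### The matrix exponential and the subordination integral -/

theorem taylorPS_const_mul (c : ℝ) (f : ℝ → ℝ) :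
    taylorPS (fun u => c * f u) = PowerSeries.C c * taylorPS f := by
  ext n
  rw [PowerSeries.coeff_C_mul, coeff_taylorPS, coeff_taylorPS, iteratedDeriv_const_mul_field,
    mul_div_assoc]

section

variable {φ : ℝ → ℝ} (hφ : AnalyticAt ℝ φ 0)
include hφ

/-- Coefficient comparison in `F' = -τ φ' F` for `F = e^{-τφ}`. Each step up in the coefficient
index brings one factor `τ`. -/
theorem coeff_succ_taylorPS_exp (τ : ℝ) (n : ℕ) :
    ((n : ℝ) + 1) * PowerSeries.coeff (n + 1) (taylorPS fun u => exp (-τ * φ u)) =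
      -τ * ∑ p ∈ Finset.HasAntidiagonal.antidiagonal n, PowerSeries.coeff p.1 (taylorPS (deriv φ)) *
        PowerSeries.coeff p.2 (taylorPS fun u => exp (-τ * φ u)) := by
  have hexp : AnalyticAt ℝ (fun u => exp (-τ * φ u)) 0 := (analyticAt_const.mul hφ).rexp'
  have hd : deriv (fun u => exp (-τ * φ u)) =ᶠ[𝓝 0]
      fun u => (-τ * deriv φ u) * exp (-τ * φ u) := by
    filter_upwards [hφ.eventually_analyticAt] with u hu
    have := ((hu.differentiableAt.hasDerivAt.const_mul (-τ)).exp).deriv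
    rw [this, mul_comm]
  have h1 := taylorPS_deriv (fun u => exp (-τ * φ u))
  have hc : AnalyticAt ℝ (fun u => -τ * deriv φ u) 0 := analyticAt_const.mul hφ.deriv
  rw [taylorPS_congr hd, taylorPS_mul hc hexp, taylorPS_const_mul] at h1
  have h2 := congrArg (PowerSeries.coeff n) h1
  rw [PowerSeries.coeff_derivative, mul_assoc, PowerSeries.coeff_C_mul,
    PowerSeries.coeff_mul] at h2
  rw [h2]
  ring

/-- Coefficient comparison in `(φ^q)' = q φ' φ^{q-1}`. It has the same structure as the recursion
for `e^{-τφ}`, with the factor `τ` replaced by a shift of the exponent. -/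
theorem coeff_succ_taylorPS_rpow (hφ0 : 0 < φ 0) (q : ℝ) (n : ℕ) :
    ((n : ℝ) + 1) * PowerSeries.coeff (n + 1) (taylorPS fun u => φ u ^ q) =
      q * ∑ p ∈ Finset.HasAntidiagonal.antidiagonal n, PowerSeries.coeff p.1 (taylorPS (deriv φ)) *
        PowerSeries.coeff p.2 (taylorPS fun u => φ u ^ (q - 1)) := by
  have hpow : AnalyticAt ℝ (fun u => φ u ^ (q - 1)) 0 :=
    AnalyticAt.rpow_const_of_pos _ hφ hφ0
  have hd : deriv (fun u => φ u ^ q) =ᶠ[𝓝 0] fun u => (q * deriv φ u) * φ u ^ (q - 1) := by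
    filter_upwards [hφ.eventually_analyticAt, hφ.continuousAt.eventually (lt_mem_nhds hφ0)]
      with u hu hu0
    have := (hu.differentiableAt.hasDerivAt.rpow_const (p := q) (Or.inl (ne_of_gt hu0))).deriv
    rw [this]
    ring
  have h1 := taylorPS_deriv (fun u => φ u ^ q)
  have hc : AnalyticAt ℝ (fun u => q * deriv φ u) 0 := analyticAt_const.mul hφ.deriv
  rw [taylorPS_congr hd, taylorPS_mul hc hpow, taylorPS_const_mul] at h1
  have h2 := congrArg (PowerSeries.coeff n) h1
  rw [PowerSeries.coeff_derivative, mul_assoc, PowerSeries.coeff_C_mul,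
    PowerSeries.coeff_mul] at h2
  rw [h2]
  ring

/-- The coefficientwise Gamma integral `∫ τ^{q-1} e^{-τ φ} dτ = Γ(q) φ^{-q}`. -/
theorem integral_rpow_mul_taylorPS_exp (hφ0 : 0 < φ 0) (n : ℕ) : ∀ q : ℝ, 0 < q →
    IntegrableOn (fun τ : ℝ => τ ^ (q - 1) *
      PowerSeries.coeff n (taylorPS fun u => exp (-τ * φ u))) (Ioi 0) ∧
    ∫ τ in Ioi (0 : ℝ), τ ^ (q - 1) * PowerSeries.coeff n (taylorPS fun u => exp (-τ * φ u)) =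
      Gamma q * PowerSeries.coeff n (taylorPS fun u => φ u ^ (-q)) := by
  induction n using Nat.strong_induction_on with
  | _ n ih =>
    intro q hq
    match n with
    | 0 =>
      simp only [constantCoeff_taylorPS]
      have h := Real.integral_rpow_mul_exp_neg_mul_Ioi hq hφ0
      have e : ∀ τ : ℝ, -τ * φ 0 = -(φ 0 * τ) := fun τ => by ring
      simp only [e]
      have hval : (1 / φ 0) ^ q * Gamma q = Gamma q * φ 0 ^ (-q) := by
        rw [rpow_neg hφ0.le, one_div, inv_rpow hφ0.le, mul_comm]
      rw [hval] at h
      refine ⟨?_, h⟩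
      by_contra hn
      rw [integral_undef hn] at h
      have h1 := Gamma_pos_of_pos hq
      have : 0 < Gamma q * φ 0 ^ (-q) := by positivity
      linarith
    | k + 1 =>
      have hk : ((k : ℝ) + 1) ≠ 0 := by positivity
      -- The factor `τ` from the recursion turns `τ^{q-1}` into `τ^q`, which is why the induction
      -- runs over all `q`. The lower coefficients are used at `q + 1`, and `Γ(q+1) = q Γ(q)`
      -- matches the recursion for the powers.
      have hrec : ∀ τ ∈ Ioi (0 : ℝ), ∑ p ∈ Finset.HasAntidiagonal.antidiagonal k,
          (-(1 / ((k : ℝ) + 1)) * PowerSeries.coeff p.1 (taylorPS (deriv φ))) *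
            (τ ^ (q + 1 - 1) * PowerSeries.coeff p.2 (taylorPS fun u => exp (-τ * φ u))) =
          τ ^ (q - 1) * PowerSeries.coeff (k + 1) (taylorPS fun u => exp (-τ * φ u)) := by
        intro τ hτ
        have hτ' : (0 : ℝ) < τ := hτ
        have h1 := coeff_succ_taylorPS_exp hφ τ k
        have h2 : PowerSeries.coeff (k + 1) (taylorPS fun u => exp (-τ * φ u)) =
          (1 / ((k : ℝ) + 1)) * (-τ * ∑ p ∈ Finset.HasAntidiagonal.antidiagonal k,
            PowerSeries.coeff p.1 (taylorPS (deriv φ)) *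
            PowerSeries.coeff p.2 (taylorPS fun u => exp (-τ * φ u))) := by
          rw [← h1]; field_simp
        have h3 : τ ^ (q + 1 - 1) = τ ^ (q - 1) * τ := by
          rw [← rpow_add_one hτ'.ne']; ring_nf
        rw [h2, Finset.mul_sum, Finset.mul_sum, Finset.mul_sum]
        refine Finset.sum_congr rfl fun p _ => ?_
        rw [h3]
        ring
      have hp : ∀ p ∈ Finset.HasAntidiagonal.antidiagonal k, p.2 < k + 1 := fun p hp => by
        have := Finset.HasAntidiagonal.mem_antidiagonal.1 hp
        omega
      have hI : ∀ p ∈ Finset.HasAntidiagonal.antidiagonal k, Integrable (fun τ : ℝ =>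
          (-(1 / ((k : ℝ) + 1)) * PowerSeries.coeff p.1 (taylorPS (deriv φ))) *
            (τ ^ (q + 1 - 1) * PowerSeries.coeff p.2 (taylorPS fun u => exp (-τ * φ u))))
          (volume.restrict (Ioi 0)) := fun p hpk =>
        ((ih p.2 (hp p hpk) (q + 1) (by linarith)).1).const_mul _
      refine ⟨?_, ?_⟩
      · have h1 := integrable_finsetSum _ hI
        exact IntegrableOn.congr_fun h1 hrec measurableSet_Ioi
      · rw [← setIntegral_congr_fun measurableSet_Ioi hrec, integral_finsetSum _ hI]
        have h1 := coeff_succ_taylorPS_rpow hφ hφ0 (-q) k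
        have h2 : PowerSeries.coeff (k + 1) (taylorPS fun u => φ u ^ (-q)) =
            (1 / ((k : ℝ) + 1)) * (-q * ∑ p ∈ Finset.HasAntidiagonal.antidiagonal k,
              PowerSeries.coeff p.1 (taylorPS (deriv φ)) *
              PowerSeries.coeff p.2 (taylorPS fun u => φ u ^ (-q - 1))) := by
          rw [← h1]; field_simp
        rw [h2, Finset.mul_sum, Finset.mul_sum, Finset.mul_sum]
        refine Finset.sum_congr rfl fun p hpk => ?_
        rw [integral_const_mul, (ih p.2 (hp p hpk) (q + 1) (by linarith)).2,
          Gamma_add_one hq.ne', neg_add']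
        ring

end

/-- Integration by parts. The boundary function `-(1 - e^{-cτ}) τ^{-μ} / μ` vanishes at `0`, where
`1 - e^{-cτ} ≤ cτ`, and at infinity, where the bracket is at most `1`. What remains is a Gamma
integral with parameter `1 - μ`. -/
theorem integral_one_sub_exp_mul_rpow {μ c : ℝ} (hμ : μ ∈ Ioo (0 : ℝ) 1) (hc : 0 < c) :
    IntegrableOn (fun τ : ℝ => (1 - exp (-τ * c)) * τ ^ (-μ - 1)) (Ioi 0) ∧
    ∫ τ in Ioi (0 : ℝ), (1 - exp (-τ * c)) * τ ^ (-μ - 1) = Gamma (1 - μ) / μ * c ^ μ := by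
  have hμ0 := hμ.1
  have hμ1 : 0 < 1 - μ := sub_pos.2 hμ.2
  have hmeas : ∀ S : Set ℝ, AEStronglyMeasurable (fun τ : ℝ => (1 - exp (-τ * c)) * τ ^ (-μ - 1))
      (volume.restrict S) := fun S => by
    refine Measurable.aestronglyMeasurable ?_
    fun_prop
  have hlow : ∀ τ : ℝ, 0 ≤ τ → 0 ≤ 1 - exp (-τ * c) := fun τ hτ => by
    rw [sub_nonneg, exp_le_one_iff]
    nlinarith
  have hup : ∀ τ : ℝ, 1 - exp (-τ * c) ≤ c * τ := fun τ => by
    have := add_one_le_exp (-τ * c)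
    linarith
  have hint : IntegrableOn (fun τ : ℝ => (1 - exp (-τ * c)) * τ ^ (-μ - 1)) (Ioi 0) := by
    rw [← Ioc_union_Ioi_eq_Ioi (zero_le_one' ℝ)]
    refine IntegrableOn.union ?_ ?_
    · have h1 := ((integrableOn_rpow_sub_one hμ1 one_pos).1).const_mul c
      refine Integrable.mono' h1 (hmeas _) ?_
      filter_upwards [ae_restrict_mem measurableSet_Ioc] with τ hτ
      have hτ0 := hτ.1
      rw [norm_mul, Real.norm_of_nonneg (hlow τ hτ.1.le), Real.norm_of_nonneg (by positivity)]
      have e : τ ^ (1 - μ - 1) = τ * τ ^ (-μ - 1) := by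
        rw [mul_comm, ← rpow_add_one hτ0.ne']; ring_nf
      rw [e, ← mul_assoc]
      gcongr
      exact hup τ
    · have h1 := integrableOn_Ioi_rpow_of_lt (a := -μ - 1) (by linarith) one_pos
      refine Integrable.mono' h1 (hmeas _) ?_
      filter_upwards [ae_restrict_mem measurableSet_Ioi] with τ hτ
      have hτ0 : (0 : ℝ) < τ := lt_trans one_pos hτ
      rw [norm_mul, Real.norm_of_nonneg (hlow τ hτ0.le), Real.norm_of_nonneg (by positivity)]
      refine mul_le_of_le_one_left (by positivity) ?_
      have := exp_pos (-τ * c)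
      linarith
  refine ⟨hint, ?_⟩
  have hGam := Real.integral_rpow_mul_exp_neg_mul_Ioi hμ1 hc
  have hGamI : IntegrableOn (fun t : ℝ => t ^ (1 - μ - 1) * exp (-(c * t))) (Ioi 0) := by
    by_contra hn
    rw [integral_undef hn] at hGam
    have h1 := Gamma_pos_of_pos hμ1
    have : 0 < (1 / c) ^ (1 - μ) * Gamma (1 - μ) := by positivity
    linarith
  set F : ℝ → ℝ := fun τ => -(1 / μ) * ((1 - exp (-τ * c)) * τ ^ (-μ)) with hF
  have hd : ∀ τ ∈ Ioi (0 : ℝ), HasDerivAt F ((1 - exp (-τ * c)) * τ ^ (-μ - 1) -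
      c / μ * (τ ^ (1 - μ - 1) * exp (-(c * τ)))) τ := by
    intro τ hτ
    have hτ0 : (0 : ℝ) < τ := hτ
    have h1 : HasDerivAt (fun τ : ℝ => 1 - exp (-τ * c)) (c * exp (-τ * c)) τ := by
      have := ((((hasDerivAt_id τ).neg).mul_const c).exp).const_sub 1
      refine this.congr_deriv ?_
      simp
      ring
    have h2 := (h1.mul (Real.hasDerivAt_rpow_const (p := -μ) (Or.inl hτ0.ne'))).const_mul
      (-(1 / μ))
    refine h2.congr_deriv ?_
    have e1 : (1 : ℝ) - μ - 1 = -μ := by ring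
    have e2 : -(c * τ) = -τ * c := by ring
    rw [e1, e2]
    field_simp
    ring
  have hFb : ∀ τ : ℝ, 0 < τ → |F τ| ≤ c / μ * τ ^ (1 - μ) := fun τ hτ => by
    have e : τ ^ (1 - μ) = τ * τ ^ (-μ) := by
      rw [mul_comm, ← rpow_add_one hτ.ne']; ring_nf
    rw [hF]
    simp only
    rw [abs_mul, abs_neg, abs_of_pos (by positivity : 0 < 1 / μ),
      abs_of_nonneg (mul_nonneg (hlow τ hτ.le) (by positivity)), e]
    have := hup τ
    calc 1 / μ * ((1 - exp (-τ * c)) * τ ^ (-μ)) ≤ 1 / μ * ((c * τ) * τ ^ (-μ)) := by gcongr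
      _ = _ := by ring
  have hcont : ContinuousWithinAt F (Ici 0) 0 := by
    have hF0 : F 0 = 0 := by simp [hF]
    rw [ContinuousWithinAt, hF0]
    refine squeeze_zero_norm' (a := fun τ => c / μ * τ ^ (1 - μ)) ?_ ?_
    · filter_upwards [self_mem_nhdsWithin] with τ hτ
      rcases (show (0 : ℝ) ≤ τ from hτ).eq_or_lt with h | h
      · rw [← h, hF0]; simp [zero_rpow hμ1.ne']
      · exact hFb τ h
    · have : Continuous fun τ : ℝ => c / μ * τ ^ (1 - μ) :=
        continuous_const.mul (Real.continuous_rpow_const hμ1.le)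
      have h := this.tendsto 0
      simp only [zero_rpow hμ1.ne', mul_zero] at h
      exact h.mono_left nhdsWithin_le_nhds
  have htop : Tendsto F atTop (𝓝 0) := by
    refine squeeze_zero_norm' (a := fun τ => 1 / μ * τ ^ (-μ)) ?_ ?_
    · filter_upwards [eventually_gt_atTop 0] with τ hτ
      simp only [hF]
      rw [Real.norm_eq_abs, abs_mul, abs_neg, abs_of_pos (by positivity : 0 < 1 / μ),
        abs_of_nonneg (mul_nonneg (hlow τ hτ.le) (by positivity))]
      gcongr
      refine mul_le_of_le_one_left (by positivity) ?_
      have := exp_pos (-τ * c)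
      linarith
    · simpa using (tendsto_rpow_neg_atTop hμ0).const_mul (1 / μ)
  have hFTC := integral_Ioi_of_hasDerivAt_of_tendsto hcont hd
    (hint.sub (hGamI.const_mul (c / μ))) htop
  rw [integral_sub hint (hGamI.const_mul (c / μ)), integral_const_mul, hGam] at hFTC
  have hF0 : F 0 = 0 := by simp [hF]
  rw [hF0, sub_zero, sub_eq_zero] at hFTC
  rw [hFTC, one_div, inv_rpow hc.le, ← rpow_neg hc.le, neg_sub, rpow_sub_one hc.ne']
  field_simp

/-- Coefficientwise subordination. -/
theorem integral_subordination {φ : ℝ → ℝ} (hφ : AnalyticAt ℝ φ 0) (hφ0 : 0 < φ 0) {μ : ℝ}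
    (hμ : μ ∈ Ioo (0 : ℝ) 1) (n : ℕ) :
    IntegrableOn (fun τ : ℝ => (PowerSeries.coeff n (1 : PowerSeries ℝ) -
      PowerSeries.coeff n (taylorPS fun u => exp (-τ * φ u))) * τ ^ (-μ - 1)) (Ioi 0) ∧
    PowerSeries.coeff n (taylorPS fun u => φ u ^ μ) = -(1 / Gamma (-μ)) *
      ∫ τ in Ioi (0 : ℝ), (PowerSeries.coeff n (1 : PowerSeries ℝ) -
        PowerSeries.coeff n (taylorPS fun u => exp (-τ * φ u))) * τ ^ (-μ - 1) := by
  have hμ0 := hμ.1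
  have hμ1 : 0 < 1 - μ := sub_pos.2 hμ.2
  have hG : -(1 / Gamma (-μ)) = μ / Gamma (1 - μ) := by
    have h := Gamma_add_one (s := -μ) (by linarith)
    rw [neg_add_eq_sub] at h
    have h1 : Gamma (-μ) ≠ 0 := by
      intro h0
      rw [h0, mul_zero] at h
      exact (Gamma_pos_of_pos hμ1).ne' h
    rw [h]
    field_simp
  have hG1 := (Gamma_pos_of_pos hμ1).ne'
  match n with
  | 0 =>
    have h01 : PowerSeries.coeff 0 (1 : PowerSeries ℝ) = 1 := by simp
    simp only [h01, constantCoeff_taylorPS]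
    obtain ⟨h1, h2⟩ := integral_one_sub_exp_mul_rpow hμ hφ0
    refine ⟨h1, ?_⟩
    rw [h2, hG]
    field_simp
  | k + 1 =>
    have hk : ((k : ℝ) + 1) ≠ 0 := by positivity
    have h0 : PowerSeries.coeff (k + 1) (1 : PowerSeries ℝ) = 0 := by
      rw [PowerSeries.coeff_one, if_neg (by omega)]
    -- Off the diagonal the identity contributes nothing, and the factor `τ` from the recursion
    -- softens `τ^{-μ-1}` to the integrable `τ^{-μ}`: a plain Gamma integral with `q = 1 - μ`
    -- suffices.
    simp only [h0, zero_sub]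
    have hrec : ∀ τ ∈ Ioi (0 : ℝ), ∑ p ∈ Finset.HasAntidiagonal.antidiagonal k,
        (1 / ((k : ℝ) + 1) * PowerSeries.coeff p.1 (taylorPS (deriv φ))) *
          (τ ^ (1 - μ - 1) * PowerSeries.coeff p.2 (taylorPS fun u => exp (-τ * φ u))) =
        -PowerSeries.coeff (k + 1) (taylorPS fun u => exp (-τ * φ u)) * τ ^ (-μ - 1) := by
      intro τ hτ
      have hτ' : (0 : ℝ) < τ := hτ
      have h1 := coeff_succ_taylorPS_exp hφ τ k
      have h2 : PowerSeries.coeff (k + 1) (taylorPS fun u => exp (-τ * φ u)) =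
          (1 / ((k : ℝ) + 1)) * (-τ * ∑ p ∈ Finset.HasAntidiagonal.antidiagonal k,
            PowerSeries.coeff p.1 (taylorPS (deriv φ)) *
            PowerSeries.coeff p.2 (taylorPS fun u => exp (-τ * φ u))) := by
        rw [← h1]; field_simp
      have h3 : τ ^ (1 - μ - 1) = τ ^ (-μ - 1) * τ := by
        rw [← rpow_add_one hτ'.ne']; ring_nf
      rw [h2, Finset.mul_sum, Finset.mul_sum, ← Finset.sum_neg_distrib, Finset.sum_mul]
      refine Finset.sum_congr rfl fun p _ => ?_
      rw [h3]
      ring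
    have hL := fun j => integral_rpow_mul_taylorPS_exp hφ hφ0 j (1 - μ) hμ1
    have hI : ∀ p ∈ Finset.HasAntidiagonal.antidiagonal k, Integrable (fun τ : ℝ =>
        (1 / ((k : ℝ) + 1) * PowerSeries.coeff p.1 (taylorPS (deriv φ))) *
          (τ ^ (1 - μ - 1) * PowerSeries.coeff p.2 (taylorPS fun u => exp (-τ * φ u))))
        (volume.restrict (Ioi 0)) := fun p _ => (hL p.2).1.const_mul _
    refine ⟨IntegrableOn.congr_fun (integrable_finsetSum _ hI) hrec measurableSet_Ioi, ?_⟩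
    rw [← setIntegral_congr_fun measurableSet_Ioi hrec, integral_finsetSum _ hI]
    have h1 := coeff_succ_taylorPS_rpow hφ hφ0 μ k
    have h2 : PowerSeries.coeff (k + 1) (taylorPS fun u => φ u ^ μ) =
        (1 / ((k : ℝ) + 1)) * (μ * ∑ p ∈ Finset.HasAntidiagonal.antidiagonal k,
          PowerSeries.coeff p.1 (taylorPS (deriv φ)) *
          PowerSeries.coeff p.2 (taylorPS fun u => φ u ^ (μ - 1))) := by
      rw [← h1]; field_simp
    rw [h2, hG, Finset.mul_sum, Finset.mul_sum, Finset.mul_sum]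
    refine Finset.sum_congr rfl fun p _ => ?_
    rw [integral_const_mul, (hL p.2).2, neg_sub]
    field_simp

/-- The exponential of a formal Taylor series. -/
theorem hasSum_coeff_pow_taylorPS {ψ : ℝ → ℝ} (hψ : AnalyticAt ℝ ψ 0) (n : ℕ) :
    HasSum (fun k : ℕ => PowerSeries.coeff n (taylorPS ψ ^ k) / (k.factorial : ℝ))
      (PowerSeries.coeff n (taylorPS fun u => exp (ψ u))) := by
  induction n using Nat.strong_induction_on with
  | _ n ih =>
    match n with
    | 0 =>
      have h := NormedSpace.expSeries_div_hasSum_exp (𝔸 := ℝ) (ψ 0)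
      rw [← Real.exp_eq_exp_ℝ] at h
      rw [constantCoeff_taylorPS]
      refine h.congr_fun fun k => ?_
      rw [PowerSeries.coeff_zero_eq_constantCoeff, map_pow,
        ← PowerSeries.coeff_zero_eq_constantCoeff_apply, constantCoeff_taylorPS]
    | n + 1 =>
      have hn : ((n : ℝ) + 1) ≠ 0 := by positivity
      have h1 := coeff_succ_taylorPS_exp hψ (-1) n
      simp only [neg_neg, one_mul] at h1
      have h2 := hasSum_sum (s := Finset.HasAntidiagonal.antidiagonal n) fun p hp =>
        (ih p.2 (by have := Finset.HasAntidiagonal.mem_antidiagonal.1 hp; omega)).mul_left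
          (PowerSeries.coeff p.1 (taylorPS (deriv ψ)))
      rw [← h1] at h2
      have h3 := h2.div_const ((n : ℝ) + 1)
      rw [mul_div_cancel_left₀ _ hn] at h3
      refine (hasSum_nat_add_iff' 1).1 ?_
      have h0 : PowerSeries.coeff (n + 1) (1 : PowerSeries ℝ) = 0 := by
        rw [PowerSeries.coeff_one, if_neg (by omega)]
      simp only [Finset.range_one, Finset.sum_singleton, pow_zero, h0, zero_div, sub_zero]
      refine h3.congr_fun fun k => ?_
      have h4 := PowerSeries.coeff_derivative (taylorPS ψ ^ (k + 1)) n
      -- The factor `k + 1` from differentiating the power cancels against `(k+1)!`. So the series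
      -- of the powers satisfies the same recursion as `e^ψ`.
      have h5 : PowerSeries.derivative ℝ (taylorPS ψ ^ (k + 1)) =
          PowerSeries.C ((k : ℝ) + 1) * (taylorPS (deriv ψ) * taylorPS ψ ^ k) := by
        rw [PowerSeries.derivative_pow, taylorPS_deriv]
        simp
        ring
      rw [h5, PowerSeries.coeff_C_mul, PowerSeries.coeff_mul] at h4
      rw [eq_div_iff hn, div_mul_eq_mul_div, ← h4, Nat.factorial_succ]
      push_cast
      rw [Finset.mul_sum, Finset.sum_div]
      refine Finset.sum_congr rfl fun p _ => ?_
      field_simp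

theorem utExp_circ {ψ : ℝ → ℝ} (hψ : AnalyticAt ℝ ψ 0) :
    utExp (circ (taylorPS ψ)) = circ (taylorPS fun u => exp (ψ u)) := by
  funext i j
  simp only [utExp, utPow_circ, circ]
  split_ifs
  · exact (hasSum_coeff_pow_taylorPS hψ _).tsum_eq
  · simp

/-- Each entry is a coefficient: the exponential of `-τ g(𝓛)` is the circulant of `e^{-τφ}` with
`φ(u) = g(1-u)`, and the claim is the coefficientwise subordination formula. -/
theorem lapFn_subordination {α lam μ : ℝ} (hlam : 0 < lam) (hμ : μ ∈ Ioo (0 : ℝ) 1) (i j : ℤ) :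
    IntegrableOn (fun τ : ℝ =>
      ((1 : Matrix ℤ ℤ ℝ) i j - utExp ((-τ) • lapFn (gMLpow α lam 1)) i j) * τ ^ (-μ - 1))
      (Ioi 0) ∧
    lapFn (gMLpow α lam μ) i j = -(1 / Gamma (-μ)) * ∫ τ in Ioi (0 : ℝ),
      ((1 : Matrix ℤ ℤ ℝ) i j - utExp ((-τ) • lapFn (gMLpow α lam 1)) i j) * τ ^ (-μ - 1) := by
  set φ : ℝ → ℝ := fun u => gMLpow α lam 1 (1 - u) with hφdef
  have hφ : AnalyticAt ℝ φ 0 := analyticAt_gMLpow_one_sub α 1 hlam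
  have hφ0 : 0 < φ 0 := by
    simp only [hφdef, gMLpow]
    simp
    positivity
  have hexp : ∀ τ : ℝ, utExp ((-τ) • lapFn (gMLpow α lam 1)) =
      circ (taylorPS fun u => exp (-τ * φ u)) := fun τ => by
    have hc : AnalyticAt ℝ (fun u => -τ * φ u) 0 := analyticAt_const.mul hφ
    rw [lapFn_gMLpow, smul_circ, ← utExp_circ hc, taylorPS_const_mul, PowerSeries.smul_eq_C_mul]
    rfl
  have hpow : lapFn (gMLpow α lam μ) = circ (taylorPS fun u => φ u ^ μ) := by
    rw [lapFn_gMLpow, mlPS]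
    simp [hφdef, gMLpow]
  simp only [hexp, hpow, ← circ_one]
  simp only [circ]
  by_cases h : i ≤ j
  · simp only [if_pos h]
    exact integral_subordination hφ hφ0 hμ _
  · simp [if_neg h]

/-! ### Prabhakar kernels on the half line -/

/-- The coefficients `(c)_s (-lam₀)^s / s!`. -/
def kerCoeff (c lam₀ : ℝ) (s : ℕ) : ℝ := poch c s / (s.factorial : ℝ) * (-lam₀) ^ s

theorem kernelTerm_eq (α c lam₀ x : ℝ) (s : ℕ) : kernelTerm α c lam₀ x s =
    kerCoeff c lam₀ (s + 1) * x ^ (α * (s + 1 : ℕ) - 1) / Gamma (α * (s + 1 : ℕ)) := by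
  rw [kernelTerm, kerCoeff, div_mul_eq_mul_div, div_mul_eq_mul_div, div_div]

theorem kernelReg_eq (α c lam₀ : ℝ) : kernelReg α c lam₀ = mlDeriv α (kerCoeff c lam₀) := by
  funext x
  exact tsum_congr fun s => kernelTerm_eq α c lam₀ x s

theorem prabhakarE_eq (α c lam₀ : ℝ) {x : ℝ} (hx : 0 ≤ x) :
    prabhakarE α 1 c (-lam₀ * x ^ α) = mlSeries α (kerCoeff c lam₀) x := by
  refine tsum_congr fun s => ?_
  rw [prabhakarTerm, kerCoeff, mul_pow, rpow_mul hx, rpow_natCast]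
  ring

/-- A single term of the non-negative binomial series at `u = 1/2` is at most its sum `2^c`. The
point is the dependence on `c`: it becomes `2^m` at worst for `c = mμ`. -/
theorem poch_div_factorial_le {c : ℝ} (hc : 0 ≤ c) (s : ℕ) :
    poch c s / (s.factorial : ℝ) ≤ 2 ^ c * 2 ^ s := by
  have h := hasSum_poch c (u := 1 / 2) (by rw [abs_of_pos] <;> norm_num)
  have h1 := le_hasSum h s fun n _ => by
    have := poch_nonneg hc n
    positivity
  have h2 : (1 - 1 / 2 : ℝ) ^ (-c) = 2 ^ c := by
    rw [rpow_neg (by norm_num), ← inv_rpow (by norm_num)]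
    norm_num
  rw [h2, one_div, inv_pow, ← div_eq_mul_inv, div_le_iff₀ (by positivity)] at h1
  exact h1

theorem abs_kerCoeff_le {c lam₀ : ℝ} (hc : 0 ≤ c) (hlam : 0 < lam₀) (s : ℕ) :
    |kerCoeff c lam₀ s| ≤ 2 ^ c * (2 * lam₀) ^ s := by
  have h := poch_div_factorial_le hc s
  have h0 := poch_nonneg hc s
  rw [kerCoeff, abs_mul, abs_pow, abs_neg, abs_of_pos hlam, abs_of_nonneg (by positivity),
    mul_pow, ← mul_assoc]
  gcongr

theorem geomBdd_kerCoeff {c lam₀ : ℝ} (hc : 0 ≤ c) (hlam : 0 < lam₀) :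
    GeomBdd (kerCoeff c lam₀) :=
  ⟨2 ^ c, 2 * lam₀, by positivity, by positivity, abs_kerCoeff_le hc hlam⟩

theorem kerCoeff_zero (c lam₀ : ℝ) : kerCoeff c lam₀ 0 = 1 := by simp [kerCoeff, poch_zero]

/-- Vandermonde's identity, read off from `(1-u)^{-(c+d)} = (1-u)^{-c} (1-u)^{-d}`. -/
theorem kerCoeff_add (c d lam₀ : ℝ) (k : ℕ) : kerCoeff (c + d) lam₀ k =
    ∑ p ∈ Finset.HasAntidiagonal.antidiagonal k, kerCoeff c lam₀ p.1 * kerCoeff d lam₀ p.2 := by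
  have hT : ∀ a : ℝ, AnalyticAt ℝ (fun u : ℝ => (1 - u) ^ (-a)) 0 ∧
      ∀ n, PowerSeries.coeff n (taylorPS fun u : ℝ => (1 - u) ^ (-a)) =
        poch a n / (n.factorial : ℝ) := fun a => taylorPS_of_hasSum (by
    filter_upwards [Ioo_mem_nhds (show (-1 : ℝ) < 0 by norm_num) one_pos] with u hu
    exact hasSum_poch a (abs_lt.2 hu))
  have h1 : (taylorPS fun u : ℝ => (1 - u) ^ (-(c + d))) =
      (taylorPS fun u : ℝ => (1 - u) ^ (-c)) * taylorPS fun u : ℝ => (1 - u) ^ (-d) := by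
    rw [← taylorPS_mul (hT c).1 (hT d).1]
    refine taylorPS_congr ?_
    filter_upwards [eventually_one_sub_pos] with u hu
    rw [← rpow_add hu, neg_add]
  have h2 := congrArg (PowerSeries.coeff k) h1
  rw [(hT (c + d)).2, PowerSeries.coeff_mul] at h2
  rw [kerCoeff, h2, Finset.sum_mul]
  refine Finset.sum_congr rfl fun p hp => ?_
  rw [(hT c).2, (hT d).2, kerCoeff, kerCoeff,
    ← Finset.HasAntidiagonal.mem_antidiagonal.1 hp, pow_add]
  ring

theorem abs_mlDeriv_le {β C : ℝ} {b d : ℕ → ℝ} (hβ : 0 < β) (hd : GeomBdd d)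
    (h : ∀ m, |b m| ≤ C * d m) {x : ℝ} (hx : 0 < x) : |mlDeriv β b x| ≤ C * mlDeriv β d x := by
  have hs := (summable_mlDeriv' hβ hd hx).mul_left C
  rw [mlDeriv, mlDeriv, ← tsum_mul_left, ← Real.norm_eq_abs]
  refine tsum_of_norm_bounded hs.hasSum fun m => ?_
  rw [Real.norm_eq_abs, abs_mlDeriv_term β hβ b hx.le]
  have hG : 0 < Gamma (β * (m + 1 : ℕ)) := Gamma_pos_of_pos (by positivity)
  rw [← mul_div_assoc, ← mul_assoc]
  have := h (m + 1)
  gcongr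

theorem abs_mlSeries_le {β C : ℝ} {b d : ℕ → ℝ} (hβ : 0 < β) (hd : GeomBdd d)
    (h : ∀ m, |b m| ≤ C * d m) {x : ℝ} (hx : 0 ≤ x) : |mlSeries β b x| ≤ C * mlSeries β d x := by
  have hs := (summable_mlSeries' hβ hd hx).mul_left C
  rw [mlSeries, mlSeries, ← tsum_mul_left, ← Real.norm_eq_abs]
  refine tsum_of_norm_bounded hs.hasSum fun m => ?_
  rw [Real.norm_eq_abs, abs_mlSeries_term β hβ b hx]
  have hG : 0 < Gamma (β * m + 1) := Gamma_pos_of_pos (by positivity)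
  rw [← mul_div_assoc, ← mul_assoc]
  have := h m
  gcongr

/-! ### Convolution of Mittag-Leffler type kernels -/

/-- Summation along antidiagonals; the `k`-th one has `k + 1` points. -/
theorem summable_add_of_summable_succ_mul {u : ℕ → ℝ} (hu : ∀ k, 0 ≤ u k)
    (h : Summable fun k : ℕ => ((k : ℝ) + 1) * u k) :
    Summable fun p : ℕ × ℕ => u (p.1 + p.2) := by
  rw [← (Finset.HasAntidiagonal.sigmaAntidiagonalEquivProd (A := ℕ)).summable_iff]
  refine (summable_sigma_of_nonneg fun p => hu _).2 ⟨fun k => (hasSum_fintype _).summable, h.congr fun k => ?_⟩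
  rw [tsum_fintype]
  have : ∀ p : (Finset.HasAntidiagonal.antidiagonal k : Finset (ℕ × ℕ)),
      u (p.1.1 + p.1.2) = u k := fun p => by
    rw [Finset.HasAntidiagonal.mem_antidiagonal.1 p.2]
  simp [Finset.HasAntidiagonal.sigmaAntidiagonalEquivProd, this]

theorem mlDeriv_mul_mlDeriv {α : ℝ} (hα : 0 < α) {b d : ℕ → ℝ} (hb : GeomBdd b)
    (hd : GeomBdd d) {x y : ℝ} (hx : 0 < x) (hy : 0 < y) :
    mlDeriv α b x * mlDeriv α d y = ∑' p : ℕ × ℕ,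
      (b (p.1 + 1) * x ^ (α * (p.1 + 1 : ℕ) - 1) / Gamma (α * (p.1 + 1 : ℕ))) *
      (d (p.2 + 1) * y ^ (α * (p.2 + 1 : ℕ) - 1) / Gamma (α * (p.2 + 1 : ℕ))) := by
  have s1 := (summable_mlDeriv' hα hb hx).norm
  have s2 := (summable_mlDeriv' hα hd hy).norm
  exact tsum_mul_tsum_of_summable_norm s1 s2

/-- The convolution of two Mittag-Leffler type kernels. -/
theorem hasSum_conv_mlDeriv {α : ℝ} (hα : 0 < α) {b d : ℕ → ℝ} (hb : GeomBdd b)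
    (hd : GeomBdd d) {z : ℝ} (hz : 0 < z) :
    HasSum (fun k : ℕ => (∑ p ∈ Finset.HasAntidiagonal.antidiagonal k, b (p.1 + 1) * d (p.2 + 1)) *
      z ^ (α * (k + 2 : ℕ) - 1) / Gamma (α * (k + 2 : ℕ)))
      (∫ x in Ioc 0 z, mlDeriv α b x * mlDeriv α d (z - x)) := by
  have hp : ∀ m : ℕ, 0 < α * ((m + 1 : ℕ) : ℝ) := fun m => by positivity
  set F : ℕ × ℕ → ℝ → ℝ := fun p x =>
    (b (p.1 + 1) * d (p.2 + 1) / (Gamma (α * (p.1 + 1 : ℕ)) * Gamma (α * (p.2 + 1 : ℕ)))) *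
      (x ^ (α * (p.1 + 1 : ℕ) - 1) * (z - x) ^ (α * (p.2 + 1 : ℕ) - 1)) with hF
  have hbeta := fun p : ℕ × ℕ => beta_integral_rpow (hp p.1) (hp p.2) hz
  have hFi : ∀ p, Integrable (F p) (volume.restrict (Ioc 0 z)) := fun p =>
    ((intervalIntegrable_iff_integrableOn_Ioc_of_le hz.le).1 (hbeta p).1).const_mul _
  have hadd : ∀ p : ℕ × ℕ, α * ((p.1 + 1 : ℕ) : ℝ) + α * ((p.2 + 1 : ℕ) : ℝ) =
      α * ((p.1 + p.2 + 2 : ℕ) : ℝ) := fun p => by push_cast; ring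
  have hbval : ∀ p : ℕ × ℕ, ∫ x in Ioc 0 z, x ^ (α * ((p.1 + 1 : ℕ) : ℝ) - 1) *
      (z - x) ^ (α * ((p.2 + 1 : ℕ) : ℝ) - 1) = z ^ (α * ((p.1 + p.2 + 2 : ℕ) : ℝ) - 1) *
      (Gamma (α * (p.1 + 1 : ℕ)) * Gamma (α * (p.2 + 1 : ℕ)) /
        Gamma (α * (p.1 + p.2 + 2 : ℕ))) := fun p => by
    rw [← intervalIntegral.integral_of_le hz.le, (hbeta p).2, hadd]
  have hFval : ∀ p, ∫ x in Ioc 0 z, F p x = b (p.1 + 1) * d (p.2 + 1) *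
      z ^ (α * ((p.1 + p.2 + 2 : ℕ) : ℝ) - 1) / Gamma (α * (p.1 + p.2 + 2 : ℕ)) := fun p => by
    simp only [hF]
    rw [integral_const_mul, hbval p]
    have h1 := (Gamma_pos_of_pos (hp p.1)).ne'
    have h2 := (Gamma_pos_of_pos (hp p.2)).ne'
    field_simp
  have hFnorm : ∀ p, ∫ x in Ioc 0 z, ‖F p x‖ = |b (p.1 + 1)| * |d (p.2 + 1)| *
      z ^ (α * ((p.1 + p.2 + 2 : ℕ) : ℝ) - 1) / Gamma (α * (p.1 + p.2 + 2 : ℕ)) := fun p => by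
    have h1 := Gamma_pos_of_pos (hp p.1)
    have h2 := Gamma_pos_of_pos (hp p.2)
    have h3 : ∫ x in Ioc 0 z, ‖F p x‖ = ∫ x in Ioc 0 z, |b (p.1 + 1)| * |d (p.2 + 1)| /
        (Gamma (α * (p.1 + 1 : ℕ)) * Gamma (α * (p.2 + 1 : ℕ))) *
        (x ^ (α * ((p.1 + 1 : ℕ) : ℝ) - 1) * (z - x) ^ (α * ((p.2 + 1 : ℕ) : ℝ) - 1)) := by
      refine setIntegral_congr_fun measurableSet_Ioc fun x hx => ?_
      simp only [hF]
      rw [norm_mul, norm_div, norm_mul, Real.norm_eq_abs, Real.norm_eq_abs,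
        Real.norm_of_nonneg (mul_nonneg h1.le h2.le), Real.norm_of_nonneg
        (mul_nonneg (rpow_nonneg hx.1.le _) (rpow_nonneg (sub_nonneg.2 hx.2) _))]
    rw [h3, integral_const_mul, hbval p]
    field_simp
  have hFs : Summable fun p => ∫ x in Ioc 0 z, ‖F p x‖ := by
    obtain ⟨C, K, hC, hK, hbK⟩ := hb
    obtain ⟨D, L, hD, hL, hdL⟩ := hd
    set u : ℕ → ℝ := fun k => C * D * (max K L) ^ (k + 2) *
      z ^ (α * ((k + 2 : ℕ) : ℝ) - 1) / Gamma (α * (k + 2 : ℕ)) with hu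
    have hm : 0 < max K L := lt_max_of_lt_left hK
    have hu0 : ∀ k, 0 ≤ u k := fun k => by
      have : 0 < Gamma (α * (k + 2 : ℕ)) := Gamma_pos_of_pos (by positivity)
      simp only [hu]
      positivity
    -- The weight `k + 1` is at most `2^k`, so it only enlarges the geometric factor, which the
    -- Gamma function absorbs.
    have hus : Summable fun k : ℕ => ((k : ℝ) + 1) * u k := by
      have h1 := (summable_pow_div_Gamma (b := 2 * α) hα (2 * max K L * z ^ α)).mul_left
        (C * D * (max K L) ^ 2 * z ^ (2 * α - 1))
      refine Summable.of_nonneg_of_le (fun k => mul_nonneg (by positivity) (hu0 k)) (fun k => ?_) h1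
      have e : α * ((k + 2 : ℕ) : ℝ) = α * k + 2 * α := by push_cast; ring
      have hG : 0 < Gamma (α * k + 2 * α) := Gamma_pos_of_pos (by positivity)
      have h2 : (k : ℝ) + 1 ≤ 2 ^ k := by
        have := Nat.lt_two_pow_self (n := k)
        exact_mod_cast this
      simp only [hu]
      rw [e, add_sub_assoc, rpow_add hz, rpow_mul hz.le, rpow_natCast, mul_pow, mul_pow, pow_add]
      calc ((k : ℝ) + 1) * (C * D * (max K L ^ k * max K L ^ 2) *
            ((z ^ α) ^ k * z ^ (2 * α - 1)) / Gamma (α * k + 2 * α))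
          ≤ 2 ^ k * (C * D * (max K L ^ k * max K L ^ 2) *
            ((z ^ α) ^ k * z ^ (2 * α - 1)) / Gamma (α * k + 2 * α)) := by gcongr
        _ = _ := by ring
    refine Summable.of_nonneg_of_le (fun p => integral_nonneg fun x => norm_nonneg _) (fun p => ?_)
      (summable_add_of_summable_succ_mul hu0 hus)
    have hG : 0 < Gamma (α * (p.1 + p.2 + 2 : ℕ)) := Gamma_pos_of_pos (by positivity)
    rw [hFnorm p]
    simp only [hu]
    refine div_le_div_of_nonneg_right (mul_le_mul_of_nonneg_right ?_ (by positivity)) hG.le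
    calc |b (p.1 + 1)| * |d (p.2 + 1)| ≤ (C * K ^ (p.1 + 1)) * (D * L ^ (p.2 + 1)) := by
          gcongr
          · exact hbK _
          · exact hdL _
      _ ≤ (C * (max K L) ^ (p.1 + 1)) * (D * (max K L) ^ (p.2 + 1)) := by
          gcongr
          · exact le_max_left _ _
          · exact le_max_right _ _
      _ = _ := by rw [show p.1 + p.2 + 2 = (p.1 + 1) + (p.2 + 1) by ring, pow_add]; ring
  have key := hasSum_integral_of_summable_integral_norm hFi hFs
  have hprod : ∫ x in Ioc 0 z, ∑' p, F p x =
      ∫ x in Ioc 0 z, mlDeriv α b x * mlDeriv α d (z - x) := by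
    -- The endpoint `x = z` is dropped because the product formula for the two series needs `z - x >
    -- 0`.
    rw [integral_Ioc_eq_integral_Ioo, integral_Ioc_eq_integral_Ioo]
    refine setIntegral_congr_fun measurableSet_Ioo fun x hx => ?_
    have hx' : 0 < z - x := sub_pos.2 hx.2
    rw [mlDeriv_mul_mlDeriv hα hb hd hx.1 hx']
    refine tsum_congr fun p => ?_
    simp only [hF]
    ring
  rw [hprod] at key
  have key2 := (Finset.HasAntidiagonal.sigmaAntidiagonalEquivProd (A := ℕ)).hasSum_iff.2 key
  refine (key2.sigma fun k => hasSum_fintype _).congr_fun fun k => ?_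
  rw [Finset.sum_mul, Finset.sum_div, Finset.univ_eq_attach, ← Finset.sum_attach]
  refine Finset.sum_congr rfl fun p _ => ?_
  simp only [Function.comp_apply, Finset.HasAntidiagonal.sigmaAntidiagonalEquivProd, Equiv.coe_fn_mk]
  rw [hFval, Finset.HasAntidiagonal.mem_antidiagonal.1 p.2]

/-- `e^{c+d} = e^c * e^d` for the regular parts of the Prabhakar kernels. -/
theorem kernelReg_add {α c d lam₀ : ℝ} (hα : 0 < α) (hc : 0 ≤ c) (hd : 0 ≤ d) (hlam : 0 < lam₀)
    {z : ℝ} (hz : 0 < z) : kernelReg α (c + d) lam₀ z = kernelReg α c lam₀ z +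
      kernelReg α d lam₀ z + ∫ x in Ioc 0 z, kernelReg α c lam₀ x * kernelReg α d lam₀ (z - x) := by
  simp only [kernelReg_eq]
  have hbc := geomBdd_kerCoeff hc hlam
  have hbd := geomBdd_kerCoeff hd hlam
  have h1 := hasSum_conv_mlDeriv hα hbc hbd hz
  have h2 := (summable_mlDeriv' hα hbc hz).hasSum
  have h3 := (summable_mlDeriv' hα hbd hz).hasSum
  rw [← mlDeriv] at h2 h3
  have h4 := (hasSum_nat_add_iff' 1).2 (h2.add h3)
  have h5 := h4.add h1
  have h6 : HasSum (fun m : ℕ => kerCoeff (c + d) lam₀ (m + 1) * z ^ (α * (m + 1 : ℕ) - 1) /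
      Gamma (α * (m + 1 : ℕ))) (mlDeriv α (kerCoeff c lam₀) z + mlDeriv α (kerCoeff d lam₀) z +
      ∫ x in Ioc 0 z, mlDeriv α (kerCoeff c lam₀) x * mlDeriv α (kerCoeff d lam₀) (z - x)) := by
    refine (hasSum_nat_add_iff' 1).1 ?_
    convert h5 using 1
    · funext k
      have hK : kerCoeff (c + d) lam₀ (k + 2) = kerCoeff c lam₀ (k + 2) + kerCoeff d lam₀ (k + 2) +
          ∑ p ∈ Finset.HasAntidiagonal.antidiagonal k,
            kerCoeff c lam₀ (p.1 + 1) * kerCoeff d lam₀ (p.2 + 1) := by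
        -- The two ends of the antidiagonal, where one factor is `kerCoeff _ _ 0 = 1`, come from the
        -- `δ` parts and give the two single kernels; the interior gives the convolution.
        rw [kerCoeff_add, Finset.Nat.antidiagonal_succ_succ']
        simp [kerCoeff_zero]
        ring
      rw [hK]
      have e2 : k + 1 + 1 = k + 2 := rfl
      rw [e2]
      ring
    · have hK : kerCoeff (c + d) lam₀ 1 = kerCoeff c lam₀ 1 + kerCoeff d lam₀ 1 := by
        rw [kerCoeff_add]
        simp [Finset.Nat.antidiagonal_succ, kerCoeff_zero]
        ring
      simp only [Finset.range_one, Finset.sum_singleton, zero_add, hK]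
      ring
  exact h6.tsum_eq

/-! ### Test functions on the half line -/

theorem IsTest.exists_bound {φ : ℝ → ℝ} (hφ : IsTest φ) : ∃ R C : ℝ, 0 < R ∧ 0 ≤ C ∧
    (∀ x, 0 ≤ x → |φ x| ≤ C) ∧ ∀ x, R ≤ x → φ x = 0 := by
  obtain ⟨hc, R, hR⟩ := hφ
  obtain ⟨C, hC⟩ := isCompact_Icc.exists_bound_of_continuousOn
    (hc.mono (Icc_subset_Ici_self : Icc 0 (max R 1) ⊆ Ici 0))
  have hpos : 0 < max R 1 := lt_max_of_lt_right one_pos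
  refine ⟨max R 1, max C 0, hpos, le_max_right _ _, fun x hx => ?_,
    fun x hx => hR x ((le_max_left _ _).trans hx)⟩
  rcases le_total x (max R 1) with h | h
  · exact (hC x ⟨hx, h⟩).trans (le_max_left _ _)
  · rw [hR x ((le_max_left _ _).trans h), abs_zero]
    exact le_max_right _ _

theorem IsTest.continuous_max {φ : ℝ → ℝ} (hφ : IsTest φ) : Continuous fun x => φ (max x 0) := by
  refine continuousOn_univ.1 (hφ.1.comp (f := fun x : ℝ => max x 0) (by fun_prop) fun x _ => ?_)
  exact le_max_right x 0

theorem IsTest.abs {φ : ℝ → ℝ} (hφ : IsTest φ) : IsTest fun x => |φ x| := by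
  obtain ⟨hc, R, hR⟩ := hφ
  exact ⟨hc.abs, R, fun x hx => by simp [hR x hx]⟩

/-- A test function is integrable against locally integrable kernels. -/
theorem IsTest.integrableOn_mul {φ f : ℝ → ℝ} (hφ : IsTest φ)
    (hf : ∀ R, 0 < R → IntegrableOn f (Ioc 0 R)) :
    IntegrableOn (fun x => f x * φ x) (Ioi 0) := by
  obtain ⟨R, C, hR, hC, hb, hz⟩ := hφ.exists_bound
  rw [← Ioc_union_Ioi_eq_Ioi hR.le]
  refine IntegrableOn.union ?_ ?_
  · refine Integrable.mul_bdd (c := C) (hf R hR) ?_ ?_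
    · exact (hφ.1.mono (fun x hx => le_of_lt hx.1)).aestronglyMeasurable measurableSet_Ioc
    · filter_upwards [ae_restrict_mem measurableSet_Ioc] with x hx using hb x hx.1.le
  · have h0 : IntegrableOn (fun _ : ℝ => (0 : ℝ)) (Ioi R) := integrableOn_zero
    exact h0.congr_fun (fun x hx => by simp [hz x (le_of_lt hx)]) measurableSet_Ioi

/-- Fubini's theorem for one-sided convolutions. -/
theorem integral_mul_integral_add {φ k l : ℝ → ℝ} (hφ : IsTest φ)
    (hk : ∀ R, 0 < R → IntegrableOn k (Ioc 0 R)) (hl : ∀ R, 0 < R → IntegrableOn l (Ioc 0 R)) :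
    ∫ x in Ioi (0 : ℝ), k x * ∫ y in Ioi (0 : ℝ), l y * φ (x + y) =
      ∫ z in Ioi (0 : ℝ), (∫ x in Ioc 0 z, k x * l (z - x)) * φ z := by
  obtain ⟨R, C, hR, hC, hb, hz⟩ := hφ.exists_bound
  -- Truncation at the support bound `R` of `φ` changes neither side but makes both kernels
  -- integrable on the line, so Fubini applies. Replacing `φ z` by `φ (max z 0)` extends the test
  -- function continuously and boundedly.
  set f : ℝ → ℝ := (Ioc 0 R).indicator k with hf
  set g : ℝ → ℝ := (Ioc 0 R).indicator l with hg
  have hfi : Integrable f := (integrable_indicator_iff measurableSet_Ioc).2 (hk R hR)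
  have hgi : Integrable g := (integrable_indicator_iff measurableSet_Ioc).2 (hl R hR)
  have hconv : Integrable (fun p : ℝ × ℝ => f p.2 * g (p.1 - p.2)) (volume.prod volume) :=
    Integrable.convolution_integrand (ContinuousLinearMap.mul ℝ ℝ) hfi hgi
  have hH : Integrable (fun p : ℝ × ℝ => f p.2 * g (p.1 - p.2) * φ (max p.1 0))
      (volume.prod volume) := by
    refine Integrable.mul_bdd (c := C) hconv ?_ ?_
    · exact (hφ.continuous_max.comp continuous_fst).aestronglyMeasurable
    · exact Eventually.of_forall fun p => hb _ (le_max_right _ _)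
  have hswap := integral_integral_swap (f := fun z x => f x * g (z - x) * φ (max z 0)) hH
  have hL : ∫ z, ∫ x, f x * g (z - x) * φ (max z 0) =
      ∫ z in Ioi (0 : ℝ), (∫ x in Ioc 0 z, k x * l (z - x)) * φ z := by
    rw [← integral_indicator measurableSet_Ioi]
    congr 1
    funext z
    by_cases hz0 : 0 < z
    · rw [indicator_of_mem (show z ∈ Ioi (0 : ℝ) from hz0), max_eq_left hz0.le, integral_mul_const]
      by_cases hzR : R ≤ z
      · rw [hz z hzR, mul_zero, mul_zero]
      · congr 1
        rw [integral_Ioc_eq_integral_Ioo, ← integral_indicator measurableSet_Ioo]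
        congr 1
        funext x
        by_cases hx : x ∈ Ioo 0 z
        · have h1 : x ∈ Ioc 0 R := ⟨hx.1, by linarith [hx.2]⟩
          have h2 : z - x ∈ Ioc 0 R := ⟨by linarith [hx.2], by linarith [hx.1]⟩
          rw [indicator_of_mem hx, hf, hg, indicator_of_mem h1, indicator_of_mem h2]
        · rw [indicator_of_notMem hx, hf, hg]
          by_cases hx0 : 0 < x
          · have h2 : z - x ∉ Ioc 0 R := fun h => hx ⟨hx0, by linarith [h.1]⟩
            rw [indicator_of_notMem h2, mul_zero]
          · have h1 : x ∉ Ioc 0 R := fun h => hx0 h.1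
            rw [indicator_of_notMem h1, zero_mul]
    · rw [indicator_of_notMem (show z ∉ Ioi (0 : ℝ) from hz0)]
      have : ∀ x, f x * g (z - x) * φ (max z 0) = 0 := fun x => by
        by_cases hx0 : 0 < x
        · have h2 : z - x ∉ Ioc 0 R := fun h => hz0 (by linarith [h.1])
          rw [hg, indicator_of_notMem h2, mul_zero, zero_mul]
        · have h1 : x ∉ Ioc 0 R := fun h => hx0 h.1
          rw [hf, indicator_of_notMem h1, zero_mul, zero_mul]
      simp only [this, integral_zero]
  have hRt : ∫ x, ∫ z, f x * g (z - x) * φ (max z 0) =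
      ∫ x in Ioi (0 : ℝ), k x * ∫ y in Ioi (0 : ℝ), l y * φ (x + y) := by
    rw [← integral_indicator measurableSet_Ioi]
    congr 1
    funext x
    have hshift : ∫ z, f x * g (z - x) * φ (max z 0) =
        f x * ∫ y, g y * φ (max (y + x) 0) := by
      rw [← integral_sub_right_eq_self (fun y => g y * φ (max (y + x) 0)) x, ← integral_const_mul]
      congr 1
      funext z
      rw [sub_add_cancel, mul_assoc]
    rw [hshift]
    by_cases hx0 : 0 < x
    · rw [indicator_of_mem (show x ∈ Ioi (0 : ℝ) from hx0)]
      have hinner : ∫ y, g y * φ (max (y + x) 0) = ∫ y in Ioi (0 : ℝ), l y * φ (x + y) := by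
        rw [← integral_indicator measurableSet_Ioi]
        congr 1
        funext y
        by_cases hy0 : 0 < y
        · rw [indicator_of_mem (show y ∈ Ioi (0 : ℝ) from hy0), max_eq_left (by linarith),
            add_comm y x]
          by_cases hyR : y ≤ R
          · rw [hg, indicator_of_mem (show y ∈ Ioc 0 R from ⟨hy0, hyR⟩)]
          · rw [hz (x + y) (by linarith), mul_zero, mul_zero]
        · rw [indicator_of_notMem (show y ∉ Ioi (0 : ℝ) from hy0), hg,
            indicator_of_notMem (fun h : y ∈ Ioc 0 R => hy0 h.1), zero_mul]
      rw [hinner]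
      by_cases hxR : x ≤ R
      · rw [hf, indicator_of_mem (show x ∈ Ioc 0 R from ⟨hx0, hxR⟩)]
      · have : ∫ y in Ioi (0 : ℝ), l y * φ (x + y) = 0 := by
          rw [setIntegral_congr_fun measurableSet_Ioi (g := fun _ => (0 : ℝ)) fun y hy => ?_]
          · simp
          · have hy : (0 : ℝ) < y := hy
            simp only
            rw [hz (x + y) (by linarith), mul_zero]
        rw [this, mul_zero, mul_zero]
    · rw [indicator_of_notMem (show x ∉ Ioi (0 : ℝ) from hx0), hf,
        indicator_of_notMem (fun h : x ∈ Ioc 0 R => hx0 h.1), zero_mul]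
  rw [← hRt, ← hL, hswap]

/-! ### The limit kernel -/

theorem timeCoeff_mul (β ξ : ℝ) (v : ℕ → ℝ) {t : ℝ} (ht : 0 ≤ t) (m : ℕ) :
    timeCoeff β ξ t m * v m = (-ξ) ^ m * v m * t ^ (β * m) / Gamma (β * m + 1) := by
  rw [timeCoeff, neg_mul_rpow_pow _ _ ht]
  ring

theorem summable_timeCoeff_mul {β : ℝ} (hβ : 0 < β) (ξ : ℝ) {v : ℕ → ℝ} (hv : GeomBdd v) {t : ℝ}
    (ht : 0 ≤ t) : Summable fun m => timeCoeff β ξ t m * v m :=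
  (summable_mlSeries' hβ ((geomBdd_pow (-ξ)).mul hv) ht).congr fun m =>
    (timeCoeff_mul β ξ v ht m).symm

theorem tsum_timeCoeff_mul (β ξ : ℝ) (v : ℕ → ℝ) {t : ℝ} (ht : 0 ≤ t) :
    ∑' m, timeCoeff β ξ t m * v m = mlSeries β (fun m => (-ξ) ^ m * v m) t :=
  tsum_congr fun m => timeCoeff_mul β ξ v ht m

theorem summable_timeCoeff_two_pow {β : ℝ} (hβ : 0 < β) (ξ : ℝ) {t : ℝ} (ht : 0 ≤ t) :
    Summable fun m => |timeCoeff β ξ t m| * 2 ^ m :=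
  (summable_timeCoeff_mul hβ ξ (geomBdd_pow 2) ht).abs.congr fun m => by
    rw [abs_mul, abs_of_pos (by positivity : (0 : ℝ) < 2 ^ m)]

/-- Termwise integration of `∑_m timeCoeff_m f_m` for `|f_m| ≤ 2^m N`. -/
theorem integral_tsum_timeCoeff {β : ℝ} (hβ : 0 < β) (ξ : ℝ) {t : ℝ} (ht : 0 ≤ t)
    {f : ℕ → ℝ → ℝ} {N ψ : ℝ → ℝ} (hf : ∀ m, IntegrableOn (fun x => f m x * ψ x) (Ioi 0))
    (hN : IntegrableOn (fun x => N x * |ψ x|) (Ioi 0))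
    (hfN : ∀ m x, 0 < x → |f m x| ≤ 2 ^ m * N x) :
    IntegrableOn (fun x => (∑' m, timeCoeff β ξ t m * f m x) * ψ x) (Ioi 0) ∧
    HasSum (fun m => timeCoeff β ξ t m * ∫ x in Ioi (0 : ℝ), f m x * ψ x)
      (∫ x in Ioi (0 : ℝ), (∑' m, timeCoeff β ξ t m * f m x) * ψ x) := by
  set F : ℕ → ℝ → ℝ := fun m x => timeCoeff β ξ t m * (f m x * ψ x) with hF
  have hFi : ∀ m, Integrable (F m) (volume.restrict (Ioi 0)) := fun m => (hf m).const_mul _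
  have hFs : Summable fun m => ∫ x in Ioi (0 : ℝ), ‖F m x‖ := by
    refine Summable.of_nonneg_of_le (fun m => integral_nonneg fun x => norm_nonneg _) (fun m => ?_)
      ((summable_timeCoeff_two_pow hβ ξ ht).mul_right (∫ x in Ioi (0 : ℝ), N x * |ψ x|))
    rw [← integral_const_mul]
    refine setIntegral_mono_on (hFi m).norm (hN.const_mul _) measurableSet_Ioi fun x hx => ?_
    simp only [hF]
    rw [norm_mul, norm_mul, Real.norm_eq_abs, Real.norm_eq_abs, Real.norm_eq_abs, mul_assoc,
      ← mul_assoc (2 ^ m)]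
    have := hfN m x hx
    gcongr
  have heq : (fun x => ∑' m, F m x) = fun x => (∑' m, timeCoeff β ξ t m * f m x) * ψ x := by
    funext x
    rw [← tsum_mul_right]
    exact tsum_congr fun m => by simp only [hF]; ring
  have h1 := integrable_tsum_of_summable_integral_norm hFi hFs
  have h2 := hasSum_integral_of_summable_integral_norm hFi hFs
  rw [heq] at h1 h2
  simp only [hF, integral_const_mul] at h2
  exact ⟨h1, h2⟩

section

variable {α μ β lam₀ ξ : ℝ} (hα : 0 < α) (hμ : μ ∈ Ioc (0 : ℝ) 1) (hβ : β ∈ Ioc (0 : ℝ) 1)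
  (hlam : 0 < lam₀)
include hα hlam

theorem integrableOn_kernelReg {c : ℝ} (hc : 0 ≤ c) {R : ℝ} (hR : 0 < R) :
    IntegrableOn (kernelReg α c lam₀) (Ioc 0 R) := by
  rw [kernelReg_eq]
  exact integrableOn_mlDeriv hα (geomBdd_kerCoeff hc hlam) hR

theorem hasDerivAt_prabhakarE {c : ℝ} (hc : 0 ≤ c) {x : ℝ} (hx : 0 < x) :
    HasDerivAt (fun y : ℝ => prabhakarE α 1 c (-lam₀ * y ^ α)) (kernelReg α c lam₀ x) x := by
  rw [kernelReg_eq]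
  refine (hasDerivAt_mlSeries hα (geomBdd_kerCoeff hc hlam) hx).congr_of_eventuallyEq ?_
  filter_upwards [lt_mem_nhds hx] with y hy using prabhakarE_eq α c lam₀ (le_of_lt hy)

theorem jumpKernel_eq {c : ℝ} (hc : 0 ≤ c) {x : ℝ} (hx : 0 < x) :
    jumpKernel α c lam₀ x = -kernelReg α c lam₀ x := by
  rw [jumpKernel, (hasDerivAt_prabhakarE hα hlam hc hx).deriv]

theorem hasSum_jumpKernel {c : ℝ} (hc : 0 ≤ c) {x : ℝ} (hx : 0 < x) :
    HasSum (fun s : ℕ => lam₀ * x ^ (α - 1) * (poch c (s + 1) / ((s + 1).factorial : ℝ) *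
      (-lam₀ * x ^ α) ^ s / Gamma (α * s + α))) (jumpKernel α c lam₀ x) := by
  rw [jumpKernel_eq hα hlam hc hx, kernelReg_eq]
  refine (summable_mlDeriv' hα (geomBdd_kerCoeff hc hlam) hx).hasSum.neg.congr_fun fun s => ?_
  have e : α * ((s + 1 : ℕ) : ℝ) = α * s + α := by push_cast; ring
  rw [kerCoeff, e, add_sub_assoc, rpow_add hx, rpow_mul hx.le, rpow_natCast, mul_pow, pow_succ]
  ring

/-- This is `e^{c+d} = e^c * (δ - W_d)` tested against `φ`. The value at `τ = 0` of the smeared test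
function supplies the kernel of order `d` alone, and Fubini supplies the convolution. -/
theorem prabhakarKernel_add {c d : ℝ} (hc : 0 ≤ c) (hd : 0 ≤ d) {φ : ℝ → ℝ} (hφ : IsTest φ) :
    prabhakarKernel α (c + d) lam₀ φ = prabhakarKernel α c lam₀ φ -
      prabhakarKernel α c lam₀ (fun τ => ∫ y in Ioi (0 : ℝ), jumpKernel α d lam₀ y * φ (τ + y)) := by
  have hkc := fun R (hR : 0 < R) => integrableOn_kernelReg hα hlam hc hR
  have hkd := fun R (hR : 0 < R) => integrableOn_kernelReg hα hlam hd hR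
  have hkcd := fun R (hR : 0 < R) => integrableOn_kernelReg hα hlam (add_nonneg hc hd) hR
  have hψ : ∀ τ : ℝ, ∫ y in Ioi (0 : ℝ), jumpKernel α d lam₀ y * φ (τ + y) =
      -∫ y in Ioi (0 : ℝ), kernelReg α d lam₀ y * φ (τ + y) := fun τ => by
    rw [← integral_neg]
    refine setIntegral_congr_fun measurableSet_Ioi fun y hy => ?_
    rw [jumpKernel_eq hα hlam hd hy, neg_mul]
  have hconv : EqOn (fun z => kernelReg α (c + d) lam₀ z * φ z - (kernelReg α c lam₀ z * φ z +
      kernelReg α d lam₀ z * φ z)) (fun z => (∫ x in Ioc 0 z, kernelReg α c lam₀ x *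
        kernelReg α d lam₀ (z - x)) * φ z) (Ioi 0) := fun z hz => by
    simp only
    rw [kernelReg_add hα hc hd hlam hz]
    ring
  have i1 := hφ.integrableOn_mul hkc
  have i2 := hφ.integrableOn_mul hkd
  have i3 := hφ.integrableOn_mul hkcd
  have hF := integral_mul_integral_add hφ hkc hkd
  have i12 : IntegrableOn (fun z => kernelReg α c lam₀ z * φ z + kernelReg α d lam₀ z * φ z)
      (Ioi 0) := i1.add i2
  rw [← setIntegral_congr_fun measurableSet_Ioi hconv, integral_sub i3 i12,
    integral_add i1 i2] at hF
  have h0 := hψ 0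
  simp only [zero_add] at h0
  simp only [prabhakarKernel, hψ, h0, mul_neg, integral_neg, zero_add]
  linarith

theorem abs_kernelReg_le {c : ℝ} (hc : 0 ≤ c) {x : ℝ} (hx : 0 < x) :
    |kernelReg α c lam₀ x| ≤ 2 ^ c * mlDeriv α (fun s => (2 * lam₀) ^ s) x := by
  rw [kernelReg_eq]
  exact abs_mlDeriv_le hα (geomBdd_pow _) (abs_kerCoeff_le hc hlam) hx

theorem abs_prabhakarE_le {c : ℝ} (hc : 0 ≤ c) {x : ℝ} (hx : 0 ≤ x) :
    |prabhakarE α 1 c (-lam₀ * x ^ α)| ≤ 2 ^ c * mlSeries α (fun s => (2 * lam₀) ^ s) x := by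
  rw [prabhakarE_eq _ _ _ hx]
  exact abs_mlSeries_le hα (geomBdd_pow _) (abs_kerCoeff_le hc hlam) hx

omit hα hlam in
theorem summable_prabhakarTerm {α b c : ℝ} (hα : 0 < α) (hc : 0 ≤ c) (z : ℝ) :
    Summable (prabhakarTerm α b c z) := by
  have hb : GeomBdd fun s : ℕ => poch c s / (s.factorial : ℝ) * z ^ s := by
    refine GeomBdd.mul ⟨2 ^ c, 2, by positivity, by norm_num, fun s => ?_⟩ (geomBdd_pow z)
    have := poch_nonneg hc s
    rw [abs_of_nonneg (by positivity)]
    exact poch_div_factorial_le hc s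
  refine Summable.of_norm ((summable_geomBdd_div_Gamma (c := b) hα hb 1).abs.congr fun s => ?_)
  rw [prabhakarTerm, Real.norm_eq_abs, one_pow, mul_one, abs_div, abs_div, abs_abs]

omit hα hlam in
-- All kernels of order `mμ` are thereby at most `2^m` times one fixed majorant, which is what makes
-- the sum over `m` converge.
theorem two_rpow_le (hμ : μ ∈ Ioc (0 : ℝ) 1) (m : ℕ) : (2 : ℝ) ^ ((m : ℝ) * μ) ≤ 2 ^ m := by
  rw [← rpow_natCast 2 m]
  refine rpow_le_rpow_of_exponent_le (by norm_num) ?_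
  exact mul_le_of_le_one_right (Nat.cast_nonneg m) hμ.2

omit hα hlam in
theorem mlDeriv_pow_nonneg (hα : 0 < α) (hlam : 0 < lam₀) {x : ℝ} (hx : 0 < x) :
    0 ≤ mlDeriv α (fun s => (2 * lam₀) ^ s) x := by
  refine tsum_nonneg fun m => ?_
  have : 0 < Gamma (α * (m + 1 : ℕ)) := Gamma_pos_of_pos (by positivity)
  positivity

omit hα hlam in
theorem mlSeries_pow_nonneg (hα : 0 < α) (hlam : 0 < lam₀) {x : ℝ} (hx : 0 ≤ x) :
    0 ≤ mlSeries α (fun s => (2 * lam₀) ^ s) x := by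
  refine tsum_nonneg fun m => ?_
  have : 0 < Gamma (α * m + 1) := Gamma_pos_of_pos (by positivity)
  positivity

include hμ

theorem abs_kernelReg_nat_mul_le (m : ℕ) {x : ℝ} (hx : 0 < x) :
    |kernelReg α (m * μ) lam₀ x| ≤ 2 ^ m * mlDeriv α (fun s => (2 * lam₀) ^ s) x := by
  refine (abs_kernelReg_le hα hlam (mul_nonneg (Nat.cast_nonneg m) hμ.1.le) hx).trans ?_
  have := two_rpow_le hμ m
  have := mlDeriv_pow_nonneg hα hlam hx
  gcongr

theorem abs_prabhakarE_nat_mul_le (m : ℕ) {x : ℝ} (hx : 0 ≤ x) :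
    |prabhakarE α 1 (m * μ) (-lam₀ * x ^ α)| ≤
      2 ^ m * mlSeries α (fun s => (2 * lam₀) ^ s) x := by
  refine (abs_prabhakarE_le hα hlam (mul_nonneg (Nat.cast_nonneg m) hμ.1.le) hx).trans ?_
  have := two_rpow_le hμ m
  have := mlSeries_pow_nonneg hα hlam hx
  gcongr

theorem geomBdd_kernelReg {x : ℝ} (hx : 0 < x) :
    GeomBdd fun m : ℕ => kernelReg α (m * μ) lam₀ x :=
  ⟨_, 2, mlDeriv_pow_nonneg hα hlam hx, by norm_num, fun m => 
    (abs_kernelReg_nat_mul_le hα hμ hlam m hx).trans_eq (mul_comm _ _)⟩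

theorem geomBdd_prabhakarE {x : ℝ} (hx : 0 ≤ x) :
    GeomBdd fun m : ℕ => prabhakarE α 1 (m * μ) (-lam₀ * x ^ α) :=
  ⟨_, 2, mlSeries_pow_nonneg hα hlam hx, by norm_num, fun m => 
    (abs_prabhakarE_nat_mul_le hα hμ hlam m hx).trans_eq (mul_comm _ _)⟩

omit hμ hlam in
theorem IsTest.integrableOn_majorant {φ : ℝ → ℝ} (hφ : IsTest φ) :
    IntegrableOn (fun x => mlDeriv α (fun s => (2 * lam₀) ^ s) x * |φ x|) (Ioi 0) :=
  hφ.abs.integrableOn_mul fun _ hR => integrableOn_mlDeriv hα (geomBdd_pow _) hR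

theorem integrableOn_kernelReg_mul {φ : ℝ → ℝ} (hφ : IsTest φ) (m : ℕ) :
    IntegrableOn (fun x => kernelReg α (m * μ) lam₀ x * φ x) (Ioi 0) :=
  hφ.integrableOn_mul fun _ hR =>
    integrableOn_kernelReg hα hlam (mul_nonneg (Nat.cast_nonneg m) hμ.1.le) hR

theorem geomBdd_prabhakarKernel {φ : ℝ → ℝ} (hφ : IsTest φ) :
    GeomBdd fun m : ℕ => prabhakarKernel α (m * μ) lam₀ φ := by
  have hmaj := hφ.integrableOn_majorant (lam₀ := lam₀) hα
  have hI0 : 0 ≤ ∫ x in Ioi (0 : ℝ), mlDeriv α (fun s => (2 * lam₀) ^ s) x * |φ x| :=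
    setIntegral_nonneg measurableSet_Ioi fun x hx =>
      mul_nonneg (mlDeriv_pow_nonneg hα hlam hx) (abs_nonneg _)
  refine ⟨|φ 0| + ∫ x in Ioi (0 : ℝ), mlDeriv α (fun s => (2 * lam₀) ^ s) x * |φ x|, 2,
    by positivity, by norm_num, fun m => ?_⟩
  have h1 : |∫ x in Ioi (0 : ℝ), kernelReg α (m * μ) lam₀ x * φ x| ≤
      2 ^ m * ∫ x in Ioi (0 : ℝ), mlDeriv α (fun s => (2 * lam₀) ^ s) x * |φ x| := by
    rw [← integral_const_mul, ← Real.norm_eq_abs]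
    refine (norm_integral_le_integral_norm _).trans ?_
    refine setIntegral_mono_on (integrableOn_kernelReg_mul hα hμ hlam hφ m).norm
      (hmaj.const_mul _) measurableSet_Ioi fun x hx => ?_
    rw [norm_mul, Real.norm_eq_abs, Real.norm_eq_abs, ← mul_assoc]
    have := abs_kernelReg_nat_mul_le hα hμ hlam m hx
    gcongr
  have h2 : |φ 0| ≤ 2 ^ m * |φ 0| :=
    le_mul_of_one_le_left (abs_nonneg _) (one_le_pow₀ (by norm_num))
  simp only [prabhakarKernel]
  refine (abs_add_le _ _).trans ?_
  linarith

include hβ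

theorem summable_stateKernel {t : ℝ} (ht : 0 ≤ t) {φ : ℝ → ℝ} (hφ : IsTest φ) :
    Summable fun m : ℕ => timeCoeff β ξ t m * prabhakarKernel α (m * μ) lam₀ φ :=
  summable_timeCoeff_mul hβ.1 ξ (geomBdd_prabhakarKernel hα hμ hlam hφ) ht

theorem stateKernel_eq_atom_add_density {t : ℝ} (ht : 0 ≤ t) {φ : ℝ → ℝ} (hφ : IsTest φ) :
    IntegrableOn (fun x => stateDensity α μ β lam₀ ξ t x * φ x) (Ioi 0) ∧
    stateKernel α μ β lam₀ ξ t φ = (∑' m : ℕ, timeCoeff β ξ t m) * φ 0 +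
      ∫ x in Ioi (0 : ℝ), stateDensity α μ β lam₀ ξ t x * φ x := by
  obtain ⟨h1, h2⟩ := integral_tsum_timeCoeff hβ.1 ξ ht
    (integrableOn_kernelReg_mul hα hμ hlam hφ) (hφ.integrableOn_majorant (lam₀ := lam₀) hα)
    fun m x hx => abs_kernelReg_nat_mul_le hα hμ hlam m hx
  refine ⟨h1, ?_⟩
  have h3 : Summable fun m => timeCoeff β ξ t m := by
    simpa using summable_timeCoeff_mul hβ.1 ξ (geomBdd_pow 1) ht
  have h4 := (h3.hasSum.mul_right (φ 0)).add h2
  simp only [← mul_add] at h4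
  exact h4.tsum_eq

omit hβ in
/-- Integration by parts against one Prabhakar function. -/
theorem prabhakarKernel_eq_neg_integral {φ : ℝ → ℝ} (hφ : ContDiff ℝ 1 φ)
    (hφt : IsTest φ) (hφ' : IsTest (deriv φ)) (m : ℕ) :
    IntegrableOn (fun x => prabhakarE α 1 (m * μ) (-lam₀ * x ^ α) * deriv φ x) (Ioi 0) ∧
    prabhakarKernel α (m * μ) lam₀ φ =
      -∫ x in Ioi (0 : ℝ), prabhakarE α 1 (m * μ) (-lam₀ * x ^ α) * deriv φ x := by
  have hc : 0 ≤ (m : ℝ) * μ := mul_nonneg (Nat.cast_nonneg m) hμ.1.le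
  have hEc : ContinuousOn (fun x => prabhakarE α 1 (m * μ) (-lam₀ * x ^ α)) (Ici 0) :=
    (continuousOn_mlSeries hα (geomBdd_kerCoeff hc hlam)).congr fun x hx =>
      prabhakarE_eq α _ lam₀ hx
  have hEi : ∀ R, 0 < R →
      IntegrableOn (fun x => prabhakarE α 1 (m * μ) (-lam₀ * x ^ α)) (Ioc 0 R) := fun R _ =>
    ((hEc.mono (Icc_subset_Ici_self : Icc 0 R ⊆ Ici 0)).integrableOn_Icc).mono_set
      Ioc_subset_Icc_self
  refine ⟨hφ'.integrableOn_mul hEi, ?_⟩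
  obtain ⟨R₁, -, hR₁, -, -, hz₁⟩ := hφt.exists_bound
  obtain ⟨R₂, -, hR₂, -, -, hz₂⟩ := hφ'.exists_bound
  set R := max R₁ R₂
  have hR : 0 < R := lt_max_of_lt_left hR₁
  have hz : ∀ x, R ≤ x → φ x = 0 := fun x hx => hz₁ x ((le_max_left _ _).trans hx)
  have hz' : ∀ x, R ≤ x → deriv φ x = 0 := fun x hx => hz₂ x ((le_max_right _ _).trans hx)
  have hcut : ∀ f g : ℝ → ℝ, (∀ x, R ≤ x → g x = 0) →
      ∫ x in Ioi (0 : ℝ), f x * g x = ∫ x in (0 : ℝ)..R, f x * g x := fun f g hg => by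
    rw [intervalIntegral.integral_of_le hR.le]
    refine (setIntegral_eq_of_subset_of_forall_sdiff_eq_zero measurableSet_Ioi
      Ioc_subset_Ioi_self fun x hx => ?_)
    have : R ≤ x := by
      by_contra! h
      exact hx.2 ⟨hx.1, h.le⟩
    rw [hg x this, mul_zero]
  -- The Prabhakar function equals `1` at `0`; this jump of its product with the Heaviside function
  -- is what produces `φ 0`, the `δ` part.
  have hE0 : prabhakarE α 1 (m * μ) (-lam₀ * 0 ^ α) = 1 := by
    rw [prabhakarE_eq _ _ _ le_rfl, mlSeries_zero hα, kerCoeff_zero]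
  have hparts := intervalIntegral.integral_mul_deriv_eq_deriv_mul_of_hasDerivAt
    (a := 0) (b := R) (u := fun x => prabhakarE α 1 (m * μ) (-lam₀ * x ^ α)) (v := φ)
    (u' := kernelReg α (m * μ) lam₀) (v' := deriv φ) ?_ hφ.continuous.continuousOn ?_ ?_ ?_ ?_
  · rw [prabhakarKernel, hcut _ _ hz, hcut _ _ hz', hparts, hE0, hz R le_rfl]
    ring
  · rw [uIcc_of_le hR.le]
    exact hEc.mono Icc_subset_Ici_self
  · intro x hx
    rw [min_eq_left hR.le] at hx
    exact hasDerivAt_prabhakarE hα hlam hc hx.1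
  · intro x _
    exact (hφ.differentiable one_ne_zero x).hasDerivAt
  · rw [intervalIntegrable_iff_integrableOn_Ioc_of_le hR.le]
    exact integrableOn_kernelReg hα hlam hc hR
  · exact (hφ.continuous_deriv le_rfl).intervalIntegrable _ _

/-- The distributional derivative is computed for each order `mμ` separately and then summed against
the time coefficients, with the majorant `2^m` times a continuous function. -/
theorem stateKernel_eq_neg_integral_stateCdf {t : ℝ} (ht : 0 ≤ t) {φ : ℝ → ℝ}
    (hφ : ContDiff ℝ 1 φ) (hcs : HasCompactSupport φ) :
    IntegrableOn (fun x => stateCdf α μ β lam₀ ξ t x * deriv φ x) (Ioi 0) ∧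
    stateKernel α μ β lam₀ ξ t φ =
      -∫ x in Ioi (0 : ℝ), stateCdf α μ β lam₀ ξ t x * deriv φ x := by
  have htest : ∀ ψ : ℝ → ℝ, Continuous ψ → HasCompactSupport ψ → IsTest ψ := fun ψ h1 h2 => by
    refine ⟨h1.continuousOn, ?_⟩
    obtain ⟨R, hR⟩ := h2.isCompact.isBounded.subset_closedBall 0
    refine ⟨R + 1, fun x hx => ?_⟩
    by_contra hne
    have := hR (subset_tsupport ψ hne)
    rw [mem_closedBall_zero_iff, Real.norm_eq_abs] at this
    linarith [le_abs_self x]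
  have hφt := htest φ hφ.continuous hcs
  have hφ' := htest (deriv φ) (hφ.continuous_deriv le_rfl) hcs.deriv
  have hm := prabhakarKernel_eq_neg_integral hα hμ hlam hφ hφt hφ'
  have hNi : IntegrableOn (fun x => mlSeries α (fun s => (2 * lam₀) ^ s) x * |deriv φ x|)
      (Ioi 0) := hφ'.abs.integrableOn_mul fun R _ =>
    (((continuousOn_mlSeries hα (geomBdd_pow _)).mono
      (Icc_subset_Ici_self : Icc 0 R ⊆ Ici 0)).integrableOn_Icc).mono_set Ioc_subset_Icc_self
  obtain ⟨h1, h2⟩ := integral_tsum_timeCoeff hβ.1 ξ ht (fun m => (hm m).1) hNi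
    fun m x hx => abs_prabhakarE_nat_mul_le hα hμ hlam m hx.le
  refine ⟨h1, ?_⟩
  rw [stateKernel]
  refine HasSum.tsum_eq (h2.neg.congr_fun fun m => ?_)
  rw [(hm m).2, mul_neg]

/-- The Caputo derivative replaces `e^{mμ}` by `-ξ e^{(m+1)μ}`, and `e^{(m+1)μ} = e^{mμ} - e^{mμ} *
W` by the semigroup law. -/
theorem isContinuousSolution_stateKernel :
    IsContinuousSolution β ξ (jumpKernel α μ lam₀) (stateKernel α μ β lam₀ ξ) := by
  have hgeom := fun (φ : ℝ → ℝ) (hφ : IsTest φ) =>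
    (geomBdd_pow (-ξ)).mul (geomBdd_prabhakarKernel hα hμ hlam hφ)
  have heq : ∀ φ t, 0 ≤ t → stateKernel α μ β lam₀ ξ t φ =
      mlSeries β (fun m => (-ξ) ^ m * prabhakarKernel α (m * μ) lam₀ φ) t := fun φ t ht =>
    tsum_timeCoeff_mul β ξ _ ht
  refine ⟨fun φ hφ => ?_, fun φ hφ => ?_, fun φ hφ t ht => ?_⟩
  · exact (caputoRegular_mlSeries hβ.1 (hgeom φ hφ)).congr fun t ht => heq φ t ht
  · rw [heq φ 0 le_rfl, mlSeries_zero hβ.1]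
    have : kernelReg α (((0 : ℕ) : ℝ) * μ) lam₀ = 0 := by
      funext x
      simp [kernelReg, kernelTerm, poch_zero_succ]
    rw [prabhakarKernel, this]
    simp
  · refine HasCaputoDerivAt.congr ?_ ht fun t ht => heq φ t ht
    have h := hasCaputoDerivAt_mlSeries hβ (hgeom φ hφ) ht
    have e : mlSeries β (fun m => (-ξ) ^ (m + 1) * prabhakarKernel α ((m + 1 : ℕ) * μ) lam₀ φ) t =
        -ξ * stateKernel α μ β lam₀ ξ t φ +
          ξ * convDistr (jumpKernel α μ lam₀) (stateKernel α μ β lam₀ ξ t) φ := by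
      have hs0 := (summable_stateKernel (ξ := ξ) hα hμ hβ hlam ht.le hφ).hasSum
      have hs1 := (summable_timeCoeff_mul hβ.1 ξ
        (geomBdd_prabhakarKernel hα hμ hlam hφ).shift ht.le).hasSum
      -- The smeared function need not be known to be a test function: each kernel applied to it is
      -- rewritten in terms of kernels applied to `φ`, where convergence in `m` is known.
      have hadd : ∀ m : ℕ, prabhakarKernel α (m * μ) lam₀
          (fun τ => ∫ y in Ioi (0 : ℝ), jumpKernel α μ lam₀ y * φ (τ + y)) =
          prabhakarKernel α (m * μ) lam₀ φ - prabhakarKernel α ((m + 1 : ℕ) * μ) lam₀ φ := by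
        intro m
        have e1 : ((m + 1 : ℕ) : ℝ) * μ = m * μ + μ := by push_cast; ring
        rw [e1, prabhakarKernel_add hα hlam (mul_nonneg (Nat.cast_nonneg m) hμ.1.le) hμ.1.le hφ]
        ring
      have hconv : convDistr (jumpKernel α μ lam₀) (stateKernel α μ β lam₀ ξ t) φ =
          stateKernel α μ β lam₀ ξ t φ -
            ∑' m : ℕ, timeCoeff β ξ t m * prabhakarKernel α ((m + 1 : ℕ) * μ) lam₀ φ := by
        rw [convDistr, stateKernel]
        simp only [hadd, mul_sub]
        exact (hs0.sub hs1).tsum_eq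
      have hD : mlSeries β
          (fun m => (-ξ) ^ (m + 1) * prabhakarKernel α ((m + 1 : ℕ) * μ) lam₀ φ) t =
          -ξ * ∑' m : ℕ, timeCoeff β ξ t m * prabhakarKernel α ((m + 1 : ℕ) * μ) lam₀ φ := by
        rw [tsum_timeCoeff_mul β ξ _ ht.le, mlSeries, mlSeries, ← tsum_mul_left]
        refine tsum_congr fun m => ?_
        ring
      rw [hconv, hD]
      ring
    rw [← e]
    exact h

end

/-! ### Asymptotics of `(a)_n / n!` -/

theorem poch_div_factorial_succ (a : ℝ) (n : ℕ) :
    poch a (n + 1) / ((n + 1).factorial : ℝ) =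
      poch a n / (n.factorial : ℝ) * ((a + n) / (n + 1)) := by
  rw [poch_succ, Nat.factorial_succ]
  push_cast
  field_simp

/-- A bound uniform in `a`. The sequence `(a)_k / k!` is monotone in `k`, so at least `n` terms of
the binomial series at `r` dominate `(a)_n / n! · r^{2n}`, and their sum is at most `(1-r)^{-a}`. -/
theorem nat_mul_poch_mul_pow_le {a r : ℝ} (ha : 0 ≤ a) (hr : 0 < r) (hr1 : r < 1) (n : ℕ) :
    n * (poch a n / (n.factorial : ℝ) * r ^ (2 * n)) ≤ (1 - r) ^ (-a) := by
  have hsum := hasSum_poch a (u := r) (by rwa [abs_of_pos hr])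
  have h0 : ∀ k, 0 ≤ poch a k / (k.factorial : ℝ) := fun k => by
    have := poch_nonneg ha k
    positivity
  have key : ∀ S : Finset ℕ, S.card = n → (∀ k ∈ S, poch a n / (n.factorial : ℝ) * r ^ (2 * n) ≤
      poch a k / (k.factorial : ℝ) * r ^ k) →
      n * (poch a n / (n.factorial : ℝ) * r ^ (2 * n)) ≤ (1 - r) ^ (-a) := fun S hS h => by
    have h1 := Finset.card_nsmul_le_sum S _ _ h
    rw [hS, nsmul_eq_mul] at h1
    exact h1.trans (sum_le_hasSum S (fun k _ => mul_nonneg (h0 k) (pow_nonneg hr.le k)) hsum)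
  -- The ratio of consecutive terms is `(a+k)/(k+1)`. For `a ≥ 1` the sequence increases and the
  -- indices `n ≤ k < 2n` serve; for `a ≤ 1` it decreases and `k < n` serve.
  rcases le_total 1 a with h1 | h1
  · have hmono : Monotone fun k => poch a k / (k.factorial : ℝ) := monotone_nat_of_le_succ fun k => by
      rw [poch_div_factorial_succ]
      refine le_mul_of_one_le_right (h0 k) ?_
      rw [le_div_iff₀ (by positivity)]
      linarith
    refine key (Finset.Ico n (2 * n)) (by simp; omega) fun k hk => ?_
    rw [Finset.mem_Ico] at hk
    exact mul_le_mul (hmono hk.1) (pow_le_pow_of_le_one hr.le hr1.le hk.2.le) (by positivity) (h0 k)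
  · have hanti : Antitone fun k => poch a k / (k.factorial : ℝ) := antitone_nat_of_succ_le fun k => by
      rw [poch_div_factorial_succ]
      refine mul_le_of_le_one_right (h0 k) ?_
      rw [div_le_one (by positivity)]
      linarith
    refine key (Finset.range n) (by simp) fun k hk => ?_
    rw [Finset.mem_range] at hk
    exact mul_le_mul (hanti hk.le) (pow_le_pow_of_le_one hr.le hr1.le (by omega)) (by positivity)
      (h0 k)

/-- The choice `r = n/(n+κ)` makes `r^{-2n} = (1 + κ/n)^{2n} ≤ e^{2κ}`. A large `κ` shrinks the base
of the power `a` at the price of a constant independent of `a`. -/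
theorem poch_div_factorial_le_exp {a κ : ℝ} (ha : 0 ≤ a) (hκ : 0 < κ) {n : ℕ} (hn : 0 < n) :
    poch a n / (n.factorial : ℝ) ≤ 1 / n * (exp (2 * κ) * ((n + κ) / κ) ^ a) := by
  have hn' : (0 : ℝ) < n := Nat.cast_pos.2 hn
  set r : ℝ := n / (n + κ) with hr
  have hr0 : 0 < r := by positivity
  have hr1 : r < 1 := by rw [hr, div_lt_one (by positivity)]; linarith
  have h := nat_mul_poch_mul_pow_le ha hr0 hr1 n
  have e1 : (1 - r) ^ (-a) = ((n + κ) / κ) ^ a := by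
    have : 1 - r = ((n + κ) / κ)⁻¹ := by rw [hr]; field_simp; ring
    rw [this, inv_rpow (by positivity), rpow_neg (by positivity), inv_inv]
  have e2 : 1 ≤ exp (2 * κ) * r ^ (2 * n) := by
    have h1 : r⁻¹ ≤ exp (κ / n) := by
      have : r⁻¹ = κ / n + 1 := by rw [hr]; field_simp; ring
      rw [this]
      exact add_one_le_exp _
    have h2 : (r⁻¹) ^ (2 * n) ≤ exp (2 * κ) := by
      refine (pow_le_pow_left₀ (by positivity) h1 _).trans_eq ?_
      rw [← exp_nat_mul]
      congr 1
      push_cast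
      field_simp
    rw [inv_pow] at h2
    exact (inv_le_iff_one_le_mul₀ (by positivity)).1 h2
  have h0 : 0 ≤ poch a n / (n.factorial : ℝ) := by
    have := poch_nonneg ha n
    positivity
  rw [e1] at h
  rw [one_div, ← div_eq_inv_mul, le_div_iff₀ hn']
  calc poch a n / (n.factorial : ℝ) * n
      ≤ poch a n / (n.factorial : ℝ) * n * (exp (2 * κ) * r ^ (2 * n)) :=
        le_mul_of_one_le_right (by positivity) e2
    _ = exp (2 * κ) * (n * (poch a n / (n.factorial : ℝ) * r ^ (2 * n))) := by ring
    _ ≤ _ := by gcongr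

theorem rpow_mul_poch_floor_le {a κ h x : ℝ} (ha : 0 ≤ a) (hκ : 0 < κ) (hh : 0 < h) (hx : h ≤ x) :
    h ^ (a - 1) * (poch a ⌊x / h⌋₊ / (⌊x / h⌋₊.factorial : ℝ)) ≤
      2 / x * exp (2 * κ) * (x / κ + h) ^ a := by
  have hx0 : 0 < x := hh.trans_le hx
  have h1 : 1 ≤ x / h := (one_le_div hh).2 hx
  have hn : 0 < ⌊x / h⌋₊ := Nat.floor_pos.2 h1
  have hn1 : (1 : ℝ) ≤ ⌊x / h⌋₊ := by exact_mod_cast hn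
  have hle : (⌊x / h⌋₊ : ℝ) ≤ x / h := Nat.floor_le (by positivity)
  have hlt : x / h < ⌊x / h⌋₊ + 1 := Nat.lt_floor_add_one _
  -- For `x/h ≥ 1` the integer part is at least half of `x/h`.
  have hge : 1 / (⌊x / h⌋₊ : ℝ) ≤ 2 * h / x := by
    rw [div_le_div_iff₀ (by linarith) hx0]
    rw [div_lt_iff₀ hh] at hlt
    nlinarith
  calc h ^ (a - 1) * (poch a ⌊x / h⌋₊ / (⌊x / h⌋₊.factorial : ℝ))
      ≤ h ^ (a - 1) * (2 * h / x * (exp (2 * κ) * ((x / h + κ) / κ) ^ a)) := by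
        gcongr
        refine (poch_div_factorial_le_exp ha hκ hn).trans ?_
        gcongr
    _ = 2 / x * exp (2 * κ) * (h ^ a * ((x / h + κ) / κ) ^ a) := by
        rw [rpow_sub_one hh.ne']
        field_simp
    _ = _ := by
        rw [← mul_rpow hh.le (by positivity)]
        congr 2
        field_simp

/-- Uniform bound for the scaled coefficients on bounded intervals. -/
theorem exists_bound_rpow_mul_poch_floor {α q R : ℝ} (hα : α ∈ Ioc (0 : ℝ) 1) (hq : 0 < q) :
    ∃ C h₀ : ℝ, 0 < C ∧ 0 < h₀ ∧ ∀ (s : ℕ) (h x : ℝ), 0 < h → h ≤ h₀ → h ≤ x →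
      x ≤ R → h ^ (α * (s + 1 : ℕ) - 1) * (poch (α * (s + 1 : ℕ)) ⌊x / h⌋₊ /
        (⌊x / h⌋₊.factorial : ℝ)) ≤ C * x ^ (α - 1) * q ^ s := by
  -- It suffices to push the base `x/κ + h` below `p`, since `p^{αs} = q^s`. The choices `κ ≥ 2R/p`
  -- and `h ≤ p/2` do this, while `κ ≥ 1` gives the bound `2x` used for the one remaining power `α`.
  set p := q ^ (1 / α) with hp
  have hp0 : 0 < p := by positivity
  set κ := max 1 (2 * R / p)
  have hκ1 : 1 ≤ κ := le_max_left _ _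
  have hκ : 0 < κ := by linarith
  have hRκ : R / κ ≤ p / 2 := by
    rw [div_le_div_iff₀ hκ two_pos]
    have : 2 * R / p ≤ κ := le_max_right _ _
    rw [div_le_iff₀ hp0] at this
    linarith
  refine ⟨4 * exp (2 * κ), p / 2, by positivity, by positivity, fun s h x hh hh0 hx hxR => ?_⟩
  have hx0 : 0 < x := hh.trans_le hx
  have ha : 0 ≤ α * ((s + 1 : ℕ) : ℝ) := mul_nonneg hα.1.le (Nat.cast_nonneg _)
  have e1 : (x / κ + h) ^ (α * ((s + 1 : ℕ) : ℝ)) ≤ 2 * x ^ α * q ^ s := by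
    have e : α * ((s + 1 : ℕ) : ℝ) = α + α * s := by push_cast; ring
    have b1 : x / κ + h ≤ 2 * x := by
      have : x / κ ≤ x := div_le_self hx0.le hκ1
      linarith
    have b2 : x / κ + h ≤ p := by
      have : x / κ ≤ R / κ := by gcongr
      linarith
    have b0 : 0 < x / κ + h := by positivity
    have c1 : (x / κ + h) ^ α ≤ 2 * x ^ α := by
      refine (rpow_le_rpow b0.le b1 hα.1.le).trans ?_
      rw [mul_rpow two_pos.le hx0.le]
      gcongr
      exact rpow_le_self_of_one_le (by norm_num) hα.2
    have c2 : (x / κ + h) ^ (α * (s : ℝ)) ≤ q ^ s := by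
      refine (rpow_le_rpow b0.le b2 (by have := hα.1; positivity)).trans_eq ?_
      rw [hp, ← rpow_mul hq.le, ← mul_assoc, one_div, inv_mul_cancel₀ hα.1.ne', one_mul,
        rpow_natCast]
    rw [e, rpow_add b0]
    gcongr
  calc _ ≤ 2 / x * exp (2 * κ) * (x / κ + h) ^ (α * ((s + 1 : ℕ) : ℝ)) :=
        rpow_mul_poch_floor_le ha hκ hh hx
    _ ≤ 2 / x * exp (2 * κ) * (2 * x ^ α * q ^ s) := by gcongr
    _ = _ := by
        rw [rpow_sub_one hx0.ne']
        ring

/-- Euler's sequence is `n^a n! / (a)_{n+1}`; this rearrangement transfers its limit to `(a)_n / n!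
~ n^{a-1} / Γ(a)`. -/
theorem GammaSeq_mul_poch (a : ℝ) (n : ℕ) (hn : (a + n) * poch a n ≠ 0) :
    GammaSeq a n * ((a + n) * (poch a n / (n.factorial : ℝ))) = (n : ℝ) ^ a := by
  have h : ∀ k : ℕ, ∏ j ∈ Finset.range k, (a + j) = poch a k := fun k => by
    induction k with
    | zero => simp [poch_zero]
    | succ k ih => rw [Finset.prod_range_succ, ih, poch_succ]
  have := Nat.factorial_ne_zero n
  rw [GammaSeq, h, poch_succ]
  have h1 := left_ne_zero_of_mul hn
  have h2 := right_ne_zero_of_mul hn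
  field_simp

theorem tendsto_poch_mul_rpow {a : ℝ} (ha : 0 < a) :
    Tendsto (fun n : ℕ => poch a n / (n.factorial : ℝ) * (n : ℝ) ^ (1 - a)) atTop
      (𝓝 (1 / Gamma a)) := by
  have hG := GammaSeq_tendsto_Gamma a
  have h1 : Tendsto (fun n : ℕ => (n : ℝ) / (n + a)) atTop (𝓝 1) :=
    tendsto_natCast_div_add_atTop a
  refine (h1.div hG (Gamma_pos_of_pos ha).ne').congr' ?_
  filter_upwards [eventually_gt_atTop 0] with n hn
  have hn' : (0 : ℝ) < n := Nat.cast_pos.2 hn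
  have hp : 0 < poch a n := by
    clear hn hn'
    induction n with
    | zero => simp [poch_zero]
    | succ n ih => rw [poch_succ]; positivity
  have h := GammaSeq_mul_poch a n (by positivity)
  have hS : GammaSeq a n ≠ 0 := fun h0 => by
    rw [h0, zero_mul] at h
    exact (rpow_pos_of_pos hn' a).ne h
  have e : (n : ℝ) ^ (1 - a) = n / n ^ a := by rw [rpow_sub hn', rpow_one]
  rw [Pi.div_apply, e, ← h]
  have := Nat.factorial_ne_zero n
  field_simp
  ring

/-- With `n = ⌊x/h⌋` one has `n h → x`, and the expression is `(n h)^{a-1}` times `n^{1-a} (a)_n /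
n!`. -/
theorem tendsto_rpow_mul_poch_floor {a x : ℝ} (ha : 0 < a) (hx : 0 < x) :
    Tendsto (fun h : ℝ => h ^ (a - 1) * (poch a ⌊x / h⌋₊ / (⌊x / h⌋₊.factorial : ℝ))) (𝓝[>] 0)
      (𝓝 (x ^ (a - 1) / Gamma a)) := by
  have hinv : Tendsto (fun h : ℝ => h⁻¹) (𝓝[>] 0) atTop := tendsto_inv_nhdsGT_zero
  have hfl : Tendsto (fun h : ℝ => ⌊x / h⌋₊) (𝓝[>] 0) atTop :=
    tendsto_nat_floor_atTop.comp (hinv.const_mul_atTop hx)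
  have hhn : Tendsto (fun h : ℝ => (⌊x / h⌋₊ : ℝ) * h) (𝓝[>] 0) (𝓝 x) :=
    ((tendsto_nat_floor_mul_div_atTop hx.le).comp hinv).congr fun h => by
      simp [div_eq_mul_inv]
  have h1 := (hhn.rpow_const (p := a - 1) (Or.inl hx.ne')).mul ((tendsto_poch_mul_rpow ha).comp hfl)
  rw [mul_one_div] at h1
  refine h1.congr' ?_
  filter_upwards [self_mem_nhdsWithin, hfl.eventually_gt_atTop 0] with h hh hn
  have hh : 0 < h := hh
  have hn' : (0 : ℝ) < ⌊x / h⌋₊ := Nat.cast_pos.2 hn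
  have e : (⌊x / h⌋₊ : ℝ) ^ (1 - a) = ((⌊x / h⌋₊ : ℝ) ^ (a - 1))⁻¹ := by
    rw [← rpow_neg hn'.le, neg_sub]
  have : (⌊x / h⌋₊ : ℝ) ^ (a - 1) ≠ 0 := (rpow_pos_of_pos hn' _).ne'
  simp only [Function.comp]
  rw [e, mul_rpow hn'.le hh.le]
  field_simp

/-! ### The well-scaled limit -/

/-- The scaling `λ = λ₀ h^α` is exactly what joins each `(-λ)^s / h` into `(-λ₀)^s h^{αs-1}`. The `s
= 0` term vanishes because `(0)_n = 0` for `n > 0`; it survives only in the cell at the origin. -/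
theorem hasSum_discPrabhakar_scaled {α c lam₀ h : ℝ} (hα : α ∈ Ioc (0 : ℝ) 1) (hc : 0 ≤ c)
    (hlam : 0 < lam₀) (hh : 0 < h) (h1 : lam₀ * h ^ α < 1) {n : ℕ} (hn : 0 < n) :
    HasSum (fun s : ℕ => kerCoeff c lam₀ (s + 1) * (h ^ (α * (s + 1 : ℕ) - 1) *
      (poch (α * (s + 1 : ℕ)) n / (n.factorial : ℝ))))
      (1 / h * discPrabhakar α c (lam₀ * h ^ α) n) := by
  have h2 := (hasSum_discPrabhakar_of_lt_one hα (by positivity) hc h1 n).mul_left (1 / h)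
  obtain ⟨k, rfl⟩ := Nat.exists_eq_succ_of_ne_zero hn.ne'
  rw [← hasSum_nat_add_iff' 1] at h2
  simp only [Finset.range_one, Finset.sum_singleton, Nat.cast_zero, mul_zero,
    Nat.succ_eq_add_one, poch_zero_succ, sub_zero] at h2
  refine h2.congr_fun fun s => ?_
  have e : h ^ (α * ((s + 1 : ℕ) : ℝ) - 1) = (h ^ α) ^ (s + 1) / h := by
    rw [rpow_sub_one hh.ne', rpow_mul hh.le, rpow_natCast]
  rw [e, kerCoeff, ← neg_mul, mul_pow]
  ring

section

variable {α μ β lam₀ ξ : ℝ} (hα : α ∈ Ioc (0 : ℝ) 1) (hμ : μ ∈ Ioc (0 : ℝ) 1)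
  (hβ : β ∈ Ioc (0 : ℝ) 1) (hξ : 0 < ξ) (hlam : 0 < lam₀)

include hα hlam in
theorem eventually_scale_lt_one : ∃ h₁ : ℝ, 0 < h₁ ∧ ∀ h, 0 < h → h ≤ h₁ → lam₀ * h ^ α < 1 := by
  refine ⟨(1 / (2 * lam₀)) ^ (1 / α), by positivity, fun h hh hle => ?_⟩
  have h1 : h ^ α ≤ 1 / (2 * lam₀) := by
    refine (rpow_le_rpow hh.le hle hα.1.le).trans_eq ?_
    rw [← rpow_mul (by positivity), one_div_mul_cancel hα.1.ne', rpow_one]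
  calc lam₀ * h ^ α ≤ lam₀ * (1 / (2 * lam₀)) := by gcongr
    _ = 1 / 2 := by field_simp
    _ < 1 := by norm_num

include hα hlam in
/-- Uniform bound and limit for the scaled discrete Prabhakar kernels. -/
theorem exists_bound_discPrabhakar_scaled (R : ℝ) : ∃ C h₀ : ℝ, 0 < C ∧ 0 < h₀ ∧
    (∀ h, 0 < h → h ≤ h₀ → lam₀ * h ^ α < 1) ∧
    ∀ c : ℝ, 0 ≤ c →
      (∀ h x, 0 < h → h ≤ h₀ → h ≤ x → x ≤ R →
        |1 / h * discPrabhakar α c (lam₀ * h ^ α) ⌊x / h⌋₊| ≤ 2 ^ c * (C * x ^ (α - 1))) ∧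
      ∀ x, 0 < x → x ≤ R → Tendsto
        (fun h : ℝ => 1 / h * discPrabhakar α c (lam₀ * h ^ α) ⌊x / h⌋₊) (𝓝[>] 0)
        (𝓝 (kernelReg α c lam₀ x)) := by
  -- The coefficients grow like `(2λ₀)^s`, so `q = 1/(4λ₀)` leaves the ratio `1/2`.
  obtain ⟨C, h₂, hC, hh₂, hb⟩ := exists_bound_rpow_mul_poch_floor (R := R) hα
    (q := 1 / (4 * lam₀)) (by positivity)
  obtain ⟨h₁, hh₁, hl⟩ := eventually_scale_lt_one hα hlam
  refine ⟨4 * lam₀ * C, min h₁ h₂, by positivity, lt_min hh₁ hh₂,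
    fun h hh hle => hl h hh (hle.trans (min_le_left _ _)), fun c hc => ?_⟩
  have hterm : ∀ (s : ℕ) (h x : ℝ), 0 < h → h ≤ min h₁ h₂ → h ≤ x → x ≤ R →
      ‖kerCoeff c lam₀ (s + 1) * (h ^ (α * (s + 1 : ℕ) - 1) *
        (poch (α * (s + 1 : ℕ)) ⌊x / h⌋₊ / (⌊x / h⌋₊.factorial : ℝ)))‖ ≤
        2 ^ c * (2 * lam₀ * C * x ^ (α - 1)) * (1 / 2) ^ s := fun s h x hh hle hx hxR => by
    have h1 := hb s h x hh (hle.trans (min_le_right _ _)) hx hxR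
    have h2 := abs_kerCoeff_le hc hlam (s + 1)
    have h3 : 0 ≤ poch (α * (s + 1 : ℕ)) ⌊x / h⌋₊ :=
      poch_nonneg (mul_nonneg hα.1.le (Nat.cast_nonneg _)) _
    rw [norm_mul, Real.norm_eq_abs, Real.norm_of_nonneg (by positivity)]
    calc _ ≤ 2 ^ c * (2 * lam₀) ^ (s + 1) * (C * x ^ (α - 1) * (1 / (4 * lam₀)) ^ s) := by gcongr
      _ = 2 ^ c * (2 * lam₀ * C * x ^ (α - 1)) * (2 * lam₀ * (1 / (4 * lam₀))) ^ s := by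
          rw [mul_pow (2 * lam₀) (1 / (4 * lam₀)) s]
          ring
      _ = _ := by
          congr 2
          field_simp
          norm_num
  have hgeo : ∀ x : ℝ, HasSum (fun s : ℕ => 2 ^ c * (2 * lam₀ * C * x ^ (α - 1)) * (1 / 2) ^ s)
      (2 ^ c * (4 * lam₀ * C * x ^ (α - 1))) := fun x => by
    have e : 2 ^ c * (4 * lam₀ * C * x ^ (α - 1)) = 2 ^ c * (2 * lam₀ * C * x ^ (α - 1)) * 2 := by
      ring
    rw [e]
    exact hasSum_geometric_two.mul_left _
  have hser : ∀ h x : ℝ, 0 < h → h ≤ min h₁ h₂ → h ≤ x →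
      HasSum (fun s : ℕ => kerCoeff c lam₀ (s + 1) * (h ^ (α * (s + 1 : ℕ) - 1) *
        (poch (α * (s + 1 : ℕ)) ⌊x / h⌋₊ / (⌊x / h⌋₊.factorial : ℝ))))
        (1 / h * discPrabhakar α c (lam₀ * h ^ α) ⌊x / h⌋₊) := fun h x hh hle hx =>
    hasSum_discPrabhakar_scaled hα hc hlam hh (hl h hh (hle.trans (min_le_left _ _)))
      (Nat.floor_pos.2 ((one_le_div hh).2 hx))
  refine ⟨fun h x hh hle hx hxR => ?_, fun x hx0 hxR => ?_⟩
  · rw [← (hser h x hh hle hx).tsum_eq, ← Real.norm_eq_abs]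
    exact tsum_of_norm_bounded (hgeo x) fun s => hterm s h x hh hle hx hxR
  · have hev : ∀ᶠ h : ℝ in 𝓝[>] 0, 0 < h ∧ h ≤ min h₁ h₂ ∧ h ≤ x := by
      filter_upwards [self_mem_nhdsWithin, Ioc_mem_nhdsGT (lt_min (lt_min hh₁ hh₂) hx0)] with h h1 h2
      exact ⟨h1, h2.2.trans (min_le_left _ _), h2.2.trans (min_le_right _ _)⟩
    have hlim := tendsto_tsum_of_dominated_convergence (𝓕 := 𝓝[>] (0 : ℝ)) (hgeo x).summable
      (fun s : ℕ => (tendsto_rpow_mul_poch_floor (a := α * (s + 1 : ℕ)) (mul_pos hα.1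
        (Nat.cast_pos.2 s.succ_pos)) hx0).const_mul (kerCoeff c lam₀ (s + 1)))
      (by filter_upwards [hev] with h hh s using hterm s h x hh.1 hh.2.1 hh.2.2 hxR)
    have e : ∑' s : ℕ, kerCoeff c lam₀ (s + 1) * (x ^ (α * (s + 1 : ℕ) - 1) /
        Gamma (α * (s + 1 : ℕ))) = kernelReg α c lam₀ x := by
      rw [kernelReg_eq]
      exact tsum_congr fun s => by rw [mul_div_assoc]
    rw [e] at hlim
    refine hlim.congr' ?_
    filter_upwards [hev] with h hh using (hser h x hh.1 hh.2.1 hh.2.2).tsum_eq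

theorem stateTerm_eq_timeCoeff (α μ β ξ t : ℝ) {lam : ℝ} (n m : ℕ) :
    stateTerm α μ β lam ξ n t m =
      timeCoeff β ξ t m * (((lam + 1) ^ μ) ^ m * discPrabhakar α (m * μ) lam n) := by
  rw [stateTerm, timeCoeff, mul_assoc ((lam + 1) ^ μ), ← mul_neg, mul_pow]
  ring

include hμ in
theorem rpow_add_one_le_two {lam : ℝ} (h0 : 0 < lam) (h1 : lam < 1) : (lam + 1) ^ μ ≤ 2 :=
  calc (lam + 1) ^ μ ≤ 2 ^ μ := rpow_le_rpow (by positivity) (by linarith) hμ.1.le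
    _ ≤ 2 := rpow_le_self_of_one_le (by norm_num) hμ.2

include hα hμ hβ hlam in
-- Dominated convergence in `m`. The factor `(λ+1)^{μm}`, which tends to `1`, and the kernel of
-- order `mμ` cost `2^m` each, and `4^m` is still summable against the time coefficients. The common
-- profile `x^{α-1}` is integrable at `0`.
theorem exists_bound_stateProb_scaled {t : ℝ} (ht : 0 ≤ t) (R : ℝ) : ∃ C h₀ : ℝ, 0 < h₀ ∧
    (∀ h x, 0 < h → h ≤ h₀ → h ≤ x → x ≤ R →
      |1 / h * stateProb α μ β (lam₀ * h ^ α) ξ ⌊x / h⌋₊ t| ≤ C * x ^ (α - 1)) ∧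
    ∀ x, 0 < x → x ≤ R → Tendsto
      (fun h : ℝ => 1 / h * stateProb α μ β (lam₀ * h ^ α) ξ ⌊x / h⌋₊ t) (𝓝[>] 0)
      (𝓝 (stateDensity α μ β lam₀ ξ t x)) := by
  obtain ⟨C, h₀, hC, hh₀, hl, hD⟩ := exists_bound_discPrabhakar_scaled hα hlam R
  have hc : ∀ m : ℕ, 0 ≤ (m : ℝ) * μ := fun m => mul_nonneg (Nat.cast_nonneg m) hμ.1.le
  have hsum : Summable fun m => |timeCoeff β ξ t m| * 4 ^ m :=
    (summable_timeCoeff_mul hβ.1 ξ (geomBdd_pow 4) ht).abs.congr fun m => by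
      rw [abs_mul, abs_of_pos (by positivity : (0 : ℝ) < 4 ^ m)]
  have heq : ∀ (h x : ℝ), 1 / h * stateProb α μ β (lam₀ * h ^ α) ξ ⌊x / h⌋₊ t =
      ∑' m : ℕ, timeCoeff β ξ t m * (((lam₀ * h ^ α + 1) ^ μ) ^ m *
        (1 / h * discPrabhakar α (m * μ) (lam₀ * h ^ α) ⌊x / h⌋₊)) := fun h x => by
    rw [stateProb, ← tsum_mul_left]
    refine tsum_congr fun m => ?_
    rw [stateTerm_eq_timeCoeff]
    ring
  have hterm : ∀ (m : ℕ) (h x : ℝ), 0 < h → h ≤ h₀ → h ≤ x → x ≤ R →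
      ‖timeCoeff β ξ t m * (((lam₀ * h ^ α + 1) ^ μ) ^ m *
        (1 / h * discPrabhakar α (m * μ) (lam₀ * h ^ α) ⌊x / h⌋₊))‖ ≤
      |timeCoeff β ξ t m| * 4 ^ m * (C * x ^ (α - 1)) := fun m h x hh hle hx hxR => by
    have hx0 := hh.trans_le hx
    have h1 := (hD (m * μ) (hc m)).1 h x hh hle hx hxR
    have h2 := two_rpow_le hμ m
    have h3 := rpow_add_one_le_two hμ (lam := lam₀ * h ^ α) (by positivity) (hl h hh hle)
    rw [norm_mul, norm_mul, Real.norm_eq_abs, Real.norm_eq_abs, Real.norm_eq_abs,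
      abs_of_nonneg (a := ((lam₀ * h ^ α + 1) ^ μ) ^ m) (by positivity), mul_assoc]
    refine mul_le_mul_of_nonneg_left ?_ (abs_nonneg _)
    calc _ ≤ 2 ^ m * (2 ^ m * (C * x ^ (α - 1))) := by
          refine mul_le_mul (pow_le_pow_left₀ (by positivity) h3 m) (h1.trans ?_) (abs_nonneg _)
            (by positivity)
          gcongr
      _ = _ := by
          rw [← mul_assoc, ← mul_pow, show (2 : ℝ) * 2 = 4 by norm_num]
  refine ⟨(∑' m, |timeCoeff β ξ t m| * 4 ^ m) * C, h₀, hh₀, fun h x hh hle hx hxR => ?_,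
    fun x hx0 hxR => ?_⟩
  · rw [heq, ← Real.norm_eq_abs, mul_assoc]
    exact tsum_of_norm_bounded (hsum.hasSum.mul_right _) fun m => hterm m h x hh hle hx hxR
  · have hone : Tendsto (fun h : ℝ => (lam₀ * h ^ α + 1) ^ μ) (𝓝[>] 0) (𝓝 1) := by
      have hcont : ContinuousAt (fun h : ℝ => (lam₀ * h ^ α + 1) ^ μ) 0 := by
        refine ContinuousAt.rpow_const ?_ (Or.inr hμ.1.le)
        exact (continuousAt_const.mul (continuousAt_id.rpow_const (Or.inr hα.1.le))).add
          continuousAt_const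
      have := hcont.tendsto.mono_left (nhdsWithin_le_nhds (s := Ioi 0))
      simpa [zero_rpow hα.1.ne'] using this
    have hlim := tendsto_tsum_of_dominated_convergence (𝓕 := 𝓝[>] (0 : ℝ))
      (hsum.mul_right (C * x ^ (α - 1)))
      (fun m : ℕ => ((hone.pow m).mul ((hD (m * μ) (hc m)).2 x hx0 hxR)).const_mul
        (timeCoeff β ξ t m))
      (by
        filter_upwards [self_mem_nhdsWithin, Ioc_mem_nhdsGT (lt_min hh₀ hx0)] with h h1 h2 m
        exact hterm m h x h1 (h2.2.trans (min_le_left _ _)) (h2.2.trans (min_le_right _ _)) hxR)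
    simp only [one_pow, one_mul] at hlim
    exact hlim.congr fun h => (heq h x).symm

/-- The prefactor cancels the zeroth Taylor coefficient in every order, so `p_0` does not depend on
`λ` and hence not on `h`; it is the mass of the limiting atom. -/
theorem stateProb_zero_index (α μ β ξ t : ℝ) {lam : ℝ} (hlam : 0 < lam) :
    stateProb α μ β lam ξ 0 t = ∑' m, timeCoeff β ξ t m := by
  refine tsum_congr fun m => ?_
  rw [stateTerm_eq_timeCoeff, discPrabhakar_eq, coeff_zero_mlPS, ← rpow_natCast, ← rpow_mul
    (by positivity), mul_comm μ, ← mul_rpow (by positivity) (by positivity),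
    mul_one_div_cancel (by positivity), one_rpow, mul_one]

theorem IsTest.tendsto_average {φ : ℝ → ℝ} (hφ : IsTest φ) :
    Tendsto (fun h : ℝ => 1 / h * ∫ x in Ioo (0 : ℝ) h, φ x) (𝓝[>] 0) (𝓝 (φ 0)) := by
  have hd : HasDerivAt (fun u : ℝ => ∫ x in (0 : ℝ)..u, φ (max x 0)) (φ (max 0 0)) 0 :=
    (hφ.continuous_max.integral_hasStrictDerivAt 0 0).hasDerivAt
  have h1 := hd.tendsto_slope_zero_right
  rw [max_self] at h1
  refine h1.congr' ?_
  filter_upwards [self_mem_nhdsWithin] with h hh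
  have hh : 0 < h := hh
  rw [zero_add, intervalIntegral.integral_same, sub_zero, smul_eq_mul, one_div,
    intervalIntegral.integral_of_le hh.le, integral_Ioc_eq_integral_Ioo]
  congr 1
  exact setIntegral_congr_fun measurableSet_Ioo fun x hx => by rw [max_eq_left hx.1.le]

include hα hμ hβ hξ hlam

/-- For fixed `h` the probabilities lie in `[0, 1]`, so the step function is bounded by `1/h`. -/
theorem integrableOn_stateProb_floor_mul {h t : ℝ} (hh : 0 < h) (ht : 0 ≤ t) {φ : ℝ → ℝ}
    (hφ : IsTest φ) :
    IntegrableOn (fun x => 1 / h * stateProb α μ β (lam₀ * h ^ α) ξ ⌊x / h⌋₊ t * φ x)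
      (Ioi 0) := by
  have hl : 0 < lam₀ * h ^ α := by positivity
  refine hφ.integrableOn_mul fun R hR => ?_
  refine Measure.integrableOn_of_bounded (M := 1 / h) (by simp) ?_ ?_
  · have : Measurable fun n : ℕ => 1 / h * stateProb α μ β (lam₀ * h ^ α) ξ n t :=
      measurable_from_top
    exact (this.comp (Nat.measurable_floor.comp (measurable_id.div_const h))).aestronglyMeasurable
  · refine Eventually.of_forall fun x => ?_
    have h0 := fun n => stateProb_nonneg (ξ := ξ) hα hμ hβ hξ hl n ht
    have h1 := le_hasSum (hasSum_stateProb (ξ := ξ) hα hμ hβ hl ht) ⌊x / h⌋₊ fun n _ => h0 n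
    rw [norm_mul, Real.norm_of_nonneg (by positivity), Real.norm_of_nonneg (h0 _)]
    exact mul_le_of_le_one_right (by positivity) h1

/-- The integral is split at `x = h`. On `(0, h)` the integer part is `0`, and `p_0` times the
average of `φ` over the cell gives the atom. On `[h, ∞)` the bound `C x^{α-1}` holds and dominated
convergence gives the density part. -/
theorem tendsto_integral_stateProb_scaled {t : ℝ} (ht : 0 ≤ t) {φ : ℝ → ℝ} (hφ : IsTest φ) :
    Tendsto (fun h : ℝ => ∫ x in Ioi (0 : ℝ),
      1 / h * stateProb α μ β (lam₀ * h ^ α) ξ ⌊x / h⌋₊ t * φ x) (𝓝[>] 0)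
      (𝓝 (stateKernel α μ β lam₀ ξ t φ)) := by
  obtain ⟨R, -, hR, -, -, hz⟩ := hφ.exists_bound
  obtain ⟨C, h₀, hh₀, hb, hlim⟩ := exists_bound_stateProb_scaled (ξ := ξ) hα hμ hβ hlam ht R
  set F : ℝ → ℝ → ℝ := fun h x =>
    1 / h * stateProb α μ β (lam₀ * h ^ α) ξ ⌊x / h⌋₊ t * φ x with hF
  have hFi : ∀ h, 0 < h → IntegrableOn (F h) (Ioi 0) := fun h hh =>
    integrableOn_stateProb_floor_mul hα hμ hβ hξ hlam hh ht hφ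
  have hmain : Tendsto (fun h : ℝ => ∫ x in Ioi (0 : ℝ), (Ici h).indicator (F h) x) (𝓝[>] 0)
      (𝓝 (∫ x in Ioi (0 : ℝ), stateDensity α μ β lam₀ ξ t x * φ x)) := by
    refine tendsto_integral_filter_of_dominated_convergence
      (fun x => |C| * (x ^ (α - 1) * |φ x|)) ?_ ?_ ?_ ?_
    · filter_upwards [self_mem_nhdsWithin] with h hh
      exact (hFi h hh).aestronglyMeasurable.indicator measurableSet_Ici
    · filter_upwards [self_mem_nhdsWithin, Ioc_mem_nhdsGT hh₀] with h hh hle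
      filter_upwards [ae_restrict_mem measurableSet_Ioi] with x hx
      have hx : 0 < x := hx
      by_cases hxh : x ∈ Ici h
      · rw [indicator_of_mem hxh, hF, norm_mul, Real.norm_eq_abs, Real.norm_eq_abs, ← mul_assoc]
        rcases le_total R x with hRx | hRx
        · rw [hz x hRx, abs_zero, mul_zero, mul_zero]
        · refine mul_le_mul_of_nonneg_right ((hb h x hh hle.2 hxh hRx).trans ?_) (abs_nonneg _)
          gcongr
          exact le_abs_self C
      · rw [indicator_of_notMem hxh, norm_zero]
        positivity
    · exact (hφ.abs.integrableOn_mul fun R hR => (integrableOn_rpow_sub_one hα.1 hR).1).const_mul _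
    · filter_upwards [ae_restrict_mem measurableSet_Ioi] with x hx
      have hx : 0 < x := hx
      rcases le_total R x with hRx | hRx
      · rw [hz x hRx, mul_zero]
        refine tendsto_const_nhds.congr fun h => ?_
        by_cases hxh : x ∈ Ici h
        · simp only [indicator_of_mem hxh, hF, hz x hRx, mul_zero]
        · rw [indicator_of_notMem hxh]
      · refine ((hlim x hx hRx).mul_const (φ x)).congr' ?_
        filter_upwards [Ioc_mem_nhdsGT hx] with h hh
        rw [indicator_of_mem (show x ∈ Ici h from hh.2)]
  have hatom := (hφ.tendsto_average.const_mul (∑' m, timeCoeff β ξ t m)).add hmain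
  rw [← (stateKernel_eq_atom_add_density hα.1 hμ hβ hlam ht hφ).2] at hatom
  refine hatom.congr' ?_
  filter_upwards [self_mem_nhdsWithin] with h hh
  have hh : 0 < h := hh
  have hsplit : Ioi (0 : ℝ) = Ioo 0 h ∪ Ici h := (Ioo_union_Ici_eq_Ioi hh).symm
  have hI := hFi h hh
  have e1 : ∫ x in Ioi (0 : ℝ), (Ici h).indicator (F h) x = ∫ x in Ici h, F h x := by
    rw [setIntegral_indicator measurableSet_Ici,
      inter_eq_right.2 (Ici_subset_Ioi.2 hh)]
  have e2 : ∫ x in Ioo (0 : ℝ) h, F h x =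
      (∑' m, timeCoeff β ξ t m) * (1 / h * ∫ x in Ioo (0 : ℝ) h, φ x) := by
    rw [← mul_assoc, mul_comm _ (1 / h), ← integral_const_mul]
    refine setIntegral_congr_fun measurableSet_Ioo fun x hx => ?_
    have : ⌊x / h⌋₊ = 0 := Nat.floor_eq_zero.2 ((div_lt_one hh).2 hx.2)
    simp only [hF]
    rw [this, stateProb_zero_index _ _ _ _ _ (by positivity)]
  have e3 : ∫ x in Ioi (0 : ℝ), F h x = (∫ x in Ioo (0 : ℝ) h, F h x) + ∫ x in Ici h, F h x := by
    have hu := hI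
    rw [hsplit] at hu ⊢
    exact setIntegral_union (disjoint_left.2 fun x hx hx' => not_le.2 hx.2 hx') measurableSet_Ici
      hu.left_of_union hu.right_of_union
  rw [e1, e3, e2]

end

end SpaceTimeML

end

/-! ### The main theorem -/

theorem mainTheorem9 (α μ β ξ : ℝ) (hα : α ∈ Ioc (0 : ℝ) 1) (hμ : μ ∈ Ioc (0 : ℝ) 1)
    (hβ : β ∈ Ioc (0 : ℝ) 1) (hξ : 0 < ξ) :
    (∀ lam : ℝ, 0 < lam →
      -- `g_{ML,α}(𝓛)^μ` is the subordination integral of `g_{ML,α}(𝓛)`,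
      (μ < 1 → ∀ i j : ℤ,
        IntegrableOn (fun τ : ℝ =>
          ((1 : Matrix ℤ ℤ ℝ) i j - utExp ((-τ) • lapFn (gMLpow α lam 1)) i j) * τ ^ (-μ - 1))
          (Ioi 0) ∧
        lapFn (gMLpow α lam μ) i j = -(1 / Real.Gamma (-μ)) * ∫ τ in Ioi (0 : ℝ),
          ((1 : Matrix ℤ ℤ ℝ) i j - utExp ((-τ) • lapFn (gMLpow α lam 1)) i j) * τ ^ (-μ - 1)) ∧
      -- it is the quotient `𝓛^{αμ} / (lam + 𝓛^α)^μ`,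
      utMul (lapFn (gMLpow α lam μ)) (lapFn (fun s => (lam + s ^ α) ^ μ)) =
        lapFn (fun s => s ^ (α * μ)) ∧
      -- and a good Laplacian (Bernstein) matrix function.
      IsGoodLaplacian (lapFn (gMLpow α lam μ)) ∧
      IsLaplacianBernstein (gMLpow α lam μ) ∧
      -- The discrete Cauchy problem: explicit solution, uniqueness, probabilities.
      (∀ n t, 0 ≤ t → Summable (stateTerm α μ β lam ξ n t)) ∧
      IsDiscreteSolution α μ β lam ξ (stateProb α μ β lam ξ) ∧
      (∀ p, IsDiscreteSolution α μ β lam ξ p →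
        ∀ n t, 0 ≤ t → p n t = stateProb α μ β lam ξ n t) ∧
      (∀ n t, 0 ≤ t → 0 ≤ stateProb α μ β lam ξ n t) ∧
      (∀ t, 0 ≤ t → HasSum (fun n => stateProb α μ β lam ξ n t) 1) ∧
      -- Explicit series of the discrete Prabhakar kernels.
      (lam < 1 → ∀ m n : ℕ,
        HasSum (fun s : ℕ => 1 / (n.factorial : ℝ) *
          ((-lam) ^ s * poch (m * μ) s / (s.factorial : ℝ) * poch (α * s) n))
          (discPrabhakar α (m * μ) lam n)) ∧
      (1 < lam → ∀ m n : ℕ,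
        HasSum (fun s : ℕ => (-1) ^ n * lam ^ (-(m * μ)) / (n.factorial : ℝ) *
          ((-1) ^ s * (lam ^ s)⁻¹ * poch (m * μ) s / (s.factorial : ℝ) * fall (α * (s + m * μ)) n))
          (discPrabhakar α (m * μ) lam n))) ∧
    (∀ lam₀ : ℝ, 0 < lam₀ →
      -- Convergence of the series and integrals that define the limit kernel.
      (∀ (m : ℕ) x, 0 < x → Summable (kernelTerm α (m * μ) lam₀ x)) ∧
      (∀ (m : ℕ) R, 0 < R → IntegrableOn (kernelReg α (m * μ) lam₀) (Ioc 0 R)) ∧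
      (∀ (m : ℕ) z, Summable (prabhakarTerm α 1 (m * μ) z)) ∧
      (∀ t, 0 ≤ t → ∀ φ, IsTest φ →
        Summable (fun m : ℕ => timeCoeff β ξ t m * prabhakarKernel α (m * μ) lam₀ φ)) ∧
      (∀ t, 0 ≤ t → ∀ x, 0 < x →
        Summable (fun m : ℕ => timeCoeff β ξ t m * kernelReg α (m * μ) lam₀ x)) ∧
      (∀ t, 0 ≤ t → ∀ x, 0 ≤ x →
        Summable (fun m : ℕ => timeCoeff β ξ t m * prabhakarE α 1 (m * μ) (-lam₀ * x ^ α))) ∧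
      -- The well-scaled limit, for every `x > 0` and as distributions on `[0, ∞)`.
      (∀ t, 0 ≤ t → ∀ x, 0 < x →
        Tendsto (fun h : ℝ => 1 / h * stateProb α μ β (lam₀ * h ^ α) ξ ⌊x / h⌋₊ t) (𝓝[>] 0)
          (𝓝 (stateDensity α μ β lam₀ ξ t x))) ∧
      (∀ t, 0 ≤ t → ∀ φ, IsTest φ →
        Tendsto (fun h : ℝ => ∫ x in Ioi (0 : ℝ),
            1 / h * stateProb α μ β (lam₀ * h ^ α) ξ ⌊x / h⌋₊ t * φ x) (𝓝[>] 0)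
          (𝓝 (stateKernel α μ β lam₀ ξ t φ))) ∧
      -- The limit kernel: atom and density, and as a distributional derivative.
      (∀ t, 0 ≤ t → ∀ φ, IsTest φ →
        IntegrableOn (fun x => stateDensity α μ β lam₀ ξ t x * φ x) (Ioi 0) ∧
        stateKernel α μ β lam₀ ξ t φ = (∑' m : ℕ, timeCoeff β ξ t m) * φ 0 +
          ∫ x in Ioi (0 : ℝ), stateDensity α μ β lam₀ ξ t x * φ x) ∧
      (∀ t, 0 ≤ t → ∀ φ : ℝ → ℝ, ContDiff ℝ 1 φ → HasCompactSupport φ →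
        IntegrableOn (fun x => stateCdf α μ β lam₀ ξ t x * deriv φ x) (Ioi 0) ∧
        stateKernel α μ β lam₀ ξ t φ =
          -∫ x in Ioi (0 : ℝ), stateCdf α μ β lam₀ ξ t x * deriv φ x) ∧
      -- The jump kernel.
      (∀ x, 0 < x → DifferentiableAt ℝ (fun y : ℝ => prabhakarE α 1 μ (-lam₀ * y ^ α)) x ∧
        jumpKernel α μ lam₀ x = -kernelReg α μ lam₀ x ∧
        HasSum (fun s : ℕ => lam₀ * x ^ (α - 1) * (poch μ (s + 1) / ((s + 1).factorial : ℝ) *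
          (-lam₀ * x ^ α) ^ s / Real.Gamma (α * s + α))) (jumpKernel α μ lam₀ x)) ∧
      -- The limit kernel solves the continuous Cauchy problem.
      IsContinuousSolution β ξ (jumpKernel α μ lam₀) (stateKernel α μ β lam₀ ξ)) := by
  have hpow : ∀ m : ℕ, 0 ≤ (m : ℝ) * μ := fun m => mul_nonneg (Nat.cast_nonneg m) hμ.1.le
  refine ⟨fun lam hlam => ⟨fun hμ1 i j => lapFn_subordination hlam ⟨hμ.1, hμ1⟩ i j,
    utMul_lapFn_gMLpow α μ hlam, isGoodLaplacian_gMLpow hα hlam hμ,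
    isLaplacianBernstein_gMLpow hα hlam hμ,
    fun n t ht => summable_stateTerm hα hμ hβ hlam n ht,
    isDiscreteSolution_stateProb hα hμ hβ hlam,
    fun p hp n t ht => eq_stateProb hα hμ hβ hξ hlam hp n ht,
    fun n t ht => stateProb_nonneg hα hμ hβ hξ hlam n ht,
    fun t ht => hasSum_stateProb hα hμ hβ hlam ht,
    fun h1 m n => hasSum_discPrabhakar_of_lt_one hα hlam (hpow m) h1 n,
    fun h1 m n => hasSum_discPrabhakar_of_one_lt hα hlam (hpow m) h1 n⟩,
    fun lam₀ hlam => ⟨fun m x hx => ?_, fun m R hR => integrableOn_kernelReg hα.1 hlam (hpow m) hR,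
    fun m z => summable_prabhakarTerm hα.1 (hpow m) z,
    fun t ht φ hφ => summable_stateKernel hα.1 hμ hβ hlam ht hφ,
    fun t ht x hx => summable_timeCoeff_mul hβ.1 ξ (geomBdd_kernelReg hα.1 hμ hlam hx) ht,
    fun t ht x hx => summable_timeCoeff_mul hβ.1 ξ (geomBdd_prabhakarE hα.1 hμ hlam hx) ht,
    fun t ht x hx => ?_,
    fun t ht φ hφ => tendsto_integral_stateProb_scaled hα hμ hβ hξ hlam ht hφ,
    fun t ht φ hφ => stateKernel_eq_atom_add_density hα.1 hμ hβ hlam ht hφ,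
    fun t ht φ hφ hcs => stateKernel_eq_neg_integral_stateCdf hα.1 hμ hβ hlam ht hφ hcs,
    fun x hx => ⟨(hasDerivAt_prabhakarE hα.1 hlam hμ.1.le hx).differentiableAt,
      jumpKernel_eq hα.1 hlam hμ.1.le hx, hasSum_jumpKernel hα.1 hlam hμ.1.le hx⟩,
    isContinuousSolution_stateKernel hα.1 hμ hβ hlam⟩⟩
  · exact (summable_mlDeriv' hα.1 (geomBdd_kerCoeff (hpow m) hlam) hx).congr fun s =>
      (kernelTerm_eq α (m * μ) lam₀ x s).symm
  -- The limit is asserted for all points up to `R`; taking `R = x` covers the given point.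
  · obtain ⟨_, _, _, _, h⟩ := exists_bound_stateProb_scaled (ξ := ξ) hα hμ hβ hlam ht x
    exact h x hx le_rfl
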